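/- **Setting.** Let ${\sf X}$ be a finite set and let $\{P_\zeta:\zeta\in\mathbb R\}$ be transition matrices on ${\sf X}$ such that $\zeta\mapsto P_\zeta$ is $C^2$ near $\zeta=0$ with Lipschitz second derivative, and $P_0$ is irreducible and aperiodic, with invariant pmf $\pi_0$. Put ${\cal E}=\frac{d}{d\zeta}P_\zeta|_{\zeta=0}$ and ${\cal E}^{(2)}=\frac{d^2}{d\zeta^2}P_\zeta|_{\zeta=0}$. Let $\zeta^1=(\zeta^1_t)_{t\in\mathbb Z}$ be a real stationary process with zero mean, $|\zeta^1_t|\le 1$ a.s., and $|{\rm Cov}(\zeta^1_0,\zeta^1_t)|\le b\rho^{|t|}$ for some $b<\infty$, $|\rho|<1$. For $\varepsilon\ge0$, a *stationary realization* is a jointly stationary process $(\zeta_t,X_t)_{t\in\mathbb Z}$ such that $\zeta$ has the law of $\varepsilon\zeta^1$ and ${\sf P}\{X_{t+1}=y\mid X_r, r\le t;\ \zeta_s, s\in\mathbb Z\}=P_{\zeta_t}(X_t,y)$. With $\Gamma_t$ the indicator row vector of $X_t$, put $\Delta_{t+1}=\Gamma_{t+1}-\Gamma_tP_{\zeta_t}$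 and $D_{t+1}=\zeta_t\Gamma_t{\cal E}+\frac12\zeta_t^2\Gamma_t{\cal E}^{(2)}+\Delta_{t+1}$. For $\ell:{\sf X}\to\mathbb R$ and a stable causal filter $H_{\cal L}$ with impulse response $h$, $\sum_{k\ge0}|h_k|<\infty$, put $L_t=\ell(X_t)$, ${\cal L}_t=H_{\cal L}L_t=\sum_{k\ge 0}h_kL_{t-k}$, $H_{\cal L}(e^{i\theta})=\sum_k h_ke^{-ik\theta}$, and ${\cal V}_{\cal L}={\rm Var}({\cal L}_t)$. The power spectral density (PSD) of a stationary process $Y$ with absolutely summable autocovariance $R_Y(k)={\rm Cov}(Y_0,Y_k)$ is $S_Y(\theta)=\sum_{k\in\mathbb Z}R_Y(k)e^{-ik\theta}$ (matrix-valued for $Y=D$). **(i)** Consider any stationary realization with $0\le\varepsilon<1$. If the autocovariance of ${\cal L}$ is absolutely summable (so that its PSD exists), then $${\cal V}_{\cal L}=\frac1{2\pi}\int_0^{2\pi}S_{\cal L}(\theta)\,d\theta .$$ If the autocovariance of $L$ is absolutely summable, then so is that of ${\cal L}$, and $S_{\cal L}(\theta)=|H_{\cal L}(e^{i\theta})|^2S_L(\theta)$;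 moreover, for the moving-window metric ${\cal L}_t=\sum_{k=0}^{T_f}\ell(X_{t-k})$, ${\cal V}_{\cal L}/T_f\to S_L(0)$ as $T_f\to\infty$. **(ii)** Let $S_D^\bullet\equiv{\rm diag}(\pi_0)-P_0^{T}{\rm diag}(\pi_0)P_0$ (the PSD of $D$ when $\zeta\equiv0$). There is an absolutely summable sequence of matrices $R_D^{(2)}(k)$, $k\in\mathbb Z$, depending only on $(P_\zeta)$ and the law of $\zeta^1$, with Fourier series $S_D^{(2)}(\theta)=\sum_kR_D^{(2)}(k)e^{-ik\theta}$, such that the following hold as $\varepsilon\downarrow0$, for all stationary realizations at level $\varepsilon$ and uniformly over them. * $R_D(k)=R_D^\bullet(k)+\varepsilon^2R_D^{(2)}(k)+o(\varepsilon^2)$ uniformly in $k$, where $R_D^\bullet(0)=S_D^\bullet$ and $R_D^\bullet(k)=0$ for $k\neq0$. If in addition the entries of $R_D(k)$ are bounded by $b'\rho'^{|k|}$, with $b'<\infty$ and $|\rho'|<1$ not depending on $\varepsilon$, then $S_D(\theta)=S_D^\bullet+\varepsilon^2S_D^{(2)}(\theta)+o(\varepsilon^2)$ uniformly in $\theta$.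 * For every $\ell$ and every stable $H_{\cal L}$, ${\cal V}_{\cal L}={\cal V}^\bullet_{\cal L}+\varepsilon^2{\cal V}^{(2)}_{\cal L}+o(\varepsilon^2)$, where $${\cal V}_{\cal L}^\bullet=\frac1{2\pi}\int_0^{2\pi}|H_{\cal L}(e^{i\theta})|^2\,g(\theta)^*S_D^\bullet\,g(\theta)\,d\theta,\qquad {\cal V}_{\cal L}^{(2)}=\frac1{2\pi}\int_0^{2\pi}|H_{\cal L}(e^{i\theta})|^2\,g(\theta)^*S_D^{(2)}(\theta)\,g(\theta)\,d\theta,$$ and $g(\theta)=(I-e^{-i\theta}(P_0-{\bf 1}\pi_0))^{-1}\ell$ is the transfer vector from $D$ to $L$ in the linear model $\widehat\Gamma_{t+1}=\widehat\Gamma_tP_0+D_{t+1}$, $L_t=\widehat\Gamma_t\ell$ (the entries of $D_t$ sum to zero, so that $P_0$ may be replaced by $P_0-{\bf 1}\pi_0$). -/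

import Mathlib

open MeasureTheory ProbabilityTheory Filter Topology Matrix

universe u v

noncomputable section

/-! ### The controlled transition matrix -/

section Model

variable {S : Type*} [Fintype S] [DecidableEq S]

/-- A (row-)stochastic matrix is aperiodic if, for every state `x`, the greatest common divisor of
the return times `{n ≥ 1 | Pⁿ(x,x) > 0}` is one. -/
def IsAperiodic (P : Matrix S S ℝ) : Prop :=
  ∀ x : S, ∀ d : ℕ, (∀ n : ℕ, 0 < n → 0 < (P ^ n) x x → d ∣ n) → d = 1

/-- Standing assumption on the family `ζ ↦ P_ζ` of transition matrices: it is `C²` in a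
neighbourhood of `0`, with Lipschitz second derivative, and `P_0` is irreducible and aperiodic. -/
structure IsSmoothControlledMatrix (P : ℝ → Matrix S S ℝ) : Prop where
  stochastic : ∀ z : ℝ, P z ∈ Matrix.rowStochastic ℝ S
  smooth : ∃ r : ℝ, 0 < r ∧ ∃ K : NNReal, ∀ x y : S,
    ContDiffOn ℝ 2 (fun z => P z x y) (Set.Ioo (-r) r) ∧
    LipschitzOnWith K (iteratedDeriv 2 fun z => P z x y) (Set.Ioo (-r) r)
  irreducible : (P 0).IsIrreducible
  aperiodic : IsAperiodic (P 0)

/-- `π` is an invariant probability mass function of the transition matrix `P`. -/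
def IsInvariantPmf (P : Matrix S S ℝ) (π : S → ℝ) : Prop :=
  (∀ x, 0 ≤ π x) ∧ ∑ x, π x = 1 ∧ π ᵥ* P = π

/-- The first derivative of `ζ ↦ P_ζ` at `0`. -/
def firstDeriv (P : ℝ → Matrix S S ℝ) : Matrix S S ℝ :=
  Matrix.of fun x y => deriv (fun z => P z x y) 0

/-- The second derivative of `ζ ↦ P_ζ` at `0`. -/
def secondDeriv (P : ℝ → Matrix S S ℝ) : Matrix S S ℝ :=
  Matrix.of fun x y => iteratedDeriv 2 (fun z => P z x y) 0

end Model

/-! ### The input and the stationary realization -/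

/-- Standing assumption on the law `ν` of the unscaled input `ζ¹ = (ζ¹_t)_{t ∈ ℤ}`: a stationary
process with zero mean, bounded by one, whose autocovariance decays geometrically. -/
structure IsInputLaw (ν : Measure (ℤ → ℝ)) : Prop where
  prob : IsProbabilityMeasure ν
  stationary : ∀ s : ℤ, ν.map (fun z t => z (t + s)) = ν
  bounded : ∀ t : ℤ, ∀ᵐ z ∂ν, |z t| ≤ 1
  mean_zero : ∀ t : ℤ, ∫ z, z t ∂ν = 0
  autocov_decay : ∃ b ρ : ℝ, |ρ| < 1 ∧
    ∀ t : ℤ, |cov[fun z : ℤ → ℝ => z 0, fun z => z t; ν]| ≤ b * ρ ^ t.natAbs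

/-- `(ζ, X)` is a stationary realization, at level `ε`, of the load model on the probability space
`(Ω, μ)`: the input `ζ` has the law of `ε ζ¹`, the pair `(ζ, X)` is jointly stationary, and, given
the exogenous input and the past of `X`, the next state is drawn according to `P_{ζ_t}(X_t, ·)`. -/
structure IsStationaryRealization {S : Type*} [Fintype S] [DecidableEq S] [MeasurableSpace S]
    (P : ℝ → Matrix S S ℝ) (ν : Measure (ℤ → ℝ)) (ε : ℝ)
    {Ω : Type*} [MeasurableSpace Ω] (μ : Measure Ω) (ζ : ℤ → Ω → ℝ) (X : ℤ → Ω → S) : Prop where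
  prob : IsProbabilityMeasure μ
  measurable_input : ∀ t, Measurable (ζ t)
  measurable_state : ∀ t, Measurable (X t)
  law_input : μ.map (fun ω t => ζ t ω) = ν.map (fun z t => ε * z t)
  stationary : ∀ s : ℤ, μ.map (fun ω t => (ζ (t + s) ω, X (t + s) ω)) =
    μ.map (fun ω t => (ζ t ω, X t ω))
  transition : ∀ (t : ℤ) (y : S),
    μ[{ω | X (t + 1) ω = y}.indicator (fun _ => (1 : ℝ)) |
      (⨆ s : ℤ, MeasurableSpace.comap (ζ s) inferInstance) ⊔
        (⨆ r : ℤ, ⨆ _ : r ≤ t, MeasurableSpace.comap (X r) inferInstance)]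
      =ᵐ[μ] fun ω => P (ζ t ω) (X t ω) y

section Processes

variable {S : Type*} [Fintype S] [DecidableEq S] {Ω : Type*}

/-- The martingale difference `Δ_t = Γ_t - Γ_{t-1} P_{ζ_{t-1}}`, where `Γ_t` is the indicator row
vector of the state `X_t`. -/
def martingaleNoise (P : ℝ → Matrix S S ℝ) (ζ : ℤ → Ω → ℝ) (X : ℤ → Ω → S)
    (t : ℤ) (ω : Ω) : S → ℝ :=
  Pi.single (X t ω) 1 - Pi.single (X (t - 1) ω) 1 ᵥ* P (ζ (t - 1) ω)

/-- The driving noise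
`D_t = ζ_{t-1} Γ_{t-1} ℰ + ½ ζ_{t-1}² Γ_{t-1} ℰ⁽²⁾ + Δ_t`, where `ℰ`, `ℰ⁽²⁾` are the first two
derivatives of `P` at `0`. -/
def drivingNoise (P : ℝ → Matrix S S ℝ) (ζ : ℤ → Ω → ℝ) (X : ℤ → Ω → S)
    (t : ℤ) (ω : Ω) : S → ℝ :=
  ζ (t - 1) ω • (Pi.single (X (t - 1) ω) 1 ᵥ* firstDeriv P)
    + (ζ (t - 1) ω ^ 2 / 2) • (Pi.single (X (t - 1) ω) 1 ᵥ* secondDeriv P)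
    + martingaleNoise P ζ X t ω

/-- The unfiltered signal `L_t = ℓ(X_t)`. -/
def loadSignal (ℓ : S → ℝ) (X : ℤ → Ω → S) (t : ℤ) (ω : Ω) : ℝ := ℓ (X t ω)

/-- The QoS `ℒ_t = ∑_{k ≥ 0} h_k ℓ(X_{t-k})`: the signal `ℓ(X_t)` filtered by the causal filter
with impulse response `h`. -/
def qos (h : ℕ → ℝ) (ℓ : S → ℝ) (X : ℤ → Ω → S) (t : ℤ) (ω : Ω) : ℝ :=
  ∑' k : ℕ, h k * ℓ (X (t - k) ω)

/-- Impulse response of the moving window: `ℒ_t = ∑_{k=0}^{T} ℓ(X_{t-k})`. -/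
def windowResponse (T : ℕ) (k : ℕ) : ℝ := if k ≤ T then 1 else 0

end Processes

/-! ### Second-order statistics -/

/-- Autocovariance of a real (stationary) process. -/
def autocov {Ω : Type*} [MeasurableSpace Ω] (μ : Measure Ω) (Y : ℤ → Ω → ℝ) (k : ℤ) : ℝ :=
  cov[Y 0, Y k; μ]

/-- Autocovariance matrices `R(k) = Cov(Y_0, Y_k)` of a vector-valued (stationary) process. -/
def autocovMatrix {Ω S : Type*} [MeasurableSpace Ω] (μ : Measure Ω) (Y : ℤ → Ω → S → ℝ) (k : ℤ) :
    Matrix S S ℝ :=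
  Matrix.of fun i j => cov[fun ω => Y 0 ω i, fun ω => Y k ω j; μ]

/-- Power spectral density `∑_k R(k) e^{-ikθ}` of an (absolutely summable) autocovariance. -/
def psd (R : ℤ → ℝ) (θ : ℝ) : ℂ :=
  ∑' k : ℤ, (R k : ℂ) * Complex.exp (-((k : ℂ) * θ * Complex.I))

/-- Matrix-valued power spectral density. -/
def psdMatrix {S : Type*} (R : ℤ → Matrix S S ℝ) (θ : ℝ) : Matrix S S ℂ :=
  Matrix.of fun i j => psd (fun k => R k i j) θ

/-- Frequency response `H(e^{iθ}) = ∑_k h_k e^{-ikθ}` of the filter with impulse response `h`. -/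
def freqResponse (h : ℕ → ℝ) (θ : ℝ) : ℂ :=
  ∑' k : ℕ, (h k : ℂ) * Complex.exp (-((k : ℂ) * θ * Complex.I))

/-- Average of a spectral density over one period. -/
def spectralAverage (f : ℝ → ℂ) : ℂ :=
  (1 / (2 * (Real.pi : ℂ))) * ∫ θ in (0 : ℝ)..(2 * Real.pi), f θ

section LinearModel

variable {S : Type*} [Fintype S] [DecidableEq S]

/-- Autocovariance of the driving noise when `ζ ≡ 0`: white, with covariance
`diag(π) - P₀ᵀ diag(π) P₀`. -/
def nominalNoiseCov (P₀ : Matrix S S ℝ) (π : S → ℝ) (k : ℤ) : Matrix S S ℝ :=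
  if k = 0 then Matrix.diagonal π - P₀ᵀ * Matrix.diagonal π * P₀ else 0

/-- Transfer vector from `D` to `L` in the linear model `Γ̂_{t+1} = Γ̂_t P₀ + D_{t+1}`,
`L_t = Γ̂_t ℓ`. The entries of `D_t` sum to zero, and on row vectors with this property `P₀` acts
as the matrix `P₀ - 1 ⊗ π`, whose spectral radius is less than one; hence
`e^{iθ} (e^{iθ} I - P₀)⁻¹ ℓ` is written with `P₀ - 1 ⊗ π`, which removes the pole at `θ = 0`. -/
def transferVector (P₀ : Matrix S S ℝ) (π : S → ℝ) (ℓ : S → ℝ) (θ : ℝ) : S → ℂ :=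
  (1 - Complex.exp (-((θ : ℂ) * Complex.I)) •
      (P₀ - Matrix.of fun _ y => π y).map (fun a : ℝ => (a : ℂ)))⁻¹ *ᵥ fun x => (ℓ x : ℂ)

/-- The spectral density of QoS that the linear model followed by the filter `h` assigns to a
driving noise with spectral density `SD`. -/
def linearModelPsd (P₀ : Matrix S S ℝ) (π : S → ℝ) (ℓ : S → ℝ) (h : ℕ → ℝ)
    (SD : ℝ → Matrix S S ℂ) (θ : ℝ) : ℂ :=
  (‖freqResponse h θ‖ : ℂ) ^ 2 *
    (star (transferVector P₀ π ℓ θ) ⬝ᵥ (SD θ *ᵥ transferVector P₀ π ℓ θ))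

end LinearModel

end

/-! Let Γ_t be the indicator row vector of X_t and A = P_0 − 1⊗π. The entries of Γ_t sum to one, so
D_t = Γ_t − Γ_{t−1}A − π − (Taylor remainder), with a remainder of size O(ε³) (`drivingNoise_eq`).
Part (ii) therefore rests on one fact: Cov(Γ_0, Γ_k) = G₀(k) + ε²G₂(k) + O(ε³), uniformly in k, with
G₂ absolutely summable and determined by P and ν; then R_D⁽²⁾ = `noiseCov A G₂`
(`exists_expansion`).

To expand this covariance, condition on the past. For a bounded weight W that depends on the whole
input and on the states up to time t, E[WΓ_{t+1}] equals E[WΓ_t]P_0 + E[ζ_tWΓ_t]ℰ + ½E[ζ_t²WΓ_t]ℰ⁽²⁾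
up to O(ε³). Subtracting E[W]π turns P_0 into A, whose powers are absolutely summable by Doeblin
minorization (`summable_norm_vecMulCLM_pow`); errors then accumulate by a constant factor only,
whatever the horizon. The forcing terms have the same form with extra factors ζ, each worth ε, so
the hierarchy closes at second order. Weights that depend on the input alone allow the recursion to
be started at −∞, where the initial value is forgotten (`norm_sub_tsum_backward_le`). Weights
containing the centered indicator of X_0 are propagated forward from time 0
(`norm_sub_recursionSol_le`). The chain of estimates ends with `norm_covShift_sub_le`.

The variance of the filtered signal is a linear functional of the covariances of Γ, bounded in the
sup norm over lags because h is in ℓ¹. Hence the uniform O(ε³) error suffices and no decay in k is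
needed. On the frequency side, passing from Γ to D is a congruence by I − e^{−iθ}A, which the
transfer vector inverts (`linearModelPsd_noiseCov`); so the two spectral integrals are this
functional evaluated at G₀ and G₂.

The spectral density of D requires summing the errors over the lags. Each error is at most the
smaller of Cε³ and a geometric term plus ε² times a summable one, and dominated convergence makes
the sum o(ε²) (`exists_tsum_le`).

Part (i) combines orthogonality of characters, absolute convergence of the filter sums
(`psd_filteredCov`), and Cesàro means for the moving window. -/

noncomputable section

set_option linter.unusedSectionVars false

/-! ### Perturbed linear recursions -/

section Recursion

variable {V : Type*} [NormedAddCommGroup V] [NormedSpace ℝ V]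

/-- The solution of `v (n + 1) = A (v n) + g n` started at `v₀`. -/
def recursionSol (A : V →L[ℝ] V) (g : ℕ → V) (v₀ : V) : ℕ → V
  | 0 => v₀
  | n + 1 => A (recursionSol A g v₀ n) + g n

/-- Variation of constants for an arbitrary sequence: its failure to satisfy the homogeneous
recursion acts as the source. Since l < n, the exponent `n - 1 - l` is never truncated. -/
lemma eq_pow_add_sum_defect (A : V →L[ℝ] V) (e : ℕ → V) (n : ℕ) :
    e n = (A ^ n) (e 0) +
      ∑ l ∈ Finset.range n, (A ^ (n - 1 - l)) (e (l + 1) - A (e l)) := by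
  induction n with
  | zero => simp
  | succ n ih =>
    rw [Finset.sum_range_succ]
    have h1 : ∑ l ∈ Finset.range n, (A ^ (n + 1 - 1 - l)) (e (l + 1) - A (e l)) =
        A (∑ l ∈ Finset.range n, (A ^ (n - 1 - l)) (e (l + 1) - A (e l))) := by
      rw [map_sum]
      refine Finset.sum_congr rfl fun l hl => ?_
      have : n + 1 - 1 - l = (n - 1 - l) + 1 := by
        have := Finset.mem_range.1 hl; omega
      rw [this, pow_succ']; rfl
    rw [h1, pow_succ']
    have h2 : A (e n) = A ((A ^ n) (e 0)) +
        A (∑ l ∈ Finset.range n, (A ^ (n - 1 - l)) (e (l + 1) - A (e l))) := by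
      rw [← map_add, ← ih]
    simp only [mul_apply_eq_comp, add_tsub_cancel_right, tsub_self, pow_zero,
      one_apply_eq_self]
    rw [← add_assoc, ← h2]; abel

lemma sum_norm_pow_le {A : V →L[ℝ] V} (hA : Summable fun n : ℕ => ‖A ^ n‖) (n : ℕ) :
    ∑ m ∈ Finset.range n, ‖A ^ m‖ ≤ ∑' m : ℕ, ‖A ^ m‖ :=
  hA.sum_le_tsum _ fun _ _ => norm_nonneg _

/-- Every defect is transported by some power of A, each power occurring once, so the total error is
independent of n. Only steps before n are tested, which allows a source depending on the terminal
time. -/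
lemma norm_sub_recursionSol_le {A : V →L[ℝ] V} (hA : Summable fun n : ℕ => ‖A ^ n‖)
    {v g : ℕ → V} {v₀ : V} {η : ℝ} (n : ℕ) (h0 : ‖v 0 - v₀‖ ≤ η)
    (h : ∀ m < n, ‖v (m + 1) - (A (v m) + g m)‖ ≤ η) :
    ‖v n - recursionSol A g v₀ n‖ ≤ (∑' m : ℕ, ‖A ^ m‖) * η := by
  have hη : 0 ≤ η := (norm_nonneg _).trans h0
  have key := eq_pow_add_sum_defect A (fun m => v m - recursionSol A g v₀ m) n
  beta_reduce at key
  rw [key]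
  have h1 : ‖∑ l ∈ Finset.range n, (A ^ (n - 1 - l)) (v (l + 1) - recursionSol A g v₀ (l + 1)
      - A (v l - recursionSol A g v₀ l))‖ ≤ ∑ l ∈ Finset.range n, ‖A ^ (n - 1 - l)‖ * η := by
    refine norm_sum_le_of_le _ fun l hl => (ContinuousLinearMap.le_opNorm _ _).trans ?_
    gcongr
    have he : v (l + 1) - recursionSol A g v₀ (l + 1) - A (v l - recursionSol A g v₀ l) =
        v (l + 1) - (A (v l) + g l) := by
      simp only [recursionSol, map_sub]; abel
    exact he ▸ h l (Finset.mem_range.1 hl)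
  have h2 : ‖(A ^ n) (v 0 - recursionSol A g v₀ 0)‖ ≤ ‖A ^ n‖ * η :=
    (ContinuousLinearMap.le_opNorm _ _).trans (by gcongr; exact h0)
  calc _ ≤ ‖A ^ n‖ * η + ∑ l ∈ Finset.range n, ‖A ^ (n - 1 - l)‖ * η :=
        (norm_add_le _ _).trans (add_le_add h2 h1)
    _ = (∑ m ∈ Finset.range (n + 1), ‖A ^ m‖) * η := by
        rw [Finset.sum_range_succ, add_mul, Finset.sum_mul,
          Finset.sum_range_reflect (fun m => ‖A ^ m‖ * η) n, add_comm]
    _ ≤ _ := by gcongr; exact sum_norm_pow_le hA _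

lemma recursionSol_eq (A : V →L[ℝ] V) (g : ℕ → V) (v₀ : V) (n : ℕ) :
    recursionSol A g v₀ n =
      (A ^ n) v₀ + ∑ l ∈ Finset.range n, (A ^ (n - 1 - l)) (g l) := by
  rw [eq_pow_add_sum_defect A (recursionSol A g v₀) n]
  simp [recursionSol]

lemma summable_convolution {a b : ℕ → ℝ} (ha : Summable a) (hb : Summable b)
    (ha0 : ∀ n, 0 ≤ a n) (hb0 : ∀ n, 0 ≤ b n) :
    Summable fun n => ∑ l ∈ Finset.range n, a (n - 1 - l) * b l := by
  rw [← summable_nat_add_iff 1]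
  have := summable_norm_sum_mul_range_of_summable_norm (f := b) (g := a) hb.norm ha.norm
  refine this.congr fun n => ?_
  rw [Real.norm_of_nonneg (Finset.sum_nonneg fun l _ => mul_nonneg (hb0 _) (ha0 _))]
  exact Finset.sum_congr rfl fun l _ => by rw [mul_comm]; rfl

lemma summable_norm_recursionSol {A : V →L[ℝ] V} (hA : Summable fun n : ℕ => ‖A ^ n‖)
    {g : ℕ → V} (hg : Summable fun n => ‖g n‖) (v₀ : V) :
    Summable fun n => ‖recursionSol A g v₀ n‖ := by
  refine Summable.of_nonneg_of_le (fun _ => norm_nonneg _) (fun n => ?_)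
    ((hA.mul_right ‖v₀‖).add
      (summable_convolution hA hg (fun _ => norm_nonneg _) fun _ => norm_nonneg _))
  rw [recursionSol_eq]
  refine (norm_add_le _ _).trans (add_le_add (ContinuousLinearMap.le_opNorm _ _) ?_)
  exact norm_sum_le_of_le _ fun l _ => ContinuousLinearMap.le_opNorm _ _

/-- Here `v m` is the value m steps in the past. Unrolling n steps leaves the term A^n (v n), which
vanishes in the limit because v is bounded: no initial condition survives. -/
lemma norm_sub_tsum_backward_le {A : V →L[ℝ] V} (hA : Summable fun n : ℕ => ‖A ^ n‖)
    {v g : ℕ → V} {η B : ℝ} (hB : ∀ n, ‖v n‖ ≤ B)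
    (hg : Summable fun m : ℕ => (A ^ m) (g m))
    (h : ∀ m, ‖v m - (A (v (m + 1)) + g m)‖ ≤ η) :
    ‖v 0 - ∑' m : ℕ, (A ^ m) (g m)‖ ≤ (∑' m : ℕ, ‖A ^ m‖) * η := by
  have hη : 0 ≤ η := (norm_nonneg _).trans (h 0)
  have key : ∀ n : ℕ, v 0 - ∑ m ∈ Finset.range n, (A ^ m) (g m) = (A ^ n) (v n) +
      ∑ m ∈ Finset.range n, (A ^ m) (v m - (A (v (m + 1)) + g m)) := by
    intro n
    induction n with
    | zero => simp
    | succ n ih =>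
      rw [Finset.sum_range_succ, Finset.sum_range_succ, ← sub_sub, ih]
      simp only [map_sub, map_add, pow_succ, mul_apply_eq_comp]
      abel
  have hbd : ∀ n : ℕ, ‖v 0 - ∑ m ∈ Finset.range n, (A ^ m) (g m)‖ ≤
      ‖A ^ n‖ * B + (∑' m : ℕ, ‖A ^ m‖) * η := by
    intro n
    rw [key]
    refine (norm_add_le _ _).trans (add_le_add ((ContinuousLinearMap.le_opNorm _ _).trans
      (by gcongr; exact hB n)) ?_)
    calc _ ≤ ∑ m ∈ Finset.range n, ‖A ^ m‖ * η :=
          norm_sum_le_of_le _ fun l _ =>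
            (ContinuousLinearMap.le_opNorm _ _).trans (by gcongr; exact h l)
      _ ≤ _ := by rw [← Finset.sum_mul]; gcongr; exact sum_norm_pow_le hA _
  have l1 : Tendsto (fun n : ℕ => ‖v 0 - ∑ m ∈ Finset.range n, (A ^ m) (g m)‖) atTop
      (𝓝 ‖v 0 - ∑' m : ℕ, (A ^ m) (g m)‖) :=
    (tendsto_const_nhds.sub hg.hasSum.tendsto_sum_nat).norm
  have l2 : Tendsto (fun n : ℕ => ‖A ^ n‖ * B + (∑' m : ℕ, ‖A ^ m‖) * η) atTop
      (𝓝 (0 * B + (∑' m : ℕ, ‖A ^ m‖) * η)) :=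
    (hA.tendsto_atTop_zero.mul_const B).add_const _
  simpa using le_of_tendsto_of_tendsto' l1 l2 hbd

lemma summable_pow_apply [CompleteSpace V] {A : V →L[ℝ] V}
    (hA : Summable fun n : ℕ => ‖A ^ n‖)
    {g : ℕ → V} {B : ℝ} (hg : ∀ n, ‖g n‖ ≤ B) : Summable fun m : ℕ => (A ^ m) (g m) := by
  refine Summable.of_norm_bounded (hA.mul_right B) fun n => ?_
  exact (ContinuousLinearMap.le_opNorm _ _).trans (by gcongr; exact hg n)

lemma norm_tsum_pow_apply_le {A : V →L[ℝ] V} (hA : Summable fun n : ℕ => ‖A ^ n‖)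
    {g : ℕ → V} {B : ℝ} (hg : ∀ n, ‖g n‖ ≤ B) :
    ‖∑' m : ℕ, (A ^ m) (g m)‖ ≤ (∑' m : ℕ, ‖A ^ m‖) * B :=
  tsum_of_norm_bounded (hA.hasSum.mul_right B) fun n =>
    (ContinuousLinearMap.le_opNorm _ _).trans (by gcongr; exact hg n)

/-- Euclidean division n = qN + r compares the series with a geometric series in q times a finite
sum over r. -/
lemma summable_norm_pow_of_norm_pow_lt_one {A : V →L[ℝ] V} {N : ℕ} (hN : ‖A ^ N‖ < 1) :
    Summable fun n : ℕ => ‖A ^ n‖ := by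
  rcases Nat.eq_zero_or_pos N with rfl | hN0
  -- For N = 0 the hypothesis says that the identity has norm less than one, which forces V to be
  -- trivial.
  · have : Subsingleton V := by
      by_contra hns
      have : Nontrivial V := not_subsingleton_iff_nontrivial.1 hns
      simp at hN
    refine summable_zero.congr fun n => ?_
    rw [Subsingleton.elim (A ^ n) 0, norm_zero]
  · have : NeZero N := ⟨hN0.ne'⟩
    rw [← (Nat.divModEquiv N).symm.summable_iff]
    have hs : Summable fun p : ℕ × Fin N => ‖A ^ N‖ ^ p.1 * ‖A ^ (p.2 : ℕ)‖ :=
      Summable.mul_of_nonneg (f := fun q : ℕ => ‖A ^ N‖ ^ q)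
        (g := fun r : Fin N => ‖A ^ (r : ℕ)‖)
        (summable_geometric_of_lt_one (norm_nonneg _) hN) (hasSum_fintype _).summable
        (fun _ => by positivity) fun _ => norm_nonneg _
    refine Summable.of_nonneg_of_le (fun _ => norm_nonneg _) (fun p => ?_)
      (hs.add (summable_of_hasFiniteSupport (f := fun p : ℕ × Fin N =>
        if p.1 = 0 then ‖A ^ (p.2 : ℕ)‖ else 0) ?_))
    · simp only [Function.comp_apply, Nat.divModEquiv_symm_apply]
      rw [pow_add, pow_mul']
      rcases Nat.eq_zero_or_pos p.1 with h0 | h0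
      · simp [h0]
      · rw [if_neg h0.ne', add_zero]
        refine (norm_mul_le _ _).trans ?_
        gcongr
        exact norm_pow_le' _ h0
    · refine (Set.finite_range fun i : Fin N => ((0 : ℕ), i)).subset ?_
      rintro ⟨a, b⟩ hab
      simp only [Function.mem_support, ne_eq, ite_eq_right_iff, Classical.not_imp] at hab
      exact ⟨b, by simp [hab.1]⟩

end Recursion

/-! ### Ergodicity of an irreducible aperiodic transition matrix -/

section Ergodic

variable {S : Type*} [Fintype S] [DecidableEq S]

/-- `v ↦ v ᵥ* M` as a continuous linear map. -/
def vecMulCLM (M : Matrix S S ℝ) : (S → ℝ) →L[ℝ] (S → ℝ) :=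
  LinearMap.toContinuousLinearMap M.vecMulLinear

@[simp] lemma vecMulCLM_apply (M : Matrix S S ℝ) (v : S → ℝ) : vecMulCLM M v = v ᵥ* M := rfl

lemma vecMulCLM_pow (M : Matrix S S ℝ) (n : ℕ) : vecMulCLM M ^ n = vecMulCLM (M ^ n) := by
  induction n with
  | zero => ext v; simp
  | succ n ih =>
    rw [pow_succ', ih, pow_succ]
    refine ContinuousLinearMap.ext fun v => ?_
    simp [mul_apply_eq_comp, Matrix.vecMul_vecMul]

lemma vecMulCLM_pow_apply (M : Matrix S S ℝ) (n : ℕ) (v : S → ℝ) :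
    (vecMulCLM M ^ n) v = v ᵥ* M ^ n := by rw [vecMulCLM_pow]; rfl

lemma norm_vecMulCLM_le {M : Matrix S S ℝ} {c : ℝ} (hc : 0 ≤ c) (hM : ∀ x y, |M x y| ≤ c) :
    ‖vecMulCLM M‖ ≤ Fintype.card S * c := by
  refine ContinuousLinearMap.opNorm_le_bound _ (by positivity) fun v => ?_
  rw [pi_norm_le_iff_of_nonneg (by positivity)]
  intro y
  rw [vecMulCLM_apply, Matrix.vecMul, dotProduct]
  calc ‖∑ x, v x * M x y‖ ≤ ∑ _x : S, ‖v‖ * c := by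
        refine norm_sum_le_of_le _ fun x _ => ?_
        rw [norm_mul]
        exact mul_le_mul (norm_le_pi_norm v x) (hM x y) (norm_nonneg _) (norm_nonneg _)
    _ = _ := by simp; ring

/-- The matrix all of whose rows are `π`. -/
def constRows (π : S → ℝ) : Matrix S S ℝ := Matrix.of fun _ y => π y

lemma vecMul_constRows (v π : S → ℝ) : v ᵥ* constRows π = (∑ x, v x) • π := by
  ext y; simp [constRows, Matrix.vecMul, dotProduct, Finset.sum_mul]

lemma constRows_mul (π : S → ℝ) (M : Matrix S S ℝ) :
    constRows π * M = constRows (π ᵥ* M) := by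
  ext x y; simp [constRows, Matrix.mul_apply, Matrix.vecMul, dotProduct]

lemma mul_constRows {M : Matrix S S ℝ} (hM : ∀ x, ∑ y, M x y = 1) (π : S → ℝ) :
    M * constRows π = constRows π := by
  ext x y; simp [constRows, Matrix.mul_apply, ← Finset.sum_mul, hM]

/-- `constRows π` is idempotent and absorbs M from both sides, so all cross terms collapse. The
exponent starts at one: the zeroth powers differ by `constRows π`. -/
lemma sub_constRows_pow {M : Matrix S S ℝ} {π : S → ℝ} (hM : ∀ x, ∑ y, M x y = 1)
    (hπ : ∑ x, π x = 1) (hinv : π ᵥ* M = π) (n : ℕ) :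
    (M - constRows π) ^ (n + 1) = M ^ (n + 1) - constRows π := by
  have h1 : constRows π * M = constRows π := by rw [constRows_mul, hinv]
  have h2 : M * constRows π = constRows π := mul_constRows hM π
  have h3 : constRows π * constRows π = constRows π := mul_constRows (fun _ => hπ) π
  have h4 : ∀ n : ℕ, M ^ n * constRows π = constRows π := by
    intro n
    induction n with
    | zero => simp
    | succ n ih => rw [pow_succ, mul_assoc, h2, ih]
  induction n with
  | zero => simp
  | succ n ih =>
    rw [pow_succ, ih, sub_mul, mul_sub, mul_sub, h4, h1, h3, pow_succ M (n + 1)]; simp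

/-- The return times to a state are closed under addition with gcd one, hence contain all large
integers. A path from x to y is then padded with a long loop at x to reach a length common to all
pairs. -/
lemma exists_pow_pos {P : Matrix S S ℝ} (h0 : ∀ x y, 0 ≤ P x y) (hirr : P.IsIrreducible)
    (hap : IsAperiodic P) : ∃ N > 0, ∀ x y, 0 < (P ^ N) x y := by
  have hpos := (isIrreducible_iff_exists_pow_pos h0).1 hirr
  have hnn : ∀ n x y, 0 ≤ (P ^ n) x y := fun n x y => pow_apply_nonneg h0 n x y
  have hmul : ∀ m n x y z, 0 < (P ^ m) x y → 0 < (P ^ n) y z → 0 < (P ^ (m + n)) x z := by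
    intro m n x y z h1 h2
    rw [pow_add, Matrix.mul_apply]
    exact Finset.sum_pos' (fun w _ => mul_nonneg (hnn _ _ _) (hnn _ _ _))
      ⟨y, Finset.mem_univ _, mul_pos h1 h2⟩
  have hret : ∀ x, ∃ n, ∀ m ≥ n, 0 < (P ^ m) x x := by
    intro x
    let s : Set ℕ := {n | 0 < n ∧ 0 < (P ^ n) x x}
    have hs : Nat.setGcd s = 1 :=
      hap x _ fun n hn hn' => Nat.setGcd_dvd_of_mem ⟨hn, hn'⟩
    obtain ⟨n, hn⟩ := Nat.exists_mem_closure_of_ge s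
    refine ⟨n, fun m hm => ?_⟩
    have := hn m hm (by rw [hs]; exact one_dvd _)
    clear hm
    induction this using AddSubmonoid.closure_induction with
    | mem k hk => exact hk.2
    | zero => simp
    | add a b _ _ ha hb => exact hmul a b x x x ha hb
  choose n hn using hret
  choose k hk0 hk using hpos
  -- After removing the path length `k x y`, what is left is at least `n x`, so a loop of exactly
  -- that length exists.
  refine ⟨∑ x, n x + ∑ x, ∑ y, k x y + 1, by omega, fun x y => ?_⟩
  have h1 : n x ≤ ∑ x, n x := Finset.single_le_sum (fun _ _ => Nat.zero_le _) (Finset.mem_univ x)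
  have h2 : k x y ≤ ∑ x, ∑ y, k x y :=
    (Finset.single_le_sum (f := fun y => k x y) (fun _ _ => Nat.zero_le _)
      (Finset.mem_univ y)).trans
    (Finset.single_le_sum (f := fun x => ∑ y, k x y) (fun _ _ => Nat.zero_le _)
      (Finset.mem_univ x))
  have h3 : ∑ x, n x + ∑ x, ∑ y, k x y + 1 =
      (∑ x, n x + ∑ x, ∑ y, k x y + 1 - k x y) + k x y := by omega
  rw [h3]
  exact hmul _ _ x x y (hn x _ (by omega)) (hk x y)

/-- For an irreducible aperiodic transition matrix `P` with invariant law `π`, the powers of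
`P - 1 ⊗ π` are absolutely summable. -/
theorem summable_norm_vecMulCLM_pow {P : Matrix S S ℝ} {π : S → ℝ}
    (hP : P ∈ Matrix.rowStochastic ℝ S) (hirr : P.IsIrreducible) (hap : IsAperiodic P)
    (hπ : IsInvariantPmf P π) :
    Summable fun n : ℕ => ‖vecMulCLM (P - constRows π) ^ n‖ := by
  obtain ⟨hπ0, hπ1, hinv⟩ := hπ
  obtain ⟨N, hN, hpos⟩ := exists_pow_pos hP.1 hirr hap
  have hQ : P ^ N ∈ Matrix.rowStochastic ℝ S := pow_mem hP N
  set Q := P ^ N with hQdef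
  have hQsum := (mem_rowStochastic_iff_sum.1 hQ).2
  have hPsum := (mem_rowStochastic_iff_sum.1 hP).2
  have hinvQ : π ᵥ* Q = π := by
    have : ∀ n : ℕ, π ᵥ* P ^ n = π := by
      intro n
      induction n with
      | zero => simp
      | succ n ih => rw [pow_succ, ← Matrix.vecMul_vecMul, ih, hinv]
    exact this N
  have hAN : (P - constRows π) ^ N = Q - constRows π := by
    obtain ⟨M, rfl⟩ := Nat.exists_eq_succ_of_ne_zero hN.ne'
    exact sub_constRows_pow hPsum hπ1 hinv M
  have hπle : ∀ x, π x ≤ 1 := fun x =>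
    hπ1 ▸ Finset.single_le_sum (fun y _ => hπ0 y) (Finset.mem_univ x)
  have hne : Nonempty S := by
    by_contra h
    rw [not_nonempty_iff] at h
    simp at hπ1
  -- Doeblin minorization constant; the cap 1/2 keeps 1 − δ invertible.
  obtain ⟨δ, hδ0, hδ1, hδ⟩ : ∃ δ : ℝ, 0 < δ ∧ δ < 1 ∧ ∀ x y, δ ≤ Q x y := by
    obtain ⟨p, hp⟩ := Finite.exists_min fun p : S × S => Q p.1 p.2
    refine ⟨min (Q p.1 p.2) (1 / 2), lt_min (hpos _ _) (by norm_num),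
      (min_le_right _ _).trans_lt (by norm_num), fun x y => (min_le_left _ _).trans (hp (x, y))⟩
  -- Residual kernel of the splitting Q = δ(1⊗π) + (1 − δ)K. It is stochastic because δπ_y ≤ δ ≤
  -- Q_{xy}, and it keeps π invariant, so powers of Q − 1⊗π carry the factor (1 − δ)^n with bounded
  -- entries.
  set K : Matrix S S ℝ := (1 - δ)⁻¹ • (Q - δ • constRows π) with hK
  have hδ' : (1 - δ) ≠ 0 := by linarith
  have hQK : Q - constRows π = (1 - δ) • (K - constRows π) := by
    rw [hK, smul_sub, smul_smul, mul_inv_cancel₀ hδ', one_smul, sub_smul, one_smul]; abel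
  have hKs : K ∈ Matrix.rowStochastic ℝ S := by
    rw [mem_rowStochastic_iff_sum]
    refine ⟨fun x y => ?_, fun x => ?_⟩
    · have h1 : 0 ≤ Q x y - δ * π y := by
        have := mul_le_mul_of_nonneg_left (hπle y) hδ0.le
        linarith [hδ x y]
      have h2 : 0 ≤ (1 - δ)⁻¹ := inv_nonneg.2 (by linarith)
      simpa [hK, constRows] using mul_nonneg h2 h1
    · simp only [hK, constRows, Matrix.smul_apply, Matrix.sub_apply, Matrix.of_apply, smul_eq_mul,
        ← Finset.mul_sum, Finset.sum_sub_distrib, hQsum, hπ1]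
      rw [mul_one, inv_mul_cancel₀ hδ']
  have hKinv : π ᵥ* K = π := by
    rw [hK, Matrix.vecMul_smul, Matrix.vecMul_sub, hinvQ, Matrix.vecMul_smul, vecMul_constRows,
      hπ1, one_smul]
    rw [show π - δ • π = (1 - δ) • π by rw [sub_smul, one_smul], smul_smul,
      inv_mul_cancel₀ hδ', one_smul]
  have hentry : ∀ (m : ℕ) x y, |((Q - constRows π) ^ (m + 1)) x y| ≤ (1 - δ) ^ (m + 1) := by
    intro m x y
    have hs := pow_mem hKs (m + 1)
    rw [hQK, smul_pow, sub_constRows_pow (mem_rowStochastic_iff_sum.1 hKs).2 hπ1 hKinv,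
      Matrix.smul_apply, smul_eq_mul, abs_mul, abs_of_nonneg (by bound)]
    refine mul_le_of_le_one_right (by bound) ?_
    rw [Matrix.sub_apply, abs_le]
    have h1 : 0 ≤ (K ^ (m + 1)) x y := hs.1 x y
    have h2 : (K ^ (m + 1)) x y ≤ 1 := le_one_of_mem_rowStochastic hs
    have h3 : constRows π x y = π y := rfl
    constructor <;> linarith [hπ0 y, hπle y]
  have hlim : Tendsto (fun m : ℕ => (Fintype.card S : ℝ) * (1 - δ) ^ (m + 1)) atTop (𝓝 0) := by
    have := (tendsto_pow_atTop_nhds_zero_of_lt_one (r := 1 - δ) (by linarith) (by linarith))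
    simpa using ((tendsto_add_atTop_iff_nat 1).2 this).const_mul (Fintype.card S : ℝ)
  obtain ⟨m, hm⟩ := (hlim.eventually_lt_const one_pos).exists
  refine summable_norm_pow_of_norm_pow_lt_one (N := N * (m + 1)) ?_
  rw [vecMulCLM_pow, pow_mul, hAN]
  exact (norm_vecMulCLM_le (by bound) (hentry m)).trans_lt hm

end Ergodic

/-! ### Taylor expansion -/

/-- Two mean value inequalities on [−|x|, |x|], for f′ and then for f. The Lipschitz second
derivative supplies the third power without a third derivative; the constant is not optimal. -/
lemma taylor_two_remainder_le {f : ℝ → ℝ} {r : ℝ} (hr : 0 < r) {K : NNReal}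
    (hf : ContDiffOn ℝ 2 f (Set.Ioo (-r) r))
    (hL : LipschitzOnWith K (iteratedDeriv 2 f) (Set.Ioo (-r) r)) {x : ℝ} (hx : |x| < r) :
    |f x - f 0 - x * deriv f 0 - x ^ 2 / 2 * iteratedDeriv 2 f 0| ≤ K * |x| ^ 3 := by
  have h0 : (0 : ℝ) ∈ Set.Ioo (-r) r := ⟨by linarith, hr⟩
  set s : Set ℝ := Set.Icc (-|x|) |x| with hs
  have hsub : s ⊆ Set.Ioo (-r) r := fun y hy => ⟨by linarith [hy.1], by linarith [hy.2]⟩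
  have hsc : Convex ℝ s := convex_Icc _ _
  have h0s : (0 : ℝ) ∈ s := ⟨by simp, by simp⟩
  have hxs : x ∈ s := ⟨neg_abs_le x, le_abs_self x⟩
  have hd1 : ∀ y ∈ Set.Ioo (-r) r, HasDerivAt f (deriv f y) y := fun y hy =>
    ((hf.differentiableOn (by norm_num)).differentiableAt (isOpen_Ioo.mem_nhds hy)).hasDerivAt
  have hd2 : ∀ y ∈ Set.Ioo (-r) r, HasDerivAt (deriv f) (iteratedDeriv 2 f y) y := by
    intro y hy
    have h1 : ContDiffOn ℝ 1 (deriv f) (Set.Ioo (-r) r) :=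
      ((contDiffOn_succ_iff_deriv_of_isOpen (n := 1) isOpen_Ioo).1 (by exact_mod_cast hf)).2.2
    have := ((h1.differentiableOn (by norm_num)).differentiableAt
      (isOpen_Ioo.mem_nhds hy)).hasDerivAt
    rwa [show deriv (deriv f) y = iteratedDeriv 2 f y by
      rw [iteratedDeriv_succ, iteratedDeriv_one]] at this
  have hφ : ∀ y ∈ s, |deriv f y - deriv f 0 - y * iteratedDeriv 2 f 0| ≤ K * |x| * |x| := by
    intro y hy
    have := hsc.norm_image_sub_le_of_norm_hasDerivWithin_le
      (f := fun y => deriv f y - y * iteratedDeriv 2 f 0)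
      (f' := fun y => iteratedDeriv 2 f y - 1 * iteratedDeriv 2 f 0) (C := K * |x|)
      (fun z hz => ((hd2 z (hsub hz)).sub
        ((hasDerivAt_id z).mul_const _)).hasDerivWithinAt) (fun z hz => ?_) h0s hy
    · simp only [Real.norm_eq_abs, zero_mul, sub_zero] at this
      calc _ = |deriv f y - y * iteratedDeriv 2 f 0 - deriv f 0| := by ring_nf
        _ ≤ K * |x| * |y| := this
        _ ≤ _ := mul_le_mul_of_nonneg_left (abs_le.2 hy) (by positivity)
    · have := hL.dist_le_mul z (hsub hz) 0 h0
      rw [Real.dist_eq, Real.dist_eq, sub_zero] at this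
      rw [one_mul, Real.norm_eq_abs]
      exact this.trans (mul_le_mul_of_nonneg_left (abs_le.2 hz) K.2)
  have := hsc.norm_image_sub_le_of_norm_hasDerivWithin_le
      (f := fun y => f y - y * deriv f 0 - y ^ 2 / 2 * iteratedDeriv 2 f 0)
      (f' := fun y => deriv f y - deriv f 0 - y * iteratedDeriv 2 f 0) (C := K * |x| * |x|)
      (fun z hz => ?_) (fun z hz => by simpa using hφ z hz) h0s hxs
  · simp only [Real.norm_eq_abs] at this
    calc _ = |f x - x * deriv f 0 - x ^ 2 / 2 * iteratedDeriv 2 f 0 -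
          (f 0 - 0 * deriv f 0 - 0 ^ 2 / 2 * iteratedDeriv 2 f 0)| := by ring_nf
      _ ≤ _ := this
      _ = _ := by rw [sub_zero]; ring
  · have h1 := (((hd1 z (hsub hz)).sub ((hasDerivAt_id z).mul_const (deriv f 0))).sub
      ((((hasDerivAt_id z).pow 2).div_const 2).mul_const (iteratedDeriv 2 f 0))).hasDerivWithinAt
      (s := s)
    refine h1.congr_deriv ?_
    simp only [id, one_mul, mul_one, Nat.cast_ofNat, Nat.add_one_sub_one, pow_one]
    ring

/-! ### Weighted state distributions -/

section Weights

variable {S : Type*} [Fintype S] [DecidableEq S] {Ω : Type*}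

/-- The `σ`-algebra generated by the whole input. -/
abbrev inputSigma (ζ : ℤ → Ω → ℝ) : MeasurableSpace Ω :=
  ⨆ s : ℤ, MeasurableSpace.comap (ζ s) inferInstance

/-- The `σ`-algebra generated by the whole input and the states up to time `t`. -/
abbrev pastSigma [MeasurableSpace S] (ζ : ℤ → Ω → ℝ) (X : ℤ → Ω → S) (t : ℤ) : MeasurableSpace Ω :=
  (⨆ s : ℤ, MeasurableSpace.comap (ζ s) inferInstance) ⊔
    (⨆ r : ℤ, ⨆ _ : r ≤ t, MeasurableSpace.comap (X r) inferInstance)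

/-- Indicator of the event that the state at time `t` is `x`. -/
def stateInd (X : ℤ → Ω → S) (t : ℤ) (x : S) (ω : Ω) : ℝ := if X t ω = x then 1 else 0

lemma measurable_inputSigma (ζ : ℤ → Ω → ℝ) (s : ℤ) : Measurable[inputSigma ζ] (ζ s) :=
  (comap_measurable (ζ s)).mono (le_iSup (fun s => MeasurableSpace.comap (ζ s) inferInstance) s)
    le_rfl

lemma inputSigma_le_pastSigma [MeasurableSpace S] (ζ : ℤ → Ω → ℝ) (X : ℤ → Ω → S) (t : ℤ) :
    inputSigma ζ ≤ pastSigma ζ X t := le_sup_left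

lemma measurable_stateInd_pastSigma [MeasurableSpace S] [DiscreteMeasurableSpace S]
    (ζ : ℤ → Ω → ℝ) (X : ℤ → Ω → S) {r t : ℤ} (hr : r ≤ t) (x : S) :
    Measurable[pastSigma ζ X t] (stateInd X r x) := by
  have hX : Measurable[pastSigma ζ X t] (X r) :=
    (comap_measurable (X r)).mono ((le_iSup₂ (f := fun r (_ : r ≤ t) =>
      MeasurableSpace.comap (X r) inferInstance) r hr).trans le_sup_right) le_rfl
  exact (measurable_of_countable fun y : S => if y = x then (1 : ℝ) else 0).comp hX

lemma sum_stateInd (X : ℤ → Ω → S) (t : ℤ) (ω : Ω) : ∑ x, stateInd X t x ω = 1 := by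
  simp [stateInd]

lemma abs_stateInd_le (X : ℤ → Ω → S) (t : ℤ) (x : S) (ω : Ω) : |stateInd X t x ω| ≤ 1 := by
  unfold stateInd; split_ifs <;> simp

lemma stateInd_mul_stateInd (X : ℤ → Ω → S) (t : ℤ) (x y : S) (ω : Ω) :
    stateInd X t x ω * stateInd X t y ω = if x = y then stateInd X t x ω else 0 := by
  unfold stateInd; split_ifs <;> simp_all

/-- `W` is a random weight measurable for `m` and a.s. bounded by `w`. -/
structure IsWeight (m : MeasurableSpace Ω) [mΩ : MeasurableSpace Ω] (μ : Measure Ω) (W : Ω → ℝ)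
    (w : ℝ) : Prop where
  meas : Measurable[m] W
  bound : ∀ᵐ ω ∂μ, |W ω| ≤ w

variable {m m' : MeasurableSpace Ω} [mΩ : MeasurableSpace Ω]

namespace IsWeight

variable {μ : Measure Ω} {W V : Ω → ℝ} {w v : ℝ}

lemma mono (h : IsWeight m μ W w) (hm : m ≤ m') : IsWeight m' μ W w :=
  ⟨h.meas.mono hm le_rfl, h.bound⟩

lemma mul (hV : IsWeight m μ V v) (hW : IsWeight m μ W w) (hv : 0 ≤ v) :
    IsWeight m μ (V * W) (v * w) :=
  ⟨hV.meas.mul hW.meas, by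
    filter_upwards [hV.bound, hW.bound] with ω h1 h2
    rw [Pi.mul_apply, abs_mul]
    exact mul_le_mul h1 h2 (abs_nonneg _) hv⟩

lemma integrable [IsFiniteMeasure μ] (hm : m ≤ mΩ) (h : IsWeight m μ W w) : Integrable W μ :=
  Integrable.of_bound (h.meas.mono hm le_rfl).aestronglyMeasurable w
    (by simpa [Real.norm_eq_abs] using h.bound)

lemma abs_integral_le [IsProbabilityMeasure μ] (h : IsWeight m μ W w) : |∫ ω, W ω ∂μ| ≤ w := by
  simpa using norm_integral_le_of_norm_le_const (μ := μ) (f := W) (C := w) h.bound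

end IsWeight

/-- The row vector `E[W Γ_t]`. -/
def stateMean (μ : Measure Ω) (X : ℤ → Ω → S) (t : ℤ) (W : Ω → ℝ) : S → ℝ :=
  fun x => ∫ ω, W ω * stateInd X t x ω ∂μ

variable [MeasurableSpace S] [DiscreteMeasurableSpace S]

lemma measurable_stateInd {X : ℤ → Ω → S} {t : ℤ} (hX : Measurable (X t)) (x : S) :
    Measurable (stateInd X t x) :=
  (measurable_of_countable fun y : S => if y = x then (1 : ℝ) else 0).comp hX

variable {μ : Measure Ω} [IsProbabilityMeasure μ] {X : ℤ → Ω → S} {W V : Ω → ℝ} {w : ℝ} {t : ℤ}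

lemma ae_abs_mul_stateInd_le (h : ∀ᵐ ω ∂μ, |W ω| ≤ w) (x : S) :
    ∀ᵐ ω ∂μ, |W ω * stateInd X t x ω| ≤ w := by
  filter_upwards [h] with ω hω
  rw [abs_mul]
  exact (mul_le_of_le_one_right (abs_nonneg _) (abs_stateInd_le X t x ω)).trans hω

lemma norm_stateMean_le (h : ∀ᵐ ω ∂μ, |W ω| ≤ w) : ‖stateMean μ X t W‖ ≤ w := by
  have hw : 0 ≤ w := by
    obtain ⟨ω, hω⟩ := h.exists
    exact (abs_nonneg _).trans hω
  rw [pi_norm_le_iff_of_nonneg hw]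
  intro x
  simpa [stateMean] using norm_integral_le_of_norm_le_const (μ := μ)
    (f := fun ω => W ω * stateInd X t x ω) (C := w) (ae_abs_mul_stateInd_le h x)

lemma integrable_mul_stateInd (hX : Measurable (X t)) (hW : Integrable W μ) (x : S) :
    Integrable (fun ω => W ω * stateInd X t x ω) μ :=
  hW.mul_bdd (c := 1) (measurable_stateInd hX x).aestronglyMeasurable
    (Eventually.of_forall fun ω => abs_stateInd_le X t x ω)

lemma sum_stateMean (hX : Measurable (X t)) (hW : Integrable W μ) :
    ∑ x, stateMean μ X t W x = ∫ ω, W ω ∂μ := by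
  unfold stateMean
  rw [← integral_finsetSum _ fun x _ => integrable_mul_stateInd hX hW x]
  simp [← Finset.mul_sum, sum_stateInd]

end Weights

/-! ### Second-order expansion of the state process -/

section Coefficients

variable {S : Type*} [Fintype S] [DecidableEq S]
variable (A E₁ E₂ : (S → ℝ) →L[ℝ] (S → ℝ)) (π : S → ℝ) (R : ℤ → ℝ)

/-- The `ε²` coefficient of `E[ζ_j Γ_0]`. -/
def inputState (j : ℕ) : S → ℝ := ∑' m : ℕ, (A ^ m) (R (j + 1 + m) • E₁ π)

/-- The `ε²` coefficient of `E[Γ_0]`. -/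
def meanShift : S → ℝ :=
  ∑' m : ℕ, (A ^ m) (E₁ (inputState A E₁ π R 0) + (R 0 / 2) • E₂ π)

/-- The `i`-th row of `diag(a) - πᵀ a - aᵀ π`. -/
def coupling (i : S) (a : S → ℝ) : S → ℝ := Pi.single i (a i) - π i • a - a i • π

/-- The `i`-th row of `diag(π) - πᵀ π`. -/
def stateCov (i : S) : S → ℝ := Pi.single i (π i) - π i • π

/-- The `ε²` coefficient of `Cov(1{X_0 = i}, ζ_j Γ_j)`. -/
def inputStateCov (i : S) (j : ℕ) : S → ℝ :=
  inputState A E₁ π R j i • π +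
    recursionSol A (fun n => R (j - n) • E₁ ((A ^ n) (stateCov π i)))
      (coupling π i (inputState A E₁ π R j)) j

/-- The `ε²` coefficient of `Cov(1{X_0 = i}, Γ_k)`. -/
def covShift (i : S) : ℕ → S → ℝ :=
  recursionSol A (fun n => E₁ (inputStateCov A E₁ π R i n) +
    (R 0 / 2) • E₂ ((A ^ n) (stateCov π i))) (coupling π i (meanShift A E₁ E₂ π R))

lemma recursionSol_zero {V : Type*} [NormedAddCommGroup V] [NormedSpace ℝ V] (A : V →L[ℝ] V)
    (v : V) (n : ℕ) : recursionSol A (fun _ => 0) v n = (A ^ n) v := by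
  simp [recursionSol_eq]

/-- Linearity in the data separates the ε⁰ part of the initial value from the ε² part of value and
forcing. -/
lemma recursionSol_add_smul {V : Type*} [NormedAddCommGroup V] [NormedSpace ℝ V] (A : V →L[ℝ] V)
    (g : ℕ → V) (v w : V) (a : ℝ) (n : ℕ) :
    recursionSol A (fun m => a • g m) (v + a • w) n = (A ^ n) v + a • recursionSol A g w n := by
  simp only [recursionSol_eq, map_add, map_smul, Finset.smul_sum, smul_add, add_assoc]

end Coefficients

/-! ### Expansion of state means weighted by the input -/

section Chain

variable {S : Type*} [Fintype S] [DecidableEq S] [MeasurableSpace S] [DiscreteMeasurableSpace S]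
  {Ω : Type*} [MeasurableSpace Ω]

/-- The row vector `E[W Γ_t] - E[W] π`. -/
def centeredMean (μ : Measure Ω) (X : ℤ → Ω → S) (π : S → ℝ) (t : ℤ) (W : Ω → ℝ) : S → ℝ :=
  stateMean μ X t W - (∫ ω, W ω ∂μ) • π

/-- The indicator of `X_0 = i`, centered at its mean. -/
def centeredInd (μ : Measure Ω) (X : ℤ → Ω → S) (i : S) (ω : Ω) : ℝ :=
  stateInd X 0 i ω - stateMean μ X 0 1 i

/-- The quantitative properties of a stationary realization at level `ε` from which the expansion
of its second-order statistics is derived. -/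
structure IsPerturbedChain (A E₁ E₂ : (S → ℝ) →L[ℝ] (S → ℝ)) (π : S → ℝ) (R : ℤ → ℝ) (c ε : ℝ)
    (μ : Measure Ω) (ζ : ℤ → Ω → ℝ) (X : ℤ → Ω → S) : Prop where
  prob : IsProbabilityMeasure μ
  measurable_input : ∀ t, Measurable (ζ t)
  measurable_state : ∀ t, Measurable (X t)
  summable_pow : Summable fun n : ℕ => ‖A ^ n‖
  tsum_pow_le : ∑' n : ℕ, ‖A ^ n‖ ≤ c
  one_le : 1 ≤ c
  norm_E₁_le : ‖E₁‖ ≤ c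
  norm_E₂_le : ‖E₂‖ ≤ c
  norm_π_le : ‖π‖ ≤ 1
  abs_R_le : ∀ k, |R k| ≤ 1
  ε_nonneg : 0 ≤ ε
  ε_le_one : ε ≤ 1
  input_le : ∀ t, ∀ᵐ ω ∂μ, |ζ t ω| ≤ ε
  integral_input : ∀ t, ∫ ω, ζ t ω ∂μ = 0
  integral_input_mul : ∀ s t, ∫ ω, (ζ s * ζ t) ω ∂μ = ε ^ 2 * R (t - s)
  stationary : ∀ t, stateMean μ X t 1 = stateMean μ X 0 1
  step : ∀ (t : ℤ) (W : Ω → ℝ) (w : ℝ), 0 ≤ w → IsWeight (pastSigma ζ X t) μ W w →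
    ‖centeredMean μ X π (t + 1) W - (A (centeredMean μ X π t W) +
      (E₁ (stateMean μ X t (ζ t * W)) + (1 / 2 : ℝ) • E₂ (stateMean μ X t (ζ t * (ζ t * W)))))‖
      ≤ c * ε ^ 3 * w

namespace IsPerturbedChain

variable {A E₁ E₂ : (S → ℝ) →L[ℝ] (S → ℝ)} {π : S → ℝ} {R : ℤ → ℝ} {c ε : ℝ}
    {μ : Measure Ω} {ζ : ℤ → Ω → ℝ} {X : ℤ → Ω → S}

lemma inputSigma_le (h : IsPerturbedChain A E₁ E₂ π R c ε μ ζ X) :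
    inputSigma ζ ≤ (inferInstance : MeasurableSpace Ω) :=
  iSup_le fun s => (h.measurable_input s).comap_le

lemma isWeight_input (h : IsPerturbedChain A E₁ E₂ π R c ε μ ζ X) (t : ℤ) :
    IsWeight (inputSigma ζ) μ (ζ t) ε := ⟨measurable_inputSigma ζ t, h.input_le t⟩

lemma isWeight_one (_ : IsPerturbedChain A E₁ E₂ π R c ε μ ζ X) :
    IsWeight (inputSigma ζ) μ 1 1 := ⟨measurable_const, by simp⟩

lemma isWeight_input_mul (h : IsPerturbedChain A E₁ E₂ π R c ε μ ζ X) (s t : ℤ) :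
    IsWeight (inputSigma ζ) μ (ζ s * ζ t) (ε ^ 2) := by
  rw [sq]; exact (h.isWeight_input s).mul (h.isWeight_input t) h.ε_nonneg

lemma isWeight_past (_ : IsPerturbedChain A E₁ E₂ π R c ε μ ζ X) {W : Ω → ℝ} {w : ℝ}
    (hW : IsWeight (inputSigma ζ) μ W w) (t : ℤ) : IsWeight (pastSigma ζ X t) μ W w :=
  hW.mono (inputSigma_le_pastSigma ζ X t)

lemma c_pow_le (h : IsPerturbedChain A E₁ E₂ π R c ε μ ζ X) {a b : ℕ} (hab : a ≤ b) (k : ℕ) :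
    c ^ a * ε ^ k ≤ c ^ b * ε ^ k := by
  have := h.ε_nonneg
  exact mul_le_mul_of_nonneg_right (pow_le_pow_right₀ h.one_le hab) (by positivity)

lemma c_nonneg (h : IsPerturbedChain A E₁ E₂ π R c ε μ ζ X) : 0 ≤ c := zero_le_one.trans h.one_le

lemma ε_pow_le (h : IsPerturbedChain A E₁ E₂ π R c ε μ ζ X) {a b : ℕ} (hab : a ≤ b) :
    ε ^ b ≤ ε ^ a := pow_le_pow_of_le_one h.ε_nonneg h.ε_le_one hab

lemma norm_E₁_apply_le (h : IsPerturbedChain A E₁ E₂ π R c ε μ ζ X) {v : S → ℝ} {b : ℝ}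
    (hv : ‖v‖ ≤ b) : ‖E₁ v‖ ≤ c * b :=
  (E₁.le_opNorm v).trans (mul_le_mul h.norm_E₁_le hv (norm_nonneg _) h.c_nonneg)

lemma norm_E₂_apply_le (h : IsPerturbedChain A E₁ E₂ π R c ε μ ζ X) {v : S → ℝ} {b : ℝ}
    (hv : ‖v‖ ≤ b) : ‖E₂ v‖ ≤ c * b :=
  (E₂.le_opNorm v).trans (mul_le_mul h.norm_E₂_le hv (norm_nonneg _) h.c_nonneg)

lemma norm_half_E₂_le (h : IsPerturbedChain A E₁ E₂ π R c ε μ ζ X) {v : S → ℝ} {b : ℝ}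
    (hv : ‖v‖ ≤ b) : ‖(1 / 2 : ℝ) • E₂ v‖ ≤ c * b := by
  rw [norm_smul]
  have h1 := h.norm_E₂_apply_le hv
  have h2 : ‖(1 / 2 : ℝ)‖ = 1 / 2 := by norm_num
  rw [h2]
  linarith [norm_nonneg (E₂ v)]

/-- First-order form of `step`. The two forcing terms and the remainder each contribute at most cεw,
whence the factor 3. -/
lemma step_coarse (h : IsPerturbedChain A E₁ E₂ π R c ε μ ζ X) {t : ℤ} {W : Ω → ℝ} {w : ℝ}
    (hw : 0 ≤ w) (hW : IsWeight (pastSigma ζ X t) μ W w) :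
    ‖centeredMean μ X π (t + 1) W - A (centeredMean μ X π t W)‖ ≤ 3 * c * ε * w := by
  have := h.prob
  have hζ := h.isWeight_past (h.isWeight_input t) t
  have h1 := h.norm_E₁_apply_le (norm_stateMean_le (X := X) (t := t) (hζ.mul hW h.ε_nonneg).bound)
  have h2 := h.norm_half_E₂_le
    (norm_stateMean_le (X := X) (t := t) (hζ.mul (hζ.mul hW h.ε_nonneg) h.ε_nonneg).bound)
  have h3 := h.step t W w hw hW
  have h4 : ε * (ε * w) ≤ ε * w := by
    have := mul_nonneg h.ε_nonneg hw
    exact mul_le_of_le_one_left this h.ε_le_one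
  have h5 : ε ^ 3 * w ≤ ε * w := by
    have := h.ε_pow_le (show 1 ≤ 3 by norm_num)
    rw [pow_one] at this
    exact mul_le_mul_of_nonneg_right this hw
  have h6 := mul_le_mul_of_nonneg_left h4 h.c_nonneg
  have h7 := mul_le_mul_of_nonneg_left h5 h.c_nonneg
  have h8 : centeredMean μ X π (t + 1) W - A (centeredMean μ X π t W) =
      (centeredMean μ X π (t + 1) W - (A (centeredMean μ X π t W) +
      (E₁ (stateMean μ X t (ζ t * W)) + (1 / 2 : ℝ) • E₂ (stateMean μ X t (ζ t * (ζ t * W)))))) +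
      (E₁ (stateMean μ X t (ζ t * W)) +
        (1 / 2 : ℝ) • E₂ (stateMean μ X t (ζ t * (ζ t * W)))) := by abel
  rw [h8]
  refine (norm_add_le _ _).trans ?_
  have h9 := norm_add_le (E₁ (stateMean μ X t (ζ t * W)))
    ((1 / 2 : ℝ) • E₂ (stateMean μ X t (ζ t * (ζ t * W))))
  linarith

lemma norm_centeredMean_le (h : IsPerturbedChain A E₁ E₂ π R c ε μ ζ X) {t : ℤ} {W : Ω → ℝ}
    {w : ℝ} (hw : 0 ≤ w) (hW : IsWeight (pastSigma ζ X t) μ W w) :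
    ‖centeredMean μ X π t W‖ ≤ 2 * w := by
  have := h.prob
  refine (norm_sub_le _ _).trans ?_
  have h1 := norm_stateMean_le (X := X) (t := t) hW.bound
  have h2 : ‖(∫ ω, W ω ∂μ) • π‖ ≤ w * 1 := by
    rw [norm_smul]
    exact mul_le_mul hW.abs_integral_le h.norm_π_le (norm_nonneg _) hw
  linarith

/-- Input-measurable weights nearly decouple from the state. -/
lemma norm_centeredMean_input_le (h : IsPerturbedChain A E₁ E₂ π R c ε μ ζ X) (t : ℤ)
    {W : Ω → ℝ} {w : ℝ} (hw : 0 ≤ w) (hW : IsWeight (inputSigma ζ) μ W w) :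
    ‖centeredMean μ X π t W‖ ≤ 3 * c ^ 2 * ε * w := by
  -- An input-measurable weight is admissible at every time, so the recursion runs back to −∞ with
  -- zero source, and only the step defects remain.
  have := norm_sub_tsum_backward_le h.summable_pow
    (v := fun m : ℕ => centeredMean μ X π (t - m) W) (g := fun _ => 0) (η := 3 * c * ε * w)
    (B := 2 * w) (fun n => h.norm_centeredMean_le hw (h.isWeight_past hW _))
    (by simp) (fun m => by
      have := h.step_coarse hw (h.isWeight_past hW (t - (m + 1 : ℕ)))
      simpa [sub_add_eq_sub_sub] using this)
  simp only [Nat.cast_zero, sub_zero, map_zero, tsum_zero] at this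
  refine this.trans ?_
  have h0 : 0 ≤ 3 * c * ε * w := by have := h.c_nonneg; have := h.ε_nonneg; positivity
  calc _ ≤ c * (3 * c * ε * w) := mul_le_mul_of_nonneg_right h.tsum_pow_le h0
    _ = _ := by ring

/-- A product of two inputs has size ε², so the first-order decoupling error is already of third
order. -/
lemma norm_stateMean_sub_le (h : IsPerturbedChain A E₁ E₂ π R c ε μ ζ X) (s t r : ℤ) :
    ‖stateMean μ X r (ζ s * ζ t) - (ε ^ 2 * R (t - s)) • π‖ ≤ 3 * c ^ 2 * ε ^ 3 := by
  have := h.norm_centeredMean_input_le r (by positivity) (h.isWeight_input_mul s t)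
  rw [centeredMean, h.integral_input_mul] at this
  exact this.trans_eq (by ring)

lemma norm_inputState_le (h : IsPerturbedChain A E₁ E₂ π R c ε μ ζ X) (j : ℕ) :
    ‖inputState A E₁ π R j‖ ≤ c ^ 2 := by
  have h1 : ∀ m : ℕ, ‖R (j + 1 + m) • E₁ π‖ ≤ c := fun m => by
    rw [norm_smul]
    have := h.norm_E₁_apply_le h.norm_π_le
    calc _ ≤ 1 * (c * 1) := mul_le_mul (h.abs_R_le _) this (norm_nonneg _) zero_le_one
      _ = c := by ring
  refine (norm_tsum_pow_apply_le h.summable_pow h1).trans ?_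
  rw [sq]; exact mul_le_mul_of_nonneg_right h.tsum_pow_le h.c_nonneg

lemma norm_meanShift_le (h : IsPerturbedChain A E₁ E₂ π R c ε μ ζ X) :
    ‖meanShift A E₁ E₂ π R‖ ≤ 2 * c ^ 4 := by
  have h2 : ‖(R 0 / 2) • E₂ π‖ ≤ c := by
    rw [norm_smul]
    have := h.norm_E₂_apply_le h.norm_π_le
    have h3 : ‖R 0 / 2‖ ≤ 1 := by
      rw [norm_div, Real.norm_eq_abs]; have := h.abs_R_le 0; norm_num; linarith
    calc _ ≤ 1 * (c * 1) := mul_le_mul h3 this (norm_nonneg _) zero_le_one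
      _ = c := by ring
  have h1 : ∀ _m : ℕ, ‖E₁ (inputState A E₁ π R 0) + (R 0 / 2) • E₂ π‖ ≤ 2 * c ^ 3 := fun _ => by
    have h3 := h.norm_E₁_apply_le (h.norm_inputState_le 0)
    have h4 := pow_le_pow_right₀ h.one_le (show 1 ≤ 3 by norm_num)
    refine (norm_add_le _ _).trans ?_
    linarith
  refine (norm_tsum_pow_apply_le h.summable_pow h1).trans ?_
  have h0 : 0 ≤ 2 * c ^ 3 := by have := h.c_nonneg; positivity
  calc _ ≤ c * (2 * c ^ 3) := mul_le_mul_of_nonneg_right h.tsum_pow_le h0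
    _ = _ := by ring

lemma summable_of_bdd (h : IsPerturbedChain A E₁ E₂ π R c ε μ ζ X) {g : ℕ → S → ℝ} {B : ℝ}
    (hg : ∀ n, ‖g n‖ ≤ B) : Summable fun m : ℕ => (A ^ m) (g m) :=
  summable_pow_apply h.summable_pow hg

/-- Expansion of `E[ζ_j Γ_0]`. -/
lemma norm_stateMean_input_sub_le (h : IsPerturbedChain A E₁ E₂ π R c ε μ ζ X) (j : ℕ) :
    ‖stateMean μ X 0 (ζ j) - ε ^ 2 • inputState A E₁ π R j‖ ≤ 5 * c ^ 4 * ε ^ 3 := by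
  have hprob := h.prob
  have hc := h.c_nonneg
  have hε := h.ε_nonneg
  have hg : ∀ m : ℕ, ‖R (j + 1 + m) • E₁ π‖ ≤ c := fun m => by
    rw [norm_smul]
    have := h.norm_E₁_apply_le h.norm_π_le
    calc _ ≤ 1 * (c * 1) := mul_le_mul (h.abs_R_le _) this (norm_nonneg _) zero_le_one
      _ = c := by ring
  have hsum : Summable fun m : ℕ => (A ^ m) (ε ^ 2 • R (j + 1 + m) • E₁ π) := by
    simpa only [map_smul] using (h.summable_of_bdd hg).const_smul (ε ^ 2)
  -- The input has mean zero, so centering is void and the leading term of E[ζ_jΓ_0] is of order ε².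
  have hcen : ∀ t, centeredMean μ X π t (ζ j) = stateMean μ X t (ζ j) := fun t => by
    rw [centeredMean, h.integral_input]; simp
  -- The source at time −(m+1) is E[ζ_tζ_jΓ_t]ℰ ≈ ε²R(j+1+m)πℰ. The 5 is 1 + 3 + 1: Taylor
  -- remainder, decoupling error of ζ_tζ_j, and the term with three inputs.
  have key := norm_sub_tsum_backward_le h.summable_pow
    (v := fun m : ℕ => stateMean μ X (0 - m) (ζ j))
    (g := fun m : ℕ => ε ^ 2 • R (j + 1 + m) • E₁ π) (η := 5 * c ^ 3 * ε ^ 3)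
    (B := ε) (fun n => norm_stateMean_le (h.isWeight_input _).bound) hsum (fun m => ?_)
  · simp only [Nat.cast_zero, sub_zero] at key
    have h1 : ∑' m : ℕ, (A ^ m) (ε ^ 2 • R (j + 1 + m) • E₁ π) =
        ε ^ 2 • inputState A E₁ π R j := by
      rw [inputState, ← tsum_const_smul'']; simp only [map_smul]
    rw [h1] at key
    refine key.trans ?_
    calc _ ≤ c * (5 * c ^ 3 * ε ^ 3) :=
          mul_le_mul_of_nonneg_right h.tsum_pow_le (by positivity)
      _ = _ := by ring
  · set t : ℤ := 0 - ((m + 1 : ℕ) : ℤ) with ht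
    have h1 := h.step t (ζ j) ε hε (h.isWeight_past (h.isWeight_input j) t)
    rw [hcen, hcen, show t + 1 = 0 - (m : ℤ) by rw [ht]; push_cast; ring] at h1
    have h2 := h.norm_E₁_apply_le (h.norm_stateMean_sub_le t j t)
    rw [show (j : ℤ) - t = j + 1 + m by rw [ht]; push_cast; ring, map_sub, map_smul,
      mul_smul] at h2
    have h3 := h.norm_half_E₂_le (norm_stateMean_le (X := X) (t := t)
      ((h.isWeight_input t).mul (h.isWeight_input_mul t j) hε).bound)
    have hb : stateMean μ X (0 - (m : ℤ)) (ζ j) - (A (stateMean μ X t (ζ j)) +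
        ε ^ 2 • R (j + 1 + m) • E₁ π) =
        (stateMean μ X (0 - (m : ℤ)) (ζ j) - (A (stateMean μ X t (ζ j)) +
          (E₁ (stateMean μ X t (ζ t * ζ j)) +
            (1 / 2 : ℝ) • E₂ (stateMean μ X t (ζ t * (ζ t * ζ j)))))) +
        (E₁ (stateMean μ X t (ζ t * ζ j)) - ε ^ 2 • R (j + 1 + m) • E₁ π) +
        (1 / 2 : ℝ) • E₂ (stateMean μ X t (ζ t * (ζ t * ζ j))) := by abel
    rw [hb]
    refine norm_add₃_le.trans ?_
    have h4 := h.c_pow_le (show 1 ≤ 3 by norm_num) 3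
    have h5 := h.c_pow_le (show 1 ≤ 3 by norm_num) 4
    have h6 := mul_le_mul_of_nonneg_left (h.ε_pow_le (show 3 ≤ 4 by norm_num))
      (show 0 ≤ c ^ 3 by positivity)
    linarith

/-- Expansion of `E[Γ_0]`. -/
lemma norm_mean_sub_le (h : IsPerturbedChain A E₁ E₂ π R c ε μ ζ X) :
    ‖stateMean μ X 0 1 - π - ε ^ 2 • meanShift A E₁ E₂ π R‖ ≤ 9 * c ^ 6 * ε ^ 3 := by
  have hprob := h.prob
  have hc := h.c_nonneg
  have hε := h.ε_nonneg
  have hcen : ∀ t, centeredMean μ X π t 1 = stateMean μ X 0 1 - π := fun t => by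
    rw [centeredMean, h.stationary]; simp
  have hsum : Summable fun m : ℕ =>
      (A ^ m) (ε ^ 2 • (E₁ (inputState A E₁ π R 0) + (R 0 / 2) • E₂ π)) :=
    h.summable_of_bdd (fun _ => le_rfl)
  -- By stationarity the sequence is constant, so the recursion becomes a fixed point equation for
  -- E[Γ_0] − π. The 9 is 1 + 5 + 3: Taylor remainder, error in E[ζ_0Γ_0], error in E[ζ_0²Γ_0].
  have key := norm_sub_tsum_backward_le h.summable_pow
    (v := fun _ : ℕ => stateMean μ X 0 1 - π)
    (g := fun _ : ℕ => ε ^ 2 • (E₁ (inputState A E₁ π R 0) + (R 0 / 2) • E₂ π))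
    (η := 9 * c ^ 5 * ε ^ 3) (fun n => le_rfl) hsum (fun m => ?_)
  · have h1 : ∑' m : ℕ, (A ^ m) (ε ^ 2 • (E₁ (inputState A E₁ π R 0) + (R 0 / 2) • E₂ π)) =
        ε ^ 2 • meanShift A E₁ E₂ π R := by
      rw [meanShift, ← tsum_const_smul'']; simp only [map_smul]
    rw [h1] at key
    refine key.trans ?_
    calc _ ≤ c * (9 * c ^ 5 * ε ^ 3) :=
          mul_le_mul_of_nonneg_right h.tsum_pow_le (by positivity)
      _ = _ := by ring
  · have h1 := h.step 0 1 1 zero_le_one (h.isWeight_past h.isWeight_one 0)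
    rw [hcen, hcen, mul_one] at h1
    have h2 := h.norm_E₁_apply_le (h.norm_stateMean_input_sub_le 0)
    have h3 := h.norm_half_E₂_le (h.norm_stateMean_sub_le 0 0 0)
    rw [map_sub, map_smul] at h2 h3
    rw [sub_self] at h3
    simp only [Nat.cast_zero] at h2
    have hb : stateMean μ X 0 1 - π - (A (stateMean μ X 0 1 - π) +
        ε ^ 2 • (E₁ (inputState A E₁ π R 0) + (R 0 / 2) • E₂ π)) =
        (stateMean μ X 0 1 - π - (A (stateMean μ X 0 1 - π) +
          (E₁ (stateMean μ X 0 (ζ 0)) +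
            (1 / 2 : ℝ) • E₂ (stateMean μ X 0 (ζ 0 * ζ 0))))) +
        (E₁ (stateMean μ X 0 (ζ 0)) - ε ^ 2 • E₁ (inputState A E₁ π R 0)) +
        (1 / 2 : ℝ) • (E₂ (stateMean μ X 0 (ζ 0 * ζ 0)) - (ε ^ 2 * R 0) • E₂ π) := by
      module
    rw [hb]
    refine norm_add₃_le.trans ?_
    have h4 := h.c_pow_le (show 1 ≤ 5 by norm_num) 3
    have h5 := h.c_pow_le (show 3 ≤ 5 by norm_num) 3
    linarith

end IsPerturbedChain
end Chain

/-! ### Expansion of correlations with the state at time zero -/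

lemma norm_single_apply_le {S : Type*} [Fintype S] [DecidableEq S] (i : S) (v : S → ℝ) : ‖(Pi.single i (v i) : S → ℝ)‖ ≤ ‖v‖ := by
  rw [pi_norm_le_iff_of_nonneg (norm_nonneg _)]
  intro j
  by_cases hj : j = i
  · subst hj; simpa using norm_le_pi_norm v j
  · simp [hj]

section Chain

variable {S : Type*} [Fintype S] [DecidableEq S] [MeasurableSpace S] [DiscreteMeasurableSpace S]
  {Ω : Type*} [MeasurableSpace Ω]

namespace IsPerturbedChain

variable {A E₁ E₂ : (S → ℝ) →L[ℝ] (S → ℝ)} {π : S → ℝ} {R : ℤ → ℝ} {c ε : ℝ}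
    {μ : Measure Ω} {ζ : ℤ → Ω → ℝ} {X : ℤ → Ω → S}

lemma mean_mem_Icc (h : IsPerturbedChain A E₁ E₂ π R c ε μ ζ X) (i : S) :
    0 ≤ stateMean μ X 0 1 i ∧ stateMean μ X 0 1 i ≤ 1 := by
  have hprob := h.prob
  constructor
  · refine integral_nonneg fun ω => ?_
    simp only [Pi.one_apply, one_mul, stateInd]
    split_ifs <;> simp
  · exact (le_abs_self _).trans ((norm_le_pi_norm (stateMean μ X 0 1) i).trans
      (norm_stateMean_le h.isWeight_one.bound))

/-- This weight sees X_0, so it is admissible only from time 0 on; recursions involving it must run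
forward from an explicit initial value. -/
lemma isWeight_centeredInd (h : IsPerturbedChain A E₁ E₂ π R c ε μ ζ X) (i : S) {t : ℤ}
    (ht : 0 ≤ t) : IsWeight (pastSigma ζ X t) μ (centeredInd μ X i) 1 := by
  refine ⟨(measurable_stateInd_pastSigma ζ X ht i).sub_const _, Eventually.of_forall fun ω => ?_⟩
  obtain ⟨h0, h1⟩ := h.mean_mem_Icc i
  rw [centeredInd, stateInd, abs_le]
  split_ifs <;> constructor <;> linarith

lemma integral_mul_centeredInd (h : IsPerturbedChain A E₁ E₂ π R c ε μ ζ X) (i : S) {V : Ω → ℝ}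
    (hV : Integrable V μ) : ∫ ω, (V * centeredInd μ X i) ω ∂μ =
      stateMean μ X 0 V i - stateMean μ X 0 1 i * ∫ ω, V ω ∂μ := by
  have := h.prob
  simp only [Pi.mul_apply, centeredInd, mul_sub]
  rw [integral_sub (integrable_mul_stateInd (h.measurable_state 0) hV i) (hV.mul_const _),
    integral_mul_const, mul_comm (∫ ω, V ω ∂μ)]
  rfl

/-- Distinct states exclude each other at time 0, which leaves only a diagonal term and a product of
means. This is the initial value of the forward recursions. -/
lemma stateMean_mul_centeredInd (h : IsPerturbedChain A E₁ E₂ π R c ε μ ζ X) (i : S) {V : Ω → ℝ}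
    (hV : Integrable V μ) : stateMean μ X 0 (V * centeredInd μ X i) =
      Pi.single i (stateMean μ X 0 V i) - stateMean μ X 0 1 i • stateMean μ X 0 V := by
  have := h.prob
  have hint : ∀ x, Integrable (fun ω => V ω * stateInd X 0 x ω) μ :=
    integrable_mul_stateInd (h.measurable_state 0) hV
  ext j
  simp only [Pi.sub_apply, Pi.smul_apply, smul_eq_mul]
  have h1 : stateMean μ X 0 (V * centeredInd μ X i) j =
      ∫ ω, ((if i = j then V ω * stateInd X 0 i ω else 0) -
        stateMean μ X 0 1 i * (V ω * stateInd X 0 j ω)) ∂μ := by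
    refine integral_congr_ae (Eventually.of_forall fun ω => ?_)
    have h2 := stateInd_mul_stateInd X 0 i j ω
    simp only [Pi.mul_apply, centeredInd]
    split_ifs at h2 ⊢ with hij
    · linear_combination V ω * h2
    · linear_combination V ω * h2
  rw [h1]
  by_cases hij : i = j
  · subst hij
    simp only [if_true, Pi.single_eq_same]
    rw [integral_sub (hint i) ((hint i).const_mul _), integral_const_mul]
    rfl
  · simp only [if_neg hij, zero_sub, integral_neg, integral_const_mul]
    rw [Pi.single_eq_of_ne (Ne.symm hij), zero_sub]
    rfl

lemma norm_mean_sub_coarse (h : IsPerturbedChain A E₁ E₂ π R c ε μ ζ X) :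
    ‖stateMean μ X 0 1 - π‖ ≤ 3 * c ^ 2 * ε := by
  have := h.prob
  have := h.norm_centeredMean_input_le 0 zero_le_one h.isWeight_one
  simpa [centeredMean] using this

lemma norm_mean_apply_le (h : IsPerturbedChain A E₁ E₂ π R c ε μ ζ X) (i : S) :
    ‖stateMean μ X 0 1 i‖ ≤ 1 := by
  obtain ⟨h0, h1⟩ := h.mean_mem_Icc i
  rw [Real.norm_eq_abs, abs_le]; constructor <;> linarith

/-- Leading term of `Cov(1{X_0 = i}, Γ_n)` against an input-measurable weight. -/
lemma norm_stateMean_mul_centeredInd_sub_le (h : IsPerturbedChain A E₁ E₂ π R c ε μ ζ X) (i : S)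
    {V : Ω → ℝ} (hV : IsWeight (inputSigma ζ) μ V (ε ^ 2)) (n : ℕ) :
    ‖stateMean μ X n (V * centeredInd μ X i) - (∫ ω, V ω ∂μ) • (A ^ n) (stateCov π i)‖ ≤
      21 * c ^ 3 * ε ^ 3 := by
  have hprob := h.prob
  have hc := h.c_nonneg
  have hε := h.ε_nonneg
  have hVint := hV.integrable h.inputSigma_le
  set r := ∫ ω, V ω ∂μ with hr
  set a := stateMean μ X 0 V with ha
  set p := stateMean μ X 0 1 with hp
  have hrle : |r| ≤ ε ^ 2 := hV.abs_integral_le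
  have haπ : ‖a - r • π‖ ≤ 3 * c ^ 2 * ε ^ 3 :=
    (h.norm_centeredMean_input_le 0 (by positivity) hV).trans_eq (by ring)
  have hpπ : ‖p - π‖ ≤ 3 * c ^ 2 * ε := h.norm_mean_sub_coarse
  have hpi : |p i - π i| ≤ 3 * c ^ 2 * ε := (norm_le_pi_norm (p - π) i).trans hpπ
  have hs := h.stateMean_mul_centeredInd i hVint
  have hm := h.integral_mul_centeredInd i hVint
  rw [← hr] at hm
  have hmle : |∫ ω, (V * centeredInd μ X i) ω ∂μ| ≤ 6 * c ^ 2 * ε ^ 3 := by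
    rw [hm, show a i - p i * r = (a i - r * π i) - (p i - π i) * r by ring]
    refine (abs_sub _ _).trans ?_
    have h1 : |a i - r * π i| ≤ 3 * c ^ 2 * ε ^ 3 := (norm_le_pi_norm (a - r • π) i).trans haπ
    have h2 : |(p i - π i) * r| ≤ 3 * c ^ 2 * ε * ε ^ 2 := by
      rw [abs_mul]; exact mul_le_mul hpi hrle (abs_nonneg _) (by positivity)
    linarith
  have hmπ : ‖(∫ ω, (V * centeredInd μ X i) ω ∂μ) • π‖ ≤ 6 * c ^ 2 * ε ^ 3 := by
    rw [norm_smul]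
    calc _ ≤ (6 * c ^ 2 * ε ^ 3) * 1 :=
          mul_le_mul hmle h.norm_π_le (norm_nonneg _) (by positivity)
      _ = _ := mul_one _
  have h0 : ‖centeredMean μ X π ((0 : ℕ) : ℤ) (V * centeredInd μ X i) - r • stateCov π i‖ ≤
      15 * c ^ 2 * ε ^ 3 := by
    have hb : centeredMean μ X π 0 (V * centeredInd μ X i) - r • stateCov π i =
        (Pi.single i ((a - r • π) i) - p i • (a - r • π)) - (r * (p i - π i)) • π -
          (∫ ω, (V * centeredInd μ X i) ω ∂μ) • π := by
      rw [centeredMean, hs, stateCov, Pi.sub_apply, Pi.smul_apply, Pi.single_sub, Pi.single_smul]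
      module
    rw [Nat.cast_zero, hb]
    refine (norm_sub_le _ _).trans ?_
    have h1 : ‖(Pi.single i ((a - r • π) i) : S → ℝ) - p i • (a - r • π)‖ ≤
        3 * c ^ 2 * ε ^ 3 + 1 * (3 * c ^ 2 * ε ^ 3) := by
      refine (norm_sub_le _ _).trans (add_le_add ((norm_single_apply_le _ _).trans haπ) ?_)
      rw [norm_smul]
      exact mul_le_mul (h.norm_mean_apply_le i) haπ (norm_nonneg _) zero_le_one
    have h2 : ‖(r * (p i - π i)) • π‖ ≤ ε ^ 2 * (3 * c ^ 2 * ε) * 1 := by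
      rw [norm_smul, norm_mul]
      exact mul_le_mul (mul_le_mul hrle hpi (norm_nonneg _) (by positivity)) h.norm_π_le
        (norm_nonneg _) (by positivity)
    have h3 := norm_sub_le ((Pi.single i ((a - r • π) i) : S → ℝ) - p i • (a - r • π))
      ((r * (p i - π i)) • π)
    linarith
  -- V has size ε², so the coarse step already has a third-order defect and no source is needed. The
  -- initial error 15 is 6 + 3 + 6, which dominates the step defect 3.
  have key := norm_sub_recursionSol_le h.summable_pow
    (v := fun m : ℕ => centeredMean μ X π m (V * centeredInd μ X i)) (g := fun _ => 0)
    (η := 15 * c ^ 2 * ε ^ 3) n h0 (fun m _ => by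
      have := h.step_coarse (by positivity : 0 ≤ ε ^ 2 * 1)
        ((h.isWeight_past hV m).mul (h.isWeight_centeredInd i (Int.natCast_nonneg m))
          (by positivity))
      rw [add_zero, Nat.cast_succ]
      refine this.trans ?_
      have h4 := h.c_pow_le (show 1 ≤ 2 by norm_num) 3
      have h5 : 0 ≤ c ^ 2 * ε ^ 3 := by positivity
      linarith)
  rw [recursionSol_zero, map_smul] at key
  have hb : stateMean μ X n (V * centeredInd μ X i) - r • (A ^ n) (stateCov π i) =
      (centeredMean μ X π n (V * centeredInd μ X i) - r • (A ^ n) (stateCov π i)) +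
        (∫ ω, (V * centeredInd μ X i) ω ∂μ) • π := by
    rw [centeredMean]; abel
  rw [hb]
  refine (norm_add_le _ _).trans ?_
  have h6 : (∑' m : ℕ, ‖A ^ m‖) * (15 * c ^ 2 * ε ^ 3) ≤ c * (15 * c ^ 2 * ε ^ 3) :=
    mul_le_mul_of_nonneg_right h.tsum_pow_le (by positivity)
  have h7 := h.c_pow_le (show 2 ≤ 3 by norm_num) 3
  linarith

/-- Expansion of `Cov(1{X_0 = i}, ζ_j Γ_j)`. -/
lemma norm_inputStateCov_sub_le (h : IsPerturbedChain A E₁ E₂ π R c ε μ ζ X) (i : S) (j : ℕ) :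
    ‖stateMean μ X j (ζ j * centeredInd μ X i) - ε ^ 2 • inputStateCov A E₁ π R i j‖ ≤
      28 * c ^ 5 * ε ^ 3 := by
  have hprob := h.prob
  have hc := h.c_nonneg
  have hε := h.ε_nonneg
  have hζint := (h.isWeight_input j).integrable h.inputSigma_le
  set q := inputState A E₁ π R j with hq
  set a := stateMean μ X 0 (ζ j) with ha
  set p := stateMean μ X 0 1 with hp
  have haq : ‖a - ε ^ 2 • q‖ ≤ 5 * c ^ 4 * ε ^ 3 := h.norm_stateMean_input_sub_le j
  have hpi : |p i - π i| ≤ 3 * c ^ 2 * ε :=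
    (norm_le_pi_norm (p - π) i).trans h.norm_mean_sub_coarse
  have hs := h.stateMean_mul_centeredInd i hζint
  have hm := h.integral_mul_centeredInd i hζint
  rw [h.integral_input, mul_zero, sub_zero] at hm
  have haiπ : ‖(a i - ε ^ 2 * q i) • π‖ ≤ 5 * c ^ 4 * ε ^ 3 * 1 := by
    rw [norm_smul]
    exact mul_le_mul ((norm_le_pi_norm (a - ε ^ 2 • q) i).trans haq) h.norm_π_le
      (norm_nonneg _) (by positivity)
  have h0 : ‖centeredMean μ X π ((0 : ℕ) : ℤ) (ζ j * centeredInd μ X i) -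
      (0 + ε ^ 2 • coupling π i q)‖ ≤ 23 * c ^ 4 * ε ^ 3 := by
    have hb : centeredMean μ X π 0 (ζ j * centeredInd μ X i) - (0 + ε ^ 2 • coupling π i q) =
        (Pi.single i ((a - ε ^ 2 • q) i) - p i • (a - ε ^ 2 • q)) -
          (ε ^ 2 * (p i - π i)) • q - (a i - ε ^ 2 * q i) • π := by
      rw [centeredMean, hs, hm, coupling, Pi.sub_apply, Pi.smul_apply, Pi.single_sub,
        Pi.single_smul]
      module
    rw [Nat.cast_zero, hb]
    refine (norm_sub_le _ _).trans ?_
    have h1 : ‖(Pi.single i ((a - ε ^ 2 • q) i) : S → ℝ) - p i • (a - ε ^ 2 • q)‖ ≤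
        5 * c ^ 4 * ε ^ 3 + 1 * (5 * c ^ 4 * ε ^ 3) := by
      refine (norm_sub_le _ _).trans (add_le_add ((norm_single_apply_le _ _).trans haq) ?_)
      rw [norm_smul]
      exact mul_le_mul (h.norm_mean_apply_le i) haq (norm_nonneg _) zero_le_one
    have h2 : ‖(ε ^ 2 * (p i - π i)) • q‖ ≤ ε ^ 2 * (3 * c ^ 2 * ε) * c ^ 2 := by
      rw [norm_smul, norm_mul, norm_pow, Real.norm_of_nonneg hε]
      exact mul_le_mul (mul_le_mul_of_nonneg_left hpi (by positivity)) (h.norm_inputState_le j)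
        (norm_nonneg _) (by positivity)
    have h3 := norm_sub_le ((Pi.single i ((a - ε ^ 2 • q) i) : S → ℝ) - p i • (a - ε ^ 2 • q))
      ((ε ^ 2 * (p i - π i)) • q)
    have h4 : 0 ≤ c ^ 4 * ε ^ 3 := by positivity
    linarith
  -- The weight keeps ζ_j fixed while the state moves from 0 to j, so the source at time n carries
  -- the lag j − n. The 23 is the step defect 1 + 21 + 1; it dominates the initial error 10 + 3 + 5.
  have key := norm_sub_recursionSol_le h.summable_pow
    (v := fun m : ℕ => centeredMean μ X π m (ζ j * centeredInd μ X i))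
    (g := fun n => ε ^ 2 • R (j - n) • E₁ ((A ^ n) (stateCov π i)))
    (η := 23 * c ^ 4 * ε ^ 3) j h0 (fun m _ => ?_)
  · rw [recursionSol_add_smul, map_zero, zero_add] at key
    have hb : stateMean μ X j (ζ j * centeredInd μ X i) - ε ^ 2 • inputStateCov A E₁ π R i j =
        (centeredMean μ X π j (ζ j * centeredInd μ X i) -
          ε ^ 2 • recursionSol A (fun n => R (j - n) • E₁ ((A ^ n) (stateCov π i)))
            (coupling π i q) j) + (a i - ε ^ 2 * q i) • π := by
      rw [centeredMean, inputStateCov, hm]; module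
    rw [hb]
    refine (norm_add_le _ _).trans ?_
    have h6 : (∑' m : ℕ, ‖A ^ m‖) * (23 * c ^ 4 * ε ^ 3) ≤ c * (23 * c ^ 4 * ε ^ 3) :=
      mul_le_mul_of_nonneg_right h.tsum_pow_le (by positivity)
    have h7 := h.c_pow_le (show 4 ≤ 5 by norm_num) 3
    linarith
  · have hW := (h.isWeight_past (h.isWeight_input j) m).mul
      (h.isWeight_centeredInd i (Int.natCast_nonneg m)) hε
    rw [mul_one] at hW
    have h1 := h.step m _ ε hε hW
    have h2 := h.norm_E₁_apply_le
      (h.norm_stateMean_mul_centeredInd_sub_le i (h.isWeight_input_mul m j) m)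
    rw [h.integral_input_mul, map_sub, map_smul, mul_smul] at h2
    have hζm := h.isWeight_past (h.isWeight_input m) m
    have h3 := h.norm_half_E₂_le (norm_stateMean_le (X := X) (t := m)
      (hζm.mul (hζm.mul hW hε) hε).bound)
    rw [Nat.cast_succ]
    rw [mul_assoc] at h2
    have hb : centeredMean μ X π (m + 1) (ζ j * centeredInd μ X i) -
        (A (centeredMean μ X π m (ζ j * centeredInd μ X i)) +
          ε ^ 2 • R (j - m) • E₁ ((A ^ m) (stateCov π i))) =
        (centeredMean μ X π (m + 1) (ζ j * centeredInd μ X i) -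
          (A (centeredMean μ X π m (ζ j * centeredInd μ X i)) +
          (E₁ (stateMean μ X m (ζ m * (ζ j * centeredInd μ X i))) +
            (1 / 2 : ℝ) • E₂ (stateMean μ X m (ζ m * (ζ m * (ζ j * centeredInd μ X i))))))) +
        (E₁ (stateMean μ X m (ζ m * (ζ j * centeredInd μ X i))) -
          ε ^ 2 • R (j - m) • E₁ ((A ^ m) (stateCov π i))) +
        (1 / 2 : ℝ) • E₂ (stateMean μ X m (ζ m * (ζ m * (ζ j * centeredInd μ X i)))) := by abel
    rw [hb]
    refine norm_add₃_le.trans ?_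
    have h4 := h.c_pow_le (show 1 ≤ 4 by norm_num) 3
    have h5 := mul_le_mul_of_nonneg_left (h.ε_pow_le (show 3 ≤ 4 by norm_num)) hc
    linarith

/-- Expansion of `Cov(1{X_0 = i}, Γ_k)`. -/
lemma norm_covShift_sub_le (h : IsPerturbedChain A E₁ E₂ π R c ε μ ζ X) (i : S) (k : ℕ) :
    ‖stateMean μ X k (centeredInd μ X i) -
      ((A ^ k) (stateCov π i) + ε ^ 2 • covShift A E₁ E₂ π R i k)‖ ≤ 50 * c ^ 7 * ε ^ 3 := by
  have hprob := h.prob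
  have hc := h.c_nonneg
  have hε := h.ε_nonneg
  set s := meanShift A E₁ E₂ π R with hs'
  set p := stateMean μ X 0 1 with hp
  have hps : ‖p - π - ε ^ 2 • s‖ ≤ 9 * c ^ 6 * ε ^ 3 := h.norm_mean_sub_le
  have hpi : |p i - π i| ≤ 3 * c ^ 2 * ε :=
    (norm_le_pi_norm (p - π) i).trans h.norm_mean_sub_coarse
  have h1int : Integrable (1 : Ω → ℝ) μ := h.isWeight_one.integrable h.inputSigma_le
  have hs := h.stateMean_mul_centeredInd i h1int
  have hm := h.integral_mul_centeredInd i h1int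
  rw [one_mul] at hs hm
  simp only [Pi.one_apply, integral_const, probReal_univ, smul_eq_mul, mul_one, sub_self] at hm
  have hcen : ∀ t, centeredMean μ X π t (centeredInd μ X i) =
      stateMean μ X t (centeredInd μ X i) := fun t => by
    rw [centeredMean, hm, zero_smul, sub_zero]
  have h0 : ‖stateMean μ X ((0 : ℕ) : ℤ) (centeredInd μ X i) -
      (stateCov π i + ε ^ 2 • coupling π i s)‖ ≤ 50 * c ^ 6 * ε ^ 3 := by
    -- The covariance at lag zero is diag(p) − pᵀp with p = E[Γ_0]. `coupling π i` is row i of its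
    -- derivative at π, applied to the shift s of the mean.
    have hb : stateMean μ X 0 (centeredInd μ X i) - (stateCov π i + ε ^ 2 • coupling π i s) =
        (Pi.single i ((p - π - ε ^ 2 • s) i) - p i • (p - π - ε ^ 2 • s)) -
          (ε ^ 2 * (p i - π i)) • s - (p i - π i - ε ^ 2 * s i) • π := by
      rw [hs, coupling, stateCov, Pi.sub_apply, Pi.sub_apply, Pi.smul_apply, Pi.single_sub,
        Pi.single_sub, Pi.single_smul]
      module
    rw [Nat.cast_zero, hb]
    refine (norm_sub_le _ _).trans ?_
    have h1 : ‖(Pi.single i ((p - π - ε ^ 2 • s) i) : S → ℝ) - p i • (p - π - ε ^ 2 • s)‖ ≤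
        9 * c ^ 6 * ε ^ 3 + 1 * (9 * c ^ 6 * ε ^ 3) := by
      refine (norm_sub_le _ _).trans (add_le_add ((norm_single_apply_le _ _).trans hps) ?_)
      rw [norm_smul]
      exact mul_le_mul (h.norm_mean_apply_le i) hps (norm_nonneg _) zero_le_one
    have h2 : ‖(ε ^ 2 * (p i - π i)) • s‖ ≤ ε ^ 2 * (3 * c ^ 2 * ε) * (2 * c ^ 4) := by
      rw [norm_smul, norm_mul, norm_pow, Real.norm_of_nonneg hε]
      exact mul_le_mul (mul_le_mul_of_nonneg_left hpi (by positivity)) h.norm_meanShift_le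
        (norm_nonneg _) (by positivity)
    have h2' : ‖(p i - π i - ε ^ 2 * s i) • π‖ ≤ 9 * c ^ 6 * ε ^ 3 * 1 := by
      rw [norm_smul]
      exact mul_le_mul ((norm_le_pi_norm (p - π - ε ^ 2 • s) i).trans hps) h.norm_π_le
        (norm_nonneg _) (by positivity)
    have h3 := norm_sub_le ((Pi.single i ((p - π - ε ^ 2 • s) i) : S → ℝ) -
      p i • (p - π - ε ^ 2 • s)) ((ε ^ 2 * (p i - π i)) • s)
    have h4 : 0 ≤ c ^ 6 * ε ^ 3 := by positivity
    linarith
  -- The 50 is the step defect 1 + 28 + 21: Taylor remainder, `norm_inputStateCov_sub_le`, and the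
  -- term with ζ_m². It dominates the initial error 18 + 6 + 9.
  have key := norm_sub_recursionSol_le h.summable_pow
    (v := fun m : ℕ => stateMean μ X m (centeredInd μ X i))
    (g := fun n => ε ^ 2 • (E₁ (inputStateCov A E₁ π R i n) +
      (R 0 / 2) • E₂ ((A ^ n) (stateCov π i))))
    (η := 50 * c ^ 6 * ε ^ 3) k h0 (fun m _ => ?_)
  · rw [recursionSol_add_smul] at key
    refine key.trans ?_
    calc _ ≤ c * (50 * c ^ 6 * ε ^ 3) :=
          mul_le_mul_of_nonneg_right h.tsum_pow_le (by positivity)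
      _ = _ := by ring
  · have h1 := h.step m _ 1 zero_le_one (h.isWeight_centeredInd i (Int.natCast_nonneg m))
    rw [hcen, hcen, mul_one] at h1
    have h2 := h.norm_E₁_apply_le (h.norm_inputStateCov_sub_le i m)
    rw [map_sub, map_smul] at h2
    have h3 := h.norm_half_E₂_le
      (h.norm_stateMean_mul_centeredInd_sub_le i (h.isWeight_input_mul m m) m)
    rw [h.integral_input_mul, map_sub, map_smul, sub_self, mul_assoc (ζ m)] at h3
    rw [Nat.cast_succ]
    have hb : stateMean μ X (m + 1) (centeredInd μ X i) -
        (A (stateMean μ X m (centeredInd μ X i)) +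
          ε ^ 2 • (E₁ (inputStateCov A E₁ π R i m) + (R 0 / 2) • E₂ ((A ^ m) (stateCov π i)))) =
        (stateMean μ X (m + 1) (centeredInd μ X i) -
          (A (stateMean μ X m (centeredInd μ X i)) +
          (E₁ (stateMean μ X m (ζ m * centeredInd μ X i)) +
            (1 / 2 : ℝ) • E₂ (stateMean μ X m (ζ m * (ζ m * centeredInd μ X i)))))) +
        (E₁ (stateMean μ X m (ζ m * centeredInd μ X i)) -
          ε ^ 2 • E₁ (inputStateCov A E₁ π R i m)) +
        (1 / 2 : ℝ) • (E₂ (stateMean μ X m (ζ m * (ζ m * centeredInd μ X i))) -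
          (ε ^ 2 * R 0) • E₂ ((A ^ m) (stateCov π i))) := by module
    rw [hb]
    refine norm_add₃_le.trans ?_
    have h4 := h.c_pow_le (show 1 ≤ 6 by norm_num) 3
    have h5 := h.c_pow_le (show 4 ≤ 6 by norm_num) 3
    linarith

end IsPerturbedChain
end Chain

/-! ### Stationary realizations are perturbed chains -/

section Input

/-- Autocovariance of the unscaled input. -/
def inputCov (ν : Measure (ℤ → ℝ)) (k : ℤ) : ℝ := cov[fun z : ℤ → ℝ => z 0, fun z => z k; ν]

variable {ν : Measure (ℤ → ℝ)}

lemma IsInputLaw.inputCov_eq (hν : IsInputLaw ν) (k : ℤ) :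
    inputCov ν k = ∫ z, z 0 * z k ∂ν := by
  simp [inputCov, covariance, hν.mean_zero]

lemma IsInputLaw.integral_mul (hν : IsInputLaw ν) (s t : ℤ) :
    ∫ z, z s * z t ∂ν = inputCov ν (t - s) := by
  rw [hν.inputCov_eq]
  conv_rhs => rw [← hν.stationary s]
  rw [integral_map (measurable_pi_lambda _ fun t => measurable_pi_apply (t + s)).aemeasurable
    (by exact ((measurable_pi_apply 0).mul (measurable_pi_apply (t - s))).aestronglyMeasurable)]
  simp

lemma IsInputLaw.abs_inputCov_le (hν : IsInputLaw ν) (k : ℤ) : |inputCov ν k| ≤ 1 := by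
  have := hν.prob
  rw [hν.inputCov_eq]
  have hb : ∀ᵐ z ∂ν, ‖z 0 * z k‖ ≤ 1 := by
    filter_upwards [hν.bounded 0, hν.bounded k] with z h0 hk
    rw [norm_mul]
    exact mul_le_one₀ h0 (norm_nonneg _) hk
  simpa using norm_integral_le_of_norm_le_const hb

end Input

section Realization

variable {S : Type*} [Fintype S] [DecidableEq S] [MeasurableSpace S] [DiscreteMeasurableSpace S]
  {P : ℝ → Matrix S S ℝ} {ν : Measure (ℤ → ℝ)} {ε : ℝ} {π : S → ℝ}
  {Ω : Type*} [MeasurableSpace Ω] {μ : Measure Ω} {ζ : ℤ → Ω → ℝ} {X : ℤ → Ω → S}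

namespace IsStationaryRealization

lemma measurable_path (h : IsStationaryRealization P ν ε μ ζ X) :
    Measurable fun ω (t : ℤ) => ζ t ω :=
  measurable_pi_lambda _ h.measurable_input

lemma measurable_scale (ε : ℝ) : Measurable fun (z : ℤ → ℝ) (t : ℤ) => ε * z t := by fun_prop

lemma ae_input_le (h : IsStationaryRealization P ν ε μ ζ X) (hν : IsInputLaw ν) (hε : 0 ≤ ε)
    (t : ℤ) : ∀ᵐ ω ∂μ, |ζ t ω| ≤ ε := by
  have hs : MeasurableSet {z : ℤ → ℝ | |z t| ≤ ε} :=
    measurableSet_le (measurable_pi_apply t).abs measurable_const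
  have h1 : ∀ᵐ z ∂(ν.map fun z t => ε * z t), |z t| ≤ ε := by
    rw [ae_map_iff (measurable_scale ε).aemeasurable hs]
    filter_upwards [hν.bounded t] with z hz
    rw [abs_mul, abs_of_nonneg hε]
    exact mul_le_of_le_one_right hε hz
  rw [← h.law_input, ae_map_iff h.measurable_path.aemeasurable hs] at h1
  exact h1

lemma integral_input_eq (h : IsStationaryRealization P ν ε μ ζ X) {f : (ℤ → ℝ) → ℝ}
    (hf : Measurable f) : ∫ ω, f (fun t => ζ t ω) ∂μ = ∫ z, f (fun t => ε * z t) ∂ν := by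
  rw [← integral_map h.measurable_path.aemeasurable hf.aestronglyMeasurable, h.law_input,
    integral_map (measurable_scale ε).aemeasurable hf.aestronglyMeasurable]

lemma measurable_joint (h : IsStationaryRealization P ν ε μ ζ X) (s : ℤ) :
    Measurable fun ω (t : ℤ) => (ζ (t + s) ω, X (t + s) ω) :=
  measurable_pi_lambda _ fun _ => (h.measurable_input _).prodMk (h.measurable_state _)

lemma measurable_joint_zero (h : IsStationaryRealization P ν ε μ ζ X) :
    Measurable fun ω (t : ℤ) => (ζ t ω, X t ω) :=
  measurable_pi_lambda _ fun _ => (h.measurable_input _).prodMk (h.measurable_state _)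

lemma measurable_pathInd (x : S) (t : ℤ) :
    Measurable fun z : ℤ → ℝ × S => if (z t).2 = x then (1 : ℝ) else 0 :=
  (measurable_of_countable fun y : S => if y = x then (1 : ℝ) else 0).comp
    (measurable_snd.comp (measurable_pi_apply t))

lemma integral_stateInd (h : IsStationaryRealization P ν ε μ ζ X) (t : ℤ) (x : S) :
    ∫ ω, stateInd X t x ω ∂μ = ∫ ω, stateInd X 0 x ω ∂μ := by
  have h1 := congrArg (fun m => ∫ z : ℤ → ℝ × S, (if (z 0).2 = x then (1 : ℝ) else 0) ∂m)
    (h.stationary t)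
  beta_reduce at h1
  rw [integral_map (h.measurable_joint t).aemeasurable
    (measurable_pathInd x 0).aestronglyMeasurable, integral_map h.measurable_joint_zero.aemeasurable
    (measurable_pathInd x 0).aestronglyMeasurable] at h1
  simpa [stateInd] using h1

lemma covariance_stateInd (h : IsStationaryRealization P ν ε μ ζ X) (s t : ℤ) (i j : S) :
    cov[stateInd X s i, stateInd X t j; μ] = cov[stateInd X 0 i, stateInd X (t - s) j; μ] := by
  have h1 := congrArg (fun m => cov[fun z : ℤ → ℝ × S => if (z 0).2 = i then (1 : ℝ) else 0,
    fun z : ℤ → ℝ × S => if (z (t - s)).2 = j then (1 : ℝ) else 0; m]) (h.stationary s)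
  beta_reduce at h1
  rw [covariance_map_fun (measurable_pathInd i 0).aestronglyMeasurable
      (measurable_pathInd j _).aestronglyMeasurable (h.measurable_joint s).aemeasurable,
    covariance_map_fun (measurable_pathInd i 0).aestronglyMeasurable
      (measurable_pathInd j _).aestronglyMeasurable h.measurable_joint_zero.aemeasurable] at h1
  simp only [zero_add, sub_add_cancel] at h1
  exact h1

lemma pastSigma_le (h : IsStationaryRealization P ν ε μ ζ X) (t : ℤ) :
    pastSigma ζ X t ≤ (inferInstance : MeasurableSpace Ω) :=
  sup_le (iSup_le fun s => (h.measurable_input s).comap_le)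
    (iSup₂_le fun r _ => (h.measurable_state r).comap_le)

/-- W is measurable for the past, so it can be pulled out of the conditional expectation of the next
indicator. -/
lemma stateMean_succ (h : IsStationaryRealization P ν ε μ ζ X) {t : ℤ} {W : Ω → ℝ} {w : ℝ}
    (hW : IsWeight (pastSigma ζ X t) μ W w) (y : S) :
    Integrable (fun ω => W ω * P (ζ t ω) (X t ω) y) μ ∧
      stateMean μ X (t + 1) W y = ∫ ω, W ω * P (ζ t ω) (X t ω) y ∂μ := by
  have := h.prob
  have hind : {ω | X (t + 1) ω = y}.indicator (fun _ => (1 : ℝ)) = stateInd X (t + 1) y := by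
    ext ω; simp [Set.indicator, stateInd]
  have htr := h.transition t y
  rw [hind] at htr
  have hWi := hW.integrable (h.pastSigma_le t)
  have hint := integrable_mul_stateInd (h.measurable_state (t + 1)) hWi y
  have hindint : Integrable (stateInd X (t + 1) y) μ :=
    Integrable.of_bound (measurable_stateInd (h.measurable_state _) y).aestronglyMeasurable 1
      (Eventually.of_forall fun ω => abs_stateInd_le X _ y ω)
  have hce : μ[W * stateInd X (t + 1) y | pastSigma ζ X t] =ᵐ[μ]
      fun ω => W ω * P (ζ t ω) (X t ω) y := by
    refine (condExp_mul_of_stronglyMeasurable_left hW.meas.stronglyMeasurable hint hindint).trans ?_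
    filter_upwards [htr] with ω hω
    rw [Pi.mul_apply]
    exact congrArg (W ω * ·) hω
  -- P is regular only near 0, so integrability is read off from the conditional expectation, which
  -- agrees almost everywhere with this product.
  refine ⟨integrable_condExp.congr hce, ?_⟩
  rw [← integral_congr_ae hce, integral_condExp (h.pastSigma_le t)]
  rfl

lemma integrable_mul_apply_state (h : IsStationaryRealization P ν ε μ ζ X) {t : ℤ} {W : Ω → ℝ}
    (hW : Integrable W μ) (f : S → ℝ) : Integrable (fun ω => W ω * f (X t ω)) μ :=
  hW.mul_bdd (c := ‖f‖)
    ((measurable_of_countable f).comp (h.measurable_state t)).aestronglyMeasurable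
    (Eventually.of_forall fun _ => norm_le_pi_norm f _)

lemma integral_mul_apply_state (h : IsStationaryRealization P ν ε μ ζ X) {t : ℤ} {W : Ω → ℝ}
    (hW : Integrable W μ) (M : Matrix S S ℝ) (y : S) :
    ∫ ω, W ω * M (X t ω) y ∂μ = (stateMean μ X t W ᵥ* M) y := by
  have := h.prob
  simp only [Matrix.vecMul, dotProduct, stateMean]
  simp_rw [← integral_mul_const]
  rw [← integral_finsetSum _ fun x _ =>
    (integrable_mul_stateInd (h.measurable_state t) hW x).mul_const _]
  refine integral_congr_ae (Eventually.of_forall fun ω => ?_)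
  simp [stateInd]

/-- Taylor expansion of P_{ζ_t} inside the one-step identity; it is the source of the field `step`
of `IsPerturbedChain`. -/
lemma norm_stateMean_succ_sub_le (h : IsStationaryRealization P ν ε μ ζ X) (hν : IsInputLaw ν)
    (hε : 0 ≤ ε) {K : ℝ}
    (hK : ∀ z : ℝ, |z| ≤ ε → ∀ x y : S, |P z x y - P 0 x y - z * firstDeriv P x y -
      z ^ 2 / 2 * secondDeriv P x y| ≤ K * |z| ^ 3) (hK0 : 0 ≤ K)
    {t : ℤ} {W : Ω → ℝ} {w : ℝ} (hw : 0 ≤ w) (hW : IsWeight (pastSigma ζ X t) μ W w) :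
    ‖stateMean μ X (t + 1) W - (stateMean μ X t W ᵥ* P 0 +
      (stateMean μ X t (ζ t * W) ᵥ* firstDeriv P +
        (1 / 2 : ℝ) • (stateMean μ X t (ζ t * (ζ t * W)) ᵥ* secondDeriv P)))‖ ≤ K * ε ^ 3 * w := by
  have := h.prob
  rw [pi_norm_le_iff_of_nonneg (by positivity)]
  intro y
  have hζ : IsWeight (pastSigma ζ X t) μ (ζ t) ε :=
    ⟨(measurable_inputSigma ζ t).mono (inputSigma_le_pastSigma ζ X t) le_rfl,
      h.ae_input_le hν hε t⟩
  have hi0 := hW.integrable (h.pastSigma_le t)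
  have hi1 := (hζ.mul hW hε).integrable (h.pastSigma_le t)
  have hi2 := (hζ.mul (hζ.mul hW hε) hε).integrable (h.pastSigma_le t)
  obtain ⟨hint, heq⟩ := h.stateMean_succ hW y
  simp only [Pi.sub_apply, Pi.add_apply, Pi.smul_apply, smul_eq_mul]
  rw [heq, ← h.integral_mul_apply_state hi0, ← h.integral_mul_apply_state hi1,
    ← h.integral_mul_apply_state hi2, ← integral_const_mul]
  have j0 := h.integrable_mul_apply_state (t := t) hi0 (fun x => P 0 x y)
  have j1 := h.integrable_mul_apply_state (t := t) hi1 (fun x => firstDeriv P x y)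
  have j2 := (h.integrable_mul_apply_state (t := t) hi2 (fun x => secondDeriv P x y)).const_mul
    (1 / 2)
  have hsub : (∫ ω, W ω * P (ζ t ω) (X t ω) y ∂μ) - ((∫ ω, W ω * P 0 (X t ω) y ∂μ) +
      ((∫ ω, (ζ t * W) ω * firstDeriv P (X t ω) y ∂μ) +
        ∫ ω, 1 / 2 * ((ζ t * (ζ t * W)) ω * secondDeriv P (X t ω) y) ∂μ)) =
      ∫ ω, (W ω * P (ζ t ω) (X t ω) y - (W ω * P 0 (X t ω) y +
        ((ζ t * W) ω * firstDeriv P (X t ω) y +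
          1 / 2 * ((ζ t * (ζ t * W)) ω * secondDeriv P (X t ω) y)))) ∂μ := by
    refine ((integral_sub hint (j0.add (j1.add j2))).trans (congrArg₂ _ rfl ?_)).symm
    exact (integral_add j0 (j1.add j2)).trans (congrArg₂ _ rfl (integral_add j1 j2))
  rw [hsub]
  have hb : ∀ᵐ ω ∂μ, ‖W ω * P (ζ t ω) (X t ω) y - (W ω * P 0 (X t ω) y +
        ((ζ t * W) ω * firstDeriv P (X t ω) y +
          1 / 2 * ((ζ t * (ζ t * W)) ω * secondDeriv P (X t ω) y)))‖ ≤ K * ε ^ 3 * w := by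
    filter_upwards [hW.bound, hζ.bound] with ω h1 h2
    have h3 : W ω * P (ζ t ω) (X t ω) y - (W ω * P 0 (X t ω) y +
        ((ζ t * W) ω * firstDeriv P (X t ω) y +
          1 / 2 * ((ζ t * (ζ t * W)) ω * secondDeriv P (X t ω) y))) =
        (P (ζ t ω) (X t ω) y - P 0 (X t ω) y - ζ t ω * firstDeriv P (X t ω) y -
          ζ t ω ^ 2 / 2 * secondDeriv P (X t ω) y) * W ω := by
      simp only [Pi.mul_apply]; ring
    rw [h3, norm_mul]
    refine mul_le_mul ((hK _ h2 _ _).trans ?_) h1 (norm_nonneg _) (by positivity)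
    exact mul_le_mul_of_nonneg_left (pow_le_pow_left₀ (abs_nonneg _) h2 3) hK0
  simpa using norm_integral_le_of_norm_le_const hb

end IsStationaryRealization

lemma vecMulCLM_sub_constRows_apply (P₀ : Matrix S S ℝ) (π v : S → ℝ) :
    vecMulCLM (P₀ - constRows π) v = v ᵥ* P₀ - (∑ x, v x) • π := by
  rw [vecMulCLM_apply, Matrix.vecMul_sub, vecMul_constRows]

/-- The Taylor remainder of the controlled transition matrix is uniformly of third order. -/
lemma IsSmoothControlledMatrix.exists_taylor_le (hP : IsSmoothControlledMatrix P) :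
    ∃ r > 0, ∃ K : ℝ, 0 ≤ K ∧ ∀ z : ℝ, |z| < r → ∀ x y : S,
      |P z x y - P 0 x y - z * firstDeriv P x y - z ^ 2 / 2 * secondDeriv P x y| ≤
        K * |z| ^ 3 := by
  obtain ⟨r, hr, K, hK⟩ := hP.smooth
  exact ⟨r, hr, K, K.2, fun z hz x y => taylor_two_remainder_le hr (hK x y).1 (hK x y).2 hz⟩

/-- A stationary realization at a small level is a perturbed chain, with uniform constants. -/
theorem IsStationaryRealization.exists_isPerturbedChain (hP : IsSmoothControlledMatrix P)
    (hπ : IsInvariantPmf (P 0) π) (hν : IsInputLaw ν) :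
    ∃ ε₀ > 0, ∃ c : ℝ, 1 ≤ c ∧ ∀ ε : ℝ, 0 ≤ ε → ε < ε₀ →
      (∀ z : ℝ, |z| ≤ ε → ∀ x y : S, |P z x y - P 0 x y - z * firstDeriv P x y -
        z ^ 2 / 2 * secondDeriv P x y| ≤ c * ε ^ 3) ∧
      ∀ (Ω : Type v) [MeasurableSpace Ω] (μ : Measure Ω) (ζ : ℤ → Ω → ℝ) (X : ℤ → Ω → S),
        IsStationaryRealization P ν ε μ ζ X →
        IsPerturbedChain (vecMulCLM (P 0 - constRows π)) (vecMulCLM (firstDeriv P))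
          (vecMulCLM (secondDeriv P)) π (inputCov ν) c ε μ ζ X := by
  obtain ⟨r, hr, K, hK0, hK⟩ := hP.exists_taylor_le
  set A := vecMulCLM (P 0 - constRows π) with hA
  set E₁ := vecMulCLM (firstDeriv P)
  set E₂ := vecMulCLM (secondDeriv P)
  have hsum : Summable fun n : ℕ => ‖A ^ n‖ :=
    summable_norm_vecMulCLM_pow (hP.stochastic 0) hP.irreducible hP.aperiodic hπ
  have hκ : 0 ≤ ∑' n : ℕ, ‖A ^ n‖ := tsum_nonneg fun _ => norm_nonneg _
  obtain ⟨hπ0, hπ1, hinv⟩ := hπ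
  set c : ℝ := 1 + K + ‖E₁‖ + ‖E₂‖ + ∑' n : ℕ, ‖A ^ n‖ with hc
  have n1 := norm_nonneg E₁
  have n2 := norm_nonneg E₂
  have hKc : K ≤ c := by linarith
  -- Below r the Taylor bound applies; below 1 higher powers of ε are dominated by lower ones.
  refine ⟨min r 1, lt_min hr one_pos, c, by linarith, fun ε hε hεr => ⟨?_, ?_⟩⟩
  · intro z hz x y
    refine (hK z (hz.trans_lt (hεr.trans_le (min_le_left _ _))) x y).trans ?_
    exact mul_le_mul hKc (pow_le_pow_left₀ (abs_nonneg _) hz 3) (by positivity) (by linarith)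
  · intro Ω _ μ ζ X h
    have hprob := h.prob
    refine ⟨h.prob, h.measurable_input, h.measurable_state, hsum, by linarith, by linarith,
      by linarith, by linarith, ?_, hν.abs_inputCov_le, hε, (hεr.trans_le (min_le_right _ _)).le,
      h.ae_input_le hν hε, ?_, ?_, ?_, ?_⟩
    · rw [pi_norm_le_iff_of_nonneg zero_le_one]
      intro x
      rw [Real.norm_of_nonneg (hπ0 x), ← hπ1]
      exact Finset.single_le_sum (fun y _ => hπ0 y) (Finset.mem_univ x)
    · intro t
      rw [h.integral_input_eq (f := fun z => z t) (measurable_pi_apply t), integral_const_mul,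
        hν.mean_zero, mul_zero]
    · intro s t
      have h1 := h.integral_input_eq (f := fun z => z s * z t)
        ((measurable_pi_apply s).mul (measurable_pi_apply t))
      simp only [Pi.mul_apply]
      rw [h1, ← hν.integral_mul, ← integral_const_mul]
      exact integral_congr_ae (Eventually.of_forall fun z => by ring)
    · intro t
      ext x
      simpa [stateMean] using h.integral_stateInd t x
    · intro t W w hw hW
      have h1 := h.norm_stateMean_succ_sub_le hν hε
        (fun z hz => hK z (hz.trans_lt (hεr.trans_le (min_le_left _ _)))) hK0 hw hW
      have hWi := hW.integrable (h.pastSigma_le t)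
      have h2 : centeredMean μ X π (t + 1) W - (A (centeredMean μ X π t W) +
          (E₁ (stateMean μ X t (ζ t * W)) +
            (1 / 2 : ℝ) • E₂ (stateMean μ X t (ζ t * (ζ t * W))))) =
          stateMean μ X (t + 1) W - (stateMean μ X t W ᵥ* P 0 +
            (stateMean μ X t (ζ t * W) ᵥ* firstDeriv P +
            (1 / 2 : ℝ) • (stateMean μ X t (ζ t * (ζ t * W)) ᵥ* secondDeriv P))) := by
        -- The entries of the centered mean sum to zero, so 1⊗π annihilates it and A acts as P_0;
        -- invariance of π does the rest.
        have h3 : A (centeredMean μ X π t W) =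
            stateMean μ X t W ᵥ* P 0 - (∫ ω, W ω ∂μ) • π := by
          rw [centeredMean, map_sub, map_smul, hA, vecMulCLM_sub_constRows_apply,
            vecMulCLM_sub_constRows_apply, sum_stateMean (h.measurable_state t) hWi, hπ1, hinv]
          simp
        rw [h3, centeredMean]
        simp only [E₁, E₂, vecMulCLM_apply]
        abel
      rw [h2]
      refine h1.trans ?_
      have hε3 : 0 ≤ ε ^ 3 * w := by positivity
      nlinarith

end Realization

/-! ### Summability of the second-order coefficients -/

section Summability

variable {S : Type*} [Fintype S] [DecidableEq S]
  {A E₁ E₂ : (S → ℝ) →L[ℝ] (S → ℝ)} {π : S → ℝ} {R : ℤ → ℝ}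

lemma summable_norm_clm_apply {V : Type*} [NormedAddCommGroup V] [NormedSpace ℝ V]
    (E : V →L[ℝ] V) {g : ℕ → V} (hg : Summable fun n => ‖g n‖) : Summable fun n => ‖E (g n)‖ :=
  Summable.of_nonneg_of_le (fun _ => norm_nonneg _) (fun n => E.le_opNorm (g n))
    (hg.mul_left ‖E‖)

lemma summable_norm_pow_apply (hA : Summable fun n : ℕ => ‖A ^ n‖) (v : S → ℝ) :
    Summable fun n : ℕ => ‖(A ^ n) v‖ :=
  Summable.of_nonneg_of_le (fun _ => norm_nonneg _) (fun n => (A ^ n).le_opNorm v)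
    (hA.mul_right ‖v‖)

variable (hA : Summable fun n : ℕ => ‖A ^ n‖) {b ρ : ℝ} (hρ : |ρ| < 1)
  (hR : ∀ k : ℤ, |R k| ≤ b * ρ ^ k.natAbs)

include hR in
lemma abs_le_of_geometric (k : ℤ) : |R k| ≤ |b| * |ρ| ^ k.natAbs := by
  refine (hR k).trans ((le_abs_self _).trans ?_)
  rw [abs_mul, abs_pow]

-- All lags j + 1 + m are at least j, so the source of `inputState` at j is O(|ρ|^j) uniformly in m.
-- This is where the decay of the input covariance enters.
include hA hρ hR in
lemma summable_norm_inputState : Summable fun j => ‖inputState A E₁ π R j‖ := by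
  refine Summable.of_nonneg_of_le (fun _ => norm_nonneg _) (fun j => norm_tsum_pow_apply_le hA
    (B := |b| * |ρ| ^ j * ‖E₁ π‖) fun m => ?_)
    ((((summable_geometric_of_lt_one (abs_nonneg ρ) hρ).mul_left |b|).mul_right
      ‖E₁ π‖).mul_left _)
  rw [norm_smul]
  refine mul_le_mul_of_nonneg_right ((abs_le_of_geometric hR _).trans ?_) (norm_nonneg _)
  exact mul_le_mul_of_nonneg_left
    (pow_le_pow_of_le_one (abs_nonneg _) hρ.le (by omega)) (abs_nonneg _)

lemma norm_coupling_le (i : S) (a : S → ℝ) : ‖coupling π i a‖ ≤ (1 + 2 * ‖π‖) * ‖a‖ := by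
  have h1 : ‖(Pi.single i (a i) : S → ℝ)‖ ≤ ‖a‖ := norm_single_apply_le i a
  have h2 : ‖π i • a‖ ≤ ‖π‖ * ‖a‖ := by
    rw [norm_smul]; exact mul_le_mul_of_nonneg_right (norm_le_pi_norm π i) (norm_nonneg _)
  have h3 : ‖a i • π‖ ≤ ‖a‖ * ‖π‖ := by
    rw [norm_smul]; exact mul_le_mul_of_nonneg_right (norm_le_pi_norm a i) (norm_nonneg _)
  have h4 := norm_sub_le ((Pi.single i (a i) : S → ℝ) - π i • a) (a i • π)
  have h5 := norm_sub_le (Pi.single i (a i) : S → ℝ) (π i • a)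
  rw [coupling]
  linarith

-- The mean part and the propagated initial value are summable through `inputState`. The source part
-- is a convolution of two summable sequences, for which bounded R is enough.
include hA hρ hR in
lemma summable_norm_inputStateCov (i : S) : Summable fun j => ‖inputStateCov A E₁ π R i j‖ := by
  have hq := summable_norm_inputState (E₁ := E₁) (π := π) hA hρ hR
  set g : ℕ → S → ℝ := fun n => E₁ ((A ^ n) (stateCov π i)) with hgdef
  have hg : Summable fun n => ‖g n‖ :=
    summable_norm_clm_apply E₁ (summable_norm_pow_apply hA (stateCov π i))
  have hRb : ∀ k, |R k| ≤ |b| := fun k => (abs_le_of_geometric hR k).trans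
    (mul_le_of_le_one_right (abs_nonneg _) (pow_le_one₀ (abs_nonneg _) hρ.le))
  refine Summable.of_nonneg_of_le (fun _ => norm_nonneg _) (fun j => ?_)
    ((hq.mul_right ‖π‖).add ((hq.mul_left ((∑' n : ℕ, ‖A ^ n‖) * (1 + 2 * ‖π‖))).add
      (summable_convolution hA (hg.mul_left |b|) (fun _ => norm_nonneg _) fun _ => by positivity)))
  rw [inputStateCov, recursionSol_eq]
  refine (norm_add_le _ _).trans (add_le_add ?_ ((norm_add_le _ _).trans (add_le_add ?_ ?_)))
  · rw [norm_smul]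
    exact mul_le_mul_of_nonneg_right (norm_le_pi_norm (inputState A E₁ π R j) i) (norm_nonneg _)
  · refine ((A ^ j).le_opNorm _).trans ?_
    rw [mul_assoc]
    exact mul_le_mul (hA.le_tsum j fun _ _ => norm_nonneg _) (norm_coupling_le i _)
      (norm_nonneg _) (tsum_nonneg fun _ => norm_nonneg _)
  · refine norm_sum_le_of_le _ fun l _ => ((A ^ (j - 1 - l)).le_opNorm _).trans ?_
    rw [norm_smul]
    exact mul_le_mul_of_nonneg_left (mul_le_mul_of_nonneg_right (hRb _) (norm_nonneg _))
      (norm_nonneg _)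

include hA hρ hR in
lemma summable_norm_covShift (i : S) : Summable fun k => ‖covShift A E₁ E₂ π R i k‖ := by
  refine summable_norm_recursionSol hA ?_ _
  refine Summable.of_nonneg_of_le (fun _ => norm_nonneg _) (fun n => norm_add_le _ _)
    ((summable_norm_clm_apply E₁ (summable_norm_inputStateCov hA hρ hR i)).add ?_)
  simp only [norm_smul]
  exact (summable_norm_clm_apply E₂ (summable_norm_pow_apply hA _)).mul_left _

end Summability

/-! ### Two-sided covariance sequences -/

section TwoSided

variable {S : Type*} [Fintype S] [DecidableEq S]

/-- The two-sided sequence of matrices `G` with rows `f i k` for `k ≥ 0` and `G (-k) = (G k)ᵀ`. -/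
def twoSided (f : S → ℕ → S → ℝ) (k : ℤ) : Matrix S S ℝ :=
  Matrix.of fun i j => if 0 ≤ k then f i k.toNat j else f j (-k).toNat i

lemma summable_twoSided {f : S → ℕ → S → ℝ} (hf : ∀ i, Summable fun k => ‖f i k‖) (i j : S) :
    Summable fun k => |twoSided f k i j| := by
  refine Summable.of_nat_of_neg ?_ ?_
  · refine Summable.of_nonneg_of_le (fun _ => abs_nonneg _) (fun n => ?_) (hf i)
    simpa [twoSided] using norm_le_pi_norm (f i n) j
  -- At lag zero the entry comes from `f i`, at negative lags from `f j`; the sum of both series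
  -- dominates either case.
  · refine Summable.of_nonneg_of_le (fun _ => abs_nonneg _) (fun n => ?_) ((hf i).add (hf j))
    rcases Nat.eq_zero_or_pos n with rfl | hn
    · have := norm_le_pi_norm (f i 0) j
      have h2 := norm_nonneg (f j 0)
      simp only [twoSided, Matrix.of_apply]
      simp only [Real.norm_eq_abs] at this
      simpa using this.trans (le_add_of_nonneg_right h2)
    · have := norm_le_pi_norm (f j n) i
      have h2 := norm_nonneg (f i n)
      have h3 : ¬ (n = 0) := by omega
      simp only [twoSided, Matrix.of_apply]
      simp only [Real.norm_eq_abs] at this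
      simpa [h3] using this.trans (le_add_of_nonneg_left h2)

/-- The autocovariance of `Y_t - Y_{t-1} A` in terms of that of `Y`. -/
def noiseCov (A : Matrix S S ℝ) (G : ℤ → Matrix S S ℝ) (k : ℤ) : Matrix S S ℝ :=
  G k - Aᵀ * G (k + 1) - G (k - 1) * A + Aᵀ * G k * A

lemma noiseCov_apply (A : Matrix S S ℝ) (G : ℤ → Matrix S S ℝ) (k : ℤ) (i j : S) :
    noiseCov A G k i j = G k i j - ∑ x, A x i * G (k + 1) x j - ∑ y, G (k - 1) i y * A y j +
      ∑ y, (∑ x, A x i * G k x y) * A y j := by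
  simp [noiseCov, Matrix.mul_apply]

lemma summable_noiseCov (A : Matrix S S ℝ) {G : ℤ → Matrix S S ℝ}
    (hG : ∀ i j, Summable fun k => |G k i j|) (i j : S) :
    Summable fun k => |noiseCov A G k i j| := by
  have hG' : ∀ i j, Summable fun k => G k i j := fun i j => (hG i j).of_abs
  have h1 : ∀ i j, Summable fun k => G (k + 1) i j := fun i j =>
    (Equiv.addRight (1 : ℤ)).summable_iff.2 (hG' i j)
  have h2 : ∀ i j, Summable fun k => G (k - 1) i j := fun i j =>
    (Equiv.subRight (1 : ℤ)).summable_iff.2 (hG' i j)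
  simp only [noiseCov_apply]
  refine Summable.abs ?_
  exact (((hG' i j).sub (summable_sum fun x _ => (h1 x j).mul_left _)).sub
    (summable_sum fun y _ => (h2 i y).mul_right _)).add
    (summable_sum fun y _ => (summable_sum fun x _ => (hG' x y).mul_left _).mul_right _)

/-- The sum of the absolute values of the entries. -/
def entrySum (A : Matrix S S ℝ) : ℝ := ∑ x, ∑ y, |A x y|

lemma entrySum_nonneg (A : Matrix S S ℝ) : 0 ≤ entrySum A :=
  Finset.sum_nonneg fun _ _ => Finset.sum_nonneg fun _ _ => abs_nonneg _

lemma sum_abs_col_le (A : Matrix S S ℝ) (j : S) : ∑ x, |A x j| ≤ entrySum A :=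
  Finset.sum_le_sum fun x _ => Finset.single_le_sum (f := fun y => |A x y|)
    (fun _ _ => abs_nonneg _) (Finset.mem_univ j)

lemma abs_apply_le_entrySum (A : Matrix S S ℝ) (i j : S) : |A i j| ≤ entrySum A :=
  (Finset.single_le_sum (f := fun x => |A x j|) (fun _ _ => abs_nonneg _)
    (Finset.mem_univ i)).trans (sum_abs_col_le A j)

lemma abs_sum_mul_le (A : Matrix S S ℝ) (j : S) {v : S → ℝ} {g : ℝ} (hv : ∀ x, |v x| ≤ g)
    (hg : 0 ≤ g) : |∑ x, A x j * v x| ≤ entrySum A * g := by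
  refine (Finset.abs_sum_le_sum_abs _ _).trans ?_
  refine le_trans ?_ (mul_le_mul_of_nonneg_right (sum_abs_col_le A j) hg)
  rw [Finset.sum_mul]
  refine Finset.sum_le_sum fun x _ => ?_
  rw [abs_mul]
  exact mul_le_mul_of_nonneg_left (hv x) (abs_nonneg _)

/-- The four terms cost 1 + a + a + a² = (1 + a)². Thus an error uniform in the lag for Γ passes to
the driving noise. -/
lemma abs_noiseCov_le (A : Matrix S S ℝ) {G : ℤ → Matrix S S ℝ} {g : ℝ}
    (hG : ∀ k i j, |G k i j| ≤ g) (k : ℤ) (i j : S) :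
    |noiseCov A G k i j| ≤ (1 + entrySum A) ^ 2 * g := by
  have hg : 0 ≤ g := (abs_nonneg _).trans (hG k i j)
  have ha := entrySum_nonneg A
  rw [noiseCov_apply]
  have h1 := hG k i j
  have h2 := abs_sum_mul_le A i (fun x => hG (k + 1) x j) hg
  have h3 := abs_sum_mul_le A j (fun y => hG (k - 1) i y) hg
  have h4 := abs_sum_mul_le A j (v := fun y => ∑ x, A x i * G k x y)
    (fun y => abs_sum_mul_le A i (fun x => hG k x y) hg) (by positivity)
  simp only [mul_comm (A _ j)] at h3 h4
  refine (abs_add_le _ _).trans ((add_le_add_left ((abs_sub _ _).trans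
    (add_le_add_left (abs_sub _ _) _)) _).trans ?_)
  linarith

lemma noiseCov_sub_add_smul (A : Matrix S S ℝ) (G G₀ G₂ : ℤ → Matrix S S ℝ) (a : ℝ) (k : ℤ) :
    noiseCov A (fun k => G k - (G₀ k + a • G₂ k)) k =
      noiseCov A G k - (noiseCov A G₀ k + a • noiseCov A G₂ k) := by
  simp only [noiseCov, mul_sub, mul_add, sub_mul, add_mul, Matrix.mul_smul, Matrix.smul_mul,
    smul_sub, smul_add]
  abel

/-- The matrix `diag(π) - πᵀ π`. -/
def stateCovMatrix (π : S → ℝ) : Matrix S S ℝ := Matrix.diagonal π - Matrix.vecMulVec π π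

lemma stateCov_eq_row (π : S → ℝ) (i : S) : stateCov π i = stateCovMatrix π i := by
  ext j
  simp only [stateCov, stateCovMatrix, Pi.sub_apply, Matrix.sub_apply, Matrix.vecMulVec_apply,
    Pi.smul_apply, smul_eq_mul, Matrix.diagonal_apply, Pi.single_apply, eq_comm]

lemma stateCovMatrix_transpose (π : S → ℝ) : (stateCovMatrix π)ᵀ = stateCovMatrix π := by
  ext i j
  by_cases h : i = j
  · subst h; rfl
  · simp [stateCovMatrix, Matrix.vecMulVec_apply, Matrix.diagonal_apply_ne _ h,
      Matrix.diagonal_apply_ne _ (Ne.symm h), mul_comm]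

/-- The autocovariance of the state process when the input vanishes. -/
def nominalStateCov (A : Matrix S S ℝ) (π : S → ℝ) : ℤ → Matrix S S ℝ :=
  twoSided fun i k => (vecMulCLM A ^ k) (stateCov π i)

lemma nominalStateCov_natCast (A : Matrix S S ℝ) (π : S → ℝ) (n : ℕ) :
    nominalStateCov A π n = stateCovMatrix π * A ^ n := by
  ext i j
  simp only [nominalStateCov, twoSided, Matrix.of_apply, Int.natCast_nonneg, if_true,
    Int.toNat_natCast, vecMulCLM_pow_apply, stateCov_eq_row, Matrix.mul_apply_eq_vecMul]

lemma nominalStateCov_neg (A : Matrix S S ℝ) (π : S → ℝ) (n : ℕ) :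
    nominalStateCov A π (-n) = (stateCovMatrix π * A ^ n)ᵀ := by
  rcases Nat.eq_zero_or_pos n with rfl | hn
  · have := nominalStateCov_natCast A π 0
    simp only [Nat.cast_zero, neg_zero] at this ⊢
    rw [this, pow_zero, mul_one, stateCovMatrix_transpose]
  · ext i j
    have h3 : ¬ (n = 0) := by omega
    have h4 : (vecMulCLM A ^ n) (stateCov π j) i = (stateCovMatrix π * A ^ n) j i := by
      rw [vecMulCLM_pow_apply, stateCov_eq_row, Matrix.mul_apply_eq_vecMul]
    rw [Matrix.transpose_apply, ← h4]
    simp [nominalStateCov, twoSided, h3]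

lemma stateCovMatrix_mul_constRows {π : S → ℝ} (hπ : ∑ x, π x = 1) (ρ : S → ℝ) :
    stateCovMatrix π * constRows ρ = 0 := by
  ext i j
  simp [stateCovMatrix, constRows, sub_mul, Matrix.mul_apply, Matrix.vecMulVec_apply,
    ← Finset.sum_mul, ← Finset.mul_sum, hπ, Matrix.diagonal_apply]

/-- The rows and columns of diag(π) − πᵀπ sum to zero, so 1⊗π drops out on both sides, and πᵀπ is
preserved by invariance. -/
lemma transpose_mul_stateCovMatrix_mul {P₀ : Matrix S S ℝ} {π : S → ℝ} (hπ : ∑ x, π x = 1)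
    (hinv : π ᵥ* P₀ = π) : (P₀ - constRows π)ᵀ * stateCovMatrix π * (P₀ - constRows π) =
      P₀ᵀ * Matrix.diagonal π * P₀ - Matrix.vecMulVec π π := by
  have h1 : stateCovMatrix π * (P₀ - constRows π) = stateCovMatrix π * P₀ := by
    rw [mul_sub, stateCovMatrix_mul_constRows hπ, sub_zero]
  have h2 : (P₀ - constRows π)ᵀ * stateCovMatrix π = P₀ᵀ * stateCovMatrix π := by
    have := congrArg Matrix.transpose h1
    rwa [Matrix.transpose_mul, Matrix.transpose_mul, stateCovMatrix_transpose] at this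
  rw [h2, mul_assoc, h1, stateCovMatrix, sub_mul, mul_sub, ← mul_assoc]
  congr 1
  rw [Matrix.vecMulVec_mul, hinv, Matrix.mul_vecMulVec, Matrix.mulVec_transpose, hinv]

/-- The nominal driving noise is white. -/
lemma noiseCov_nominalStateCov {P₀ : Matrix S S ℝ} {π : S → ℝ} (hπ : ∑ x, π x = 1)
    (hinv : π ᵥ* P₀ = π) (k : ℤ) :
    noiseCov (P₀ - constRows π) (nominalStateCov (P₀ - constRows π) π) k =
      nominalNoiseCov P₀ π k := by
  have hN := stateCovMatrix_transpose π
  have key := transpose_mul_stateCovMatrix_mul hπ hinv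
  set A := P₀ - constRows π with hA
  set N := stateCovMatrix π with hNdef
  -- With N = diag(π) − πᵀπ, G(k) = NA^k for k ≥ 0 and G(−k) = G(k)ᵀ, the four terms cancel in pairs
  -- off zero; at zero N − AᵀNA remains.
  rcases lt_trichotomy k 0 with hk | rfl | hk
  · obtain ⟨n, rfl⟩ : ∃ n : ℕ, k = -((n + 1 : ℕ) : ℤ) := ⟨(-k - 1).toNat, by omega⟩
    have e1 : -((n + 1 : ℕ) : ℤ) + 1 = -(n : ℤ) := by push_cast; ring
    have e2 : -((n + 1 : ℕ) : ℤ) - 1 = -((n + 2 : ℕ) : ℤ) := by push_cast; ring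
    rw [nominalNoiseCov, if_neg (by omega), noiseCov, e1, e2, nominalStateCov_neg,
      nominalStateCov_neg, nominalStateCov_neg]
    simp only [Matrix.transpose_mul, Matrix.transpose_pow, hN, ← hNdef]
    simp only [← mul_assoc, pow_succ']
    abel
  · have h0 := nominalStateCov_natCast A π 0
    have h1 := nominalStateCov_natCast A π 1
    have h2 := nominalStateCov_neg A π 1
    simp only [Nat.cast_zero, Nat.cast_one, pow_zero, mul_one, pow_one] at h0 h1 h2
    rw [nominalNoiseCov, if_pos rfl, noiseCov, zero_add, zero_sub, h0, h1, h2,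
      Matrix.transpose_mul, ← hNdef, hN, ← mul_assoc, key, hNdef, stateCovMatrix]
    abel
  · obtain ⟨n, rfl⟩ : ∃ n : ℕ, k = ((n + 1 : ℕ) : ℤ) := ⟨(k - 1).toNat, by omega⟩
    have e1 : ((n + 1 : ℕ) : ℤ) + 1 = ((n + 2 : ℕ) : ℤ) := by push_cast; ring
    have e2 : ((n + 1 : ℕ) : ℤ) - 1 = (n : ℤ) := by push_cast; ring
    rw [nominalNoiseCov, if_neg (by omega), noiseCov, e1, e2, nominalStateCov_natCast,
      nominalStateCov_natCast, nominalStateCov_natCast]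
    simp only [← hNdef, ← mul_assoc, pow_succ]
    abel

end TwoSided

/-! ### Expansion of the autocovariances of the state and of the driving noise -/

section CovBounds

variable {Ω : Type*} [MeasurableSpace Ω] {μ : Measure Ω} [IsProbabilityMeasure μ]

lemma abs_covariance_le {Y Z : Ω → ℝ} {a b : ℝ} (hY : ∀ᵐ ω ∂μ, |Y ω| ≤ a)
    (hZ : ∀ᵐ ω ∂μ, |Z ω| ≤ b) : |cov[Y, Z; μ]| ≤ 4 * a * b := by
  have hEY : |∫ ω, Y ω ∂μ| ≤ a := by
    simpa using norm_integral_le_of_norm_le_const (μ := μ) (f := Y) (C := a) hY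
  have hEZ : |∫ ω, Z ω ∂μ| ≤ b := by
    simpa using norm_integral_le_of_norm_le_const (μ := μ) (f := Z) (C := b) hZ
  have hb : ∀ᵐ ω ∂μ, ‖(Y ω - ∫ ω, Y ω ∂μ) * (Z ω - ∫ ω, Z ω ∂μ)‖ ≤ 4 * a * b := by
    filter_upwards [hY, hZ] with ω h1 h2
    rw [norm_mul]
    have h3 : ‖Y ω - ∫ ω, Y ω ∂μ‖ ≤ 2 * a := (abs_sub _ _).trans (by linarith)
    have h4 : ‖Z ω - ∫ ω, Z ω ∂μ‖ ≤ 2 * b := (abs_sub _ _).trans (by linarith)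
    calc _ ≤ (2 * a) * (2 * b) :=
          mul_le_mul h3 h4 (norm_nonneg _) ((norm_nonneg _).trans h3)
      _ = _ := by ring
  simpa [covariance] using norm_integral_le_of_norm_le_const hb

/-- Covariances are stable under bounded perturbations. -/
lemma abs_covariance_sub_sub_le {Y Z U V : Ω → ℝ} {a b : ℝ}
    (hY : AEStronglyMeasurable Y μ) (hZ : AEStronglyMeasurable Z μ)
    (hU : AEStronglyMeasurable U μ) (hV : AEStronglyMeasurable V μ)
    (hYa : ∀ᵐ ω ∂μ, |Y ω| ≤ a) (hZa : ∀ᵐ ω ∂μ, |Z ω| ≤ a)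
    (hUb : ∀ᵐ ω ∂μ, |U ω| ≤ b) (hVb : ∀ᵐ ω ∂μ, |V ω| ≤ b) :
    |cov[Y - U, Z - V; μ] - cov[Y, Z; μ]| ≤ 8 * a * b + 4 * b * b := by
  rw [covariance_sub_sub (MemLp.of_bound hY a hYa) (MemLp.of_bound hU b hUb)
    (MemLp.of_bound hZ a hZa) (MemLp.of_bound hV b hVb)]
  have h1 := abs_le.1 (abs_covariance_le hYa hVb)
  have h2 := abs_le.1 (abs_covariance_le hUb hZa)
  have h3 := abs_le.1 (abs_covariance_le hUb hVb)
  rw [abs_le]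
  constructor <;> linarith [h1.1, h1.2, h2.1, h2.2, h3.1, h3.2]

end CovBounds

section Realization

variable {S : Type*} [Fintype S] [DecidableEq S] [MeasurableSpace S] [DiscreteMeasurableSpace S]
  {P : ℝ → Matrix S S ℝ} {ν : Measure (ℤ → ℝ)} {ε c : ℝ} {π : S → ℝ}
  {Ω : Type*} [MeasurableSpace Ω] {μ : Measure Ω} {ζ : ℤ → Ω → ℝ} {X : ℤ → Ω → S}

lemma memLp_stateInd [IsProbabilityMeasure μ] {t : ℤ} (hX : Measurable (X t)) (x : S) :
    MemLp (stateInd X t x) 2 μ :=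
  MemLp.of_bound (measurable_stateInd hX x).aestronglyMeasurable 1
    (Eventually.of_forall fun ω => abs_stateInd_le X t x ω)

/-- The autocovariance matrices of the indicator process `Γ`. -/
def indicatorCov (μ : Measure Ω) (X : ℤ → Ω → S) (k : ℤ) : Matrix S S ℝ :=
  Matrix.of fun i j => cov[stateInd X 0 i, stateInd X k j; μ]

/-- Centering one factor is enough for a covariance, which makes it a weighted state mean to which
the expansions apply. -/
lemma IsPerturbedChain.indicatorCov_eq {A E₁ E₂ : (S → ℝ) →L[ℝ] (S → ℝ)} {R : ℤ → ℝ}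
    (h : IsPerturbedChain A E₁ E₂ π R c ε μ ζ X) (k : ℤ) (i j : S) :
    indicatorCov μ X k i j = stateMean μ X k (centeredInd μ X i) j := by
  have := h.prob
  have h0 := memLp_stateInd (μ := μ) (h.measurable_state 0) i
  have hk := memLp_stateInd (μ := μ) (h.measurable_state k) j
  have hkint : Integrable (stateInd X k j) μ := hk.integrable (by norm_num)
  have hprod : Integrable (fun ω => stateInd X 0 i ω * stateInd X k j ω) μ :=
    integrable_mul_stateInd (h.measurable_state k) (h0.integrable (by norm_num)) j
  simp only [indicatorCov, Matrix.of_apply, covariance_eq_sub h0 hk, stateMean, centeredInd, sub_mul]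
  rw [integral_sub hprod (hkint.const_mul _), integral_const_mul]
  simp

namespace IsStationaryRealization

lemma indicatorCov_neg (h : IsStationaryRealization P ν ε μ ζ X) (k : ℤ) (i j : S) :
    indicatorCov μ X (-k) i j = indicatorCov μ X k j i := by
  simp only [indicatorCov, Matrix.of_apply]
  rw [covariance_comm, h.covariance_stateInd (-k) 0]
  simp

lemma abs_indicatorCov_sub_le (h : IsStationaryRealization P ν ε μ ζ X)
    {A : Matrix S S ℝ} {E₁ E₂ : (S → ℝ) →L[ℝ] (S → ℝ)} {R : ℤ → ℝ}
    (hc : IsPerturbedChain (vecMulCLM A) E₁ E₂ π R c ε μ ζ X) (k : ℤ) (i j : S) :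
    |indicatorCov μ X k i j - (nominalStateCov A π k i j +
      ε ^ 2 * twoSided (covShift (vecMulCLM A) E₁ E₂ π R) k i j)| ≤ 50 * c ^ 7 * ε ^ 3 := by
  have key : ∀ (n : ℕ) (i j : S), |indicatorCov μ X n i j -
      ((vecMulCLM A ^ n) (stateCov π i) j + ε ^ 2 * covShift (vecMulCLM A) E₁ E₂ π R i n j)| ≤
      50 * c ^ 7 * ε ^ 3 := fun n i j => by
    rw [hc.indicatorCov_eq]
    exact (norm_le_pi_norm (stateMean μ X n (centeredInd μ X i) -
      ((vecMulCLM A ^ n) (stateCov π i) + ε ^ 2 • covShift (vecMulCLM A) E₁ E₂ π R i n)) j).trans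
      (hc.norm_covShift_sub_le i n)
  by_cases hk : 0 ≤ k
  · have := key k.toNat i j
    rw [Int.toNat_of_nonneg hk] at this
    simpa [nominalStateCov, twoSided, hk] using this
  · have := key (-k).toNat j i
    rw [Int.toNat_of_nonneg (by omega), h.indicatorCov_neg] at this
    simpa [nominalStateCov, twoSided, hk] using this

/-- The driving noise of the linear model before the Taylor remainder is discarded. -/
def linearNoise (A : Matrix S S ℝ) (X : ℤ → Ω → S) (t : ℤ) (i : S) (ω : Ω) : ℝ :=
  stateInd X t i ω - ∑ x, A x i * stateInd X (t - 1) x ω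

lemma covariance_linearNoise (h : IsStationaryRealization P ν ε μ ζ X) (A : Matrix S S ℝ) (k : ℤ)
    (i j : S) : cov[linearNoise A X 0 i, linearNoise A X k j; μ] =
      noiseCov A (indicatorCov μ X) k i j := by
  have := h.prob
  have hm : ∀ t x, MemLp (stateInd X t x) 2 μ := fun t x => memLp_stateInd (h.measurable_state t) x
  have hm' : ∀ t i x, MemLp (fun ω => A x i * stateInd X t x ω) 2 μ := fun t i x =>
    (hm t x).const_mul _
  have hs : ∀ t i, MemLp (fun ω => ∑ x, A x i * stateInd X t x ω) 2 μ := fun t i =>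
    memLp_finsetSum _ fun x _ => hm' t i x
  have h1 : ∀ s t i j, cov[fun ω => ∑ x, A x i * stateInd X s x ω, stateInd X t j; μ] =
      ∑ x, A x i * indicatorCov μ X (t - s) x j := fun s t i j => by
    rw [covariance_fun_sum_left (hm' s i) (hm t j)]
    simp only [covariance_const_mul_left, h.covariance_stateInd s t]
    rfl
  unfold linearNoise
  rw [covariance_fun_sub_fun_sub (hm _ _) (hs _ _) (hm _ _) (hs _ _), h1, noiseCov_apply,
    covariance_fun_sum_right (hm' _ _) (hm _ _), covariance_fun_sum_right (hm' _ _) (hs _ _)]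
  simp only [covariance_const_mul_right, h1]
  simp only [show k - (0 - 1) = k + 1 by ring, show k - 1 - (0 - 1) = k by ring, mul_comm (A _ j)]
  exact congrArg₂ _ (sub_right_comm _ _ _) rfl

lemma abs_linearNoise_le (A : Matrix S S ℝ) (X : ℤ → Ω → S) (t : ℤ) (i : S) (ω : Ω) :
    |linearNoise A X t i ω| ≤ 1 + entrySum A := by
  refine (abs_sub _ _).trans (add_le_add (abs_stateInd_le _ _ _ _) ?_)
  exact (abs_sum_mul_le A i (fun x => abs_stateInd_le X (t - 1) x ω) zero_le_one).trans_eq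
    (mul_one _)

/-- The Taylor remainder of the transition probability used at time `t - 1`. -/
def taylorRemainder (P : ℝ → Matrix S S ℝ) (ζ : ℤ → Ω → ℝ) (X : ℤ → Ω → S) (t : ℤ) (i : S)
    (ω : Ω) : ℝ :=
  P (ζ (t - 1) ω) (X (t - 1) ω) i - P 0 (X (t - 1) ω) i -
    ζ (t - 1) ω * firstDeriv P (X (t - 1) ω) i -
    ζ (t - 1) ω ^ 2 / 2 * secondDeriv P (X (t - 1) ω) i

/-- The first two Taylor terms in D cancel those of P_{ζ_{t−1}}. Since Γ_{t−1}(1⊗π) = π, replacing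
P_0 by A costs only a constant, which covariances ignore. -/
lemma drivingNoise_eq (P : ℝ → Matrix S S ℝ) (π : S → ℝ) (ζ : ℤ → Ω → ℝ) (X : ℤ → Ω → S) (t : ℤ)
    (i : S) (ω : Ω) : drivingNoise P ζ X t ω i =
      (linearNoise (P 0 - constRows π) X t i ω - taylorRemainder P ζ X t i ω) - π i := by
  have h1 : ∑ x, (P 0 - constRows π) x i * stateInd X (t - 1) x ω =
      P 0 (X (t - 1) ω) i - π i := by
    simp [stateInd, constRows]
  have h2 : (Pi.single (X t ω) 1 : S → ℝ) i = stateInd X t i ω := by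
    simp [stateInd, Pi.single_apply, eq_comm]
  simp only [drivingNoise, martingaleNoise, Pi.add_apply, Pi.smul_apply, smul_eq_mul, Pi.sub_apply,
    Matrix.single_one_vecMul, linearNoise, h1, h2, taylorRemainder, Matrix.row]
  ring

lemma aestronglyMeasurable_linearNoise (h : IsStationaryRealization P ν ε μ ζ X)
    (A : Matrix S S ℝ) (t : ℤ) (i : S) : AEStronglyMeasurable (linearNoise A X t i) μ := by
  refine Measurable.aestronglyMeasurable ((measurable_stateInd (h.measurable_state t) i).sub ?_)
  exact Finset.measurable_sum _ fun x _ =>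
    (measurable_stateInd (h.measurable_state _) x).const_mul _

/-- Measurability of P_ζ in ζ is not assumed globally; it comes from `stateMean_succ` with weight
one. -/
lemma aestronglyMeasurable_taylorRemainder (h : IsStationaryRealization P ν ε μ ζ X) (t : ℤ)
    (i : S) : AEStronglyMeasurable (taylorRemainder P ζ X t i) μ := by
  have := h.prob
  have h1 : IsWeight (pastSigma ζ X (t - 1)) μ (1 : Ω → ℝ) 1 := ⟨measurable_const, by simp⟩
  have h2 := (h.stateMean_succ h1 i).1.aestronglyMeasurable
  simp only [Pi.one_apply, one_mul] at h2
  have hX : ∀ M : Matrix S S ℝ, AEStronglyMeasurable (fun ω => M (X (t - 1) ω) i) μ := fun M =>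
    ((measurable_of_countable fun x => M x i).comp
      (h.measurable_state (t - 1))).aestronglyMeasurable
  have hζ := (h.measurable_input (t - 1)).aestronglyMeasurable (μ := μ)
  exact ((h2.sub (hX _)).sub (hζ.mul (hX _))).sub
    ((((h.measurable_input (t - 1)).pow_const 2).div_const 2).aestronglyMeasurable.mul (hX _))

lemma abs_autocovMatrix_sub_noiseCov_le (h : IsStationaryRealization P ν ε μ ζ X)
    (hν : IsInputLaw ν) (hε : 0 ≤ ε) {C : ℝ}
    (hC : ∀ z : ℝ, |z| ≤ ε → ∀ x y : S, |P z x y - P 0 x y - z * firstDeriv P x y -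
      z ^ 2 / 2 * secondDeriv P x y| ≤ C) (π : S → ℝ) (k : ℤ) (i j : S) :
    |autocovMatrix μ (drivingNoise P ζ X) k i j -
      noiseCov (P 0 - constRows π) (indicatorCov μ X) k i j| ≤
      8 * (1 + entrySum (P 0 - constRows π)) * C + 4 * C * C := by
  have := h.prob
  set A := P 0 - constRows π
  have hrem : ∀ t i, ∀ᵐ ω ∂μ, |taylorRemainder P ζ X t i ω| ≤ C := fun t i => by
    filter_upwards [h.ae_input_le hν hε (t - 1)] with ω hω
    exact hC _ hω _ _
  have hint : ∀ t i, Integrable (linearNoise A X t i - taylorRemainder P ζ X t i) μ := fun t i =>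
    (Integrable.of_bound (h.aestronglyMeasurable_linearNoise A t i) _
      (Eventually.of_forall fun ω => abs_linearNoise_le A X t i ω)).sub
    (Integrable.of_bound (h.aestronglyMeasurable_taylorRemainder t i) C (hrem t i))
  have heq : autocovMatrix μ (drivingNoise P ζ X) k i j =
      cov[linearNoise A X 0 i - taylorRemainder P ζ X 0 i,
        linearNoise A X k j - taylorRemainder P ζ X k j; μ] := by
    simp only [autocovMatrix, Matrix.of_apply, drivingNoise_eq P π]
    exact (covariance_sub_const_left (hint 0 i) (π i)).trans
      (covariance_sub_const_right (hint k j) (π j))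
  rw [heq, ← h.covariance_linearNoise]
  exact abs_covariance_sub_sub_le (h.aestronglyMeasurable_linearNoise A 0 i)
    (h.aestronglyMeasurable_linearNoise A k j) (h.aestronglyMeasurable_taylorRemainder 0 i)
    (h.aestronglyMeasurable_taylorRemainder k j)
    (Eventually.of_forall fun ω => abs_linearNoise_le A X 0 i ω)
    (Eventually.of_forall fun ω => abs_linearNoise_le A X k j ω) (hrem 0 i) (hrem k j)

/-- Third-order accurate expansions of the autocovariances of the state and of the driving
noise, uniform over all stationary realizations. -/
theorem exists_expansion (hP : IsSmoothControlledMatrix P)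
    (hπ : IsInvariantPmf (P 0) π) (hν : IsInputLaw ν) :
    ∃ G₂ : ℤ → Matrix S S ℝ, (∀ i j, Summable fun k => |G₂ k i j|) ∧
      ∃ ε₀ > 0, ∃ C ≥ 0, ∀ ε : ℝ, 0 ≤ ε → ε < ε₀ →
      ∀ (Ω : Type v) [MeasurableSpace Ω] (μ : Measure Ω) (ζ : ℤ → Ω → ℝ) (X : ℤ → Ω → S),
        IsStationaryRealization P ν ε μ ζ X → ∀ k i j,
        |indicatorCov μ X k i j -
          (nominalStateCov (P 0 - constRows π) π k i j + ε ^ 2 * G₂ k i j)| ≤ C * ε ^ 3 ∧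
        |autocovMatrix μ (drivingNoise P ζ X) k i j - (nominalNoiseCov (P 0) π k i j +
          ε ^ 2 * noiseCov (P 0 - constRows π) G₂ k i j)| ≤ C * ε ^ 3 := by
  obtain ⟨ε₀, hε₀, c, hc1, hc⟩ :=
    IsStationaryRealization.exists_isPerturbedChain.{v, _} hP hπ hν
  obtain ⟨b, ρ, hρ, hR⟩ := hν.autocov_decay
  set A := P 0 - constRows π with hA
  set G₂ : ℤ → Matrix S S ℝ := twoSided (covShift (vecMulCLM A) (vecMulCLM (firstDeriv P))
    (vecMulCLM (secondDeriv P)) π (inputCov ν)) with hG₂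
  have hsum : Summable fun n : ℕ => ‖vecMulCLM A ^ n‖ :=
    summable_norm_vecMulCLM_pow (hP.stochastic 0) hP.irreducible hP.aperiodic hπ
  have ha := entrySum_nonneg A
  have hc0 : 0 ≤ c := by linarith
  refine ⟨G₂, fun i j => summable_twoSided
    (fun i => summable_norm_covShift hsum hρ (fun k => hR k) i) i j,
    min ε₀ 1, lt_min hε₀ one_pos, 50 * c ^ 7 + ((1 + entrySum A) ^ 2 * (50 * c ^ 7) +
      8 * (1 + entrySum A) * c + 4 * c * c), by positivity, ?_⟩
  intro ε hε hεlt Ω _ μ ζ X h k i j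
  obtain ⟨htay, hch⟩ := hc ε hε (hεlt.trans_le (min_le_left _ _))
  have hε1 : ε ≤ 1 := (hεlt.trans_le (min_le_right _ _)).le
  have hchain := hch Ω μ ζ X h
  have hind : ∀ k i j, |indicatorCov μ X k i j - (nominalStateCov A π k i j + ε ^ 2 * G₂ k i j)| ≤
      50 * c ^ 7 * ε ^ 3 := h.abs_indicatorCov_sub_le hchain
  refine ⟨(hind k i j).trans ?_, ?_⟩
  · rw [add_mul]
    exact le_add_of_nonneg_right (by positivity)
  · have h1 := h.abs_autocovMatrix_sub_noiseCov_le hν hε htay π k i j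
    have h2 := abs_noiseCov_le A (G := fun k => indicatorCov μ X k -
      (nominalStateCov A π k + ε ^ 2 • G₂ k)) (g := 50 * c ^ 7 * ε ^ 3)
      (fun k i j => hind k i j) k i j
    rw [noiseCov_sub_add_smul, noiseCov_nominalStateCov hπ.2.1 hπ.2.2] at h2
    simp only [Matrix.sub_apply, Matrix.add_apply, Matrix.smul_apply, smul_eq_mul] at h2
    rw [← hA] at h1
    -- The covariance of two remainders is of order ε⁶, absorbed into ε³ because ε ≤ 1.
    have h3 : c * ε ^ 3 * (c * ε ^ 3) ≤ c * c * ε ^ 3 := by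
      have : ε ^ 3 ≤ 1 := pow_le_one₀ hε hε1
      have h4 : 0 ≤ c * c * ε ^ 3 := by positivity
      nlinarith
    have h5 := abs_sub_le (autocovMatrix μ (drivingNoise P ζ X) k i j)
      (noiseCov A (indicatorCov μ X) k i j)
      (nominalNoiseCov (P 0) π k i j + ε ^ 2 * noiseCov A G₂ k i j)
    have h6 : 0 ≤ 50 * c ^ 7 * ε ^ 3 := by positivity
    refine h5.trans ((add_le_add h1 h2).trans ?_)
    linarith

end IsStationaryRealization
end Realization

/-! ### Power spectral densities and filters -/

section Fourier

/-- The character `k ↦ e^{-ikθ}` of `ℤ`. -/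
def character (θ : ℝ) (k : ℤ) : ℂ := Complex.exp (-((k : ℂ) * θ * Complex.I))

lemma norm_character (θ : ℝ) (k : ℤ) : ‖character θ k‖ = 1 := by
  have : -((k : ℂ) * θ * Complex.I) = ((-(k * θ) : ℝ) : ℂ) * Complex.I := by push_cast; ring
  rw [character, this, Complex.norm_exp_ofReal_mul_I]

lemma character_add (θ : ℝ) (k l : ℤ) :
    character θ (k + l) = character θ k * character θ l := by
  rw [character, character, character, ← Complex.exp_add]
  congr 1; push_cast; ring

lemma character_neg (θ : ℝ) (k : ℤ) : character θ (-k) = star (character θ k) := by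
  rw [character, character, ← starRingEnd_apply, ← Complex.exp_conj]
  congr 1; simp

lemma character_zero (θ : ℝ) : character θ 0 = 1 := by simp [character]

lemma psd_eq (R : ℤ → ℝ) (θ : ℝ) : psd R θ = ∑' k : ℤ, (R k : ℂ) * character θ k := rfl

lemma freqResponse_eq (h : ℕ → ℝ) (θ : ℝ) :
    freqResponse h θ = ∑' k : ℕ, (h k : ℂ) * character θ k := by
  simp [freqResponse, character]

lemma norm_mul_character (a θ : ℝ) (k : ℤ) : ‖(a : ℂ) * character θ k‖ = |a| := by
  rw [norm_mul, norm_character, mul_one, Complex.norm_real, Real.norm_eq_abs]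

lemma summable_norm_psd {R : ℤ → ℝ} (hR : Summable fun k => |R k|) (θ : ℝ) :
    Summable fun k : ℤ => ‖(R k : ℂ) * character θ k‖ := by
  simpa only [norm_mul_character] using hR

lemma summable_psd {R : ℤ → ℝ} (hR : Summable fun k => |R k|) (θ : ℝ) :
    Summable fun k : ℤ => (R k : ℂ) * character θ k := (summable_norm_psd hR θ).of_norm

lemma summable_norm_freqResponse {h : ℕ → ℝ} (hh : Summable fun k => |h k|) (θ : ℝ) :
    Summable fun k : ℕ => ‖(h k : ℂ) * character θ k‖ := by
  simpa only [norm_mul_character] using hh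

lemma integral_character (k : ℤ) : ∫ θ in (0 : ℝ)..(2 * Real.pi), character θ k =
    if k = 0 then (2 * Real.pi : ℂ) else 0 := by
  have h1 : ∀ θ : ℝ, character θ k = Complex.exp ((-(k : ℂ) * Complex.I) * θ) := fun θ => by
    rw [character]; congr 1; ring
  simp only [h1]
  split_ifs with hk
  · simp [hk]
  · have hc : -(k : ℂ) * Complex.I ≠ 0 := by simp [hk]
    rw [integral_exp_mul_complex hc]
    have h2 : -(k : ℂ) * Complex.I * ((2 * Real.pi : ℝ) : ℂ) =
        ((-k : ℤ) : ℂ) * (2 * Real.pi * Complex.I) := by push_cast; ring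
    rw [h2, Complex.exp_int_mul_two_pi_mul_I]
    simp

/-- The average of a power spectral density is the variance. -/
theorem spectralAverage_psd {R : ℤ → ℝ} (hR : Summable fun k => |R k|) :
    spectralAverage (psd R) = R 0 := by
  have hπ : (0 : ℝ) ≤ 2 * Real.pi := by positivity
  have hcont : ∀ k : ℤ, Continuous fun θ : ℝ => (R k : ℂ) * character θ k := fun k => by
    unfold character; fun_prop
  have hsum := hasSum_integral_of_summable_integral_norm
    (μ := volume.restrict (Set.Ioc 0 (2 * Real.pi)))
    (F := fun (k : ℤ) (θ : ℝ) => (R k : ℂ) * character θ k)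
    (fun k => ((hcont k).intervalIntegrable 0 (2 * Real.pi)).1) (by
      simp only [norm_mul_character, integral_const]
      exact hR.mul_left _)
  have h1 := hsum.tsum_eq
  rw [spectralAverage, intervalIntegral.integral_of_le hπ]
  simp only [psd_eq]
  rw [← h1]
  simp only [← intervalIntegral.integral_of_le hπ, intervalIntegral.integral_const_mul,
    integral_character]
  rw [tsum_eq_single 0 fun k hk => by simp [hk]]
  have hpi : (Real.pi : ℂ) ≠ 0 := by exact_mod_cast Real.pi_ne_zero
  simp only [if_true]
  field_simp

/-- The autocovariance of the output of the filter with impulse response `h`, when the input has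
autocovariance `R`. -/
def filteredCov (h : ℕ → ℝ) (R : ℤ → ℝ) (k : ℤ) : ℝ :=
  ∑' p : ℕ × ℕ, h p.1 * h p.2 * R (k + p.1 - p.2)

variable {h : ℕ → ℝ} (hh : Summable fun k => |h k|)

include hh in
lemma summable_norm_prod : Summable fun p : ℕ × ℕ => ‖h p.1 * h p.2‖ :=
  Summable.mul_norm (by simpa using hh) (by simpa using hh)

include hh in
lemma tsum_norm_prod : ∑' p : ℕ × ℕ, ‖h p.1 * h p.2‖ = (∑' k, |h k|) ^ 2 := by
  have hh' : Summable fun k => ‖|h k|‖ := by simpa using hh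
  rw [sq, tsum_mul_tsum_of_summable_norm hh' hh']
  simp

include hh in
lemma summable_filteredCov {R : ℤ → ℝ} {B : ℝ} (hB : ∀ k, |R k| ≤ B) (k : ℤ) :
    Summable fun p : ℕ × ℕ => h p.1 * h p.2 * R (k + p.1 - p.2) := by
  refine Summable.of_norm_bounded ((summable_norm_prod hh).mul_right B) fun p => ?_
  rw [norm_mul]
  exact mul_le_mul_of_nonneg_left (hB _) (norm_nonneg _)

include hh in
lemma abs_filteredCov_le {R : ℤ → ℝ} {B : ℝ} (hB : ∀ k, |R k| ≤ B) (k : ℤ) :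
    |filteredCov h R k| ≤ (∑' k, |h k|) ^ 2 * B := by
  rw [← tsum_norm_prod hh]
  have hb : ∀ p : ℕ × ℕ, ‖h p.1 * h p.2 * R (k + p.1 - p.2)‖ ≤ ‖h p.1 * h p.2‖ * B := fun p => by
    rw [norm_mul]
    exact mul_le_mul_of_nonneg_left (hB _) (norm_nonneg _)
  exact tsum_of_norm_bounded ((summable_norm_prod hh).hasSum.mul_right B) hb

include hh in
lemma filteredCov_sub_add_mul {R R₀ R₂ : ℤ → ℝ} {B B₀ B₂ : ℝ} (hB : ∀ k, |R k| ≤ B)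
    (hB₀ : ∀ k, |R₀ k| ≤ B₀) (hB₂ : ∀ k, |R₂ k| ≤ B₂) (a : ℝ) (k : ℤ) :
    filteredCov h (fun k => R k - (R₀ k + a * R₂ k)) k =
      filteredCov h R k - (filteredCov h R₀ k + a * filteredCov h R₂ k) := by
  have h1 := summable_filteredCov hh hB k
  have h2 := summable_filteredCov hh hB₀ k
  have h3 := summable_filteredCov hh hB₂ k
  unfold filteredCov
  rw [← tsum_mul_left, ← h2.tsum_add (h3.mul_left a), ← h1.tsum_sub (h2.add (h3.mul_left a))]
  exact tsum_congr fun p => by ring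

/-- The shear `(p, k) ↦ (p, k + p.1 - p.2)`. -/
def lagShear : (ℕ × ℕ) × ℤ ≃ (ℕ × ℕ) × ℤ :=
  Equiv.prodShear (Equiv.refl _) fun p => Equiv.addRight ((p.1 : ℤ) - p.2)

lemma lagShear_apply (p : ℕ × ℕ) (k : ℤ) : lagShear (p, k) = (p, k + (p.1 - p.2)) := rfl

-- Shifting k by a lag depending on the filter indices is a bijection of the index set, so a product
-- of summable families remains summable.
include hh in
lemma summable_filteredCov_joint {R : ℤ → ℝ} (hR : Summable fun k => |R k|) :
    Summable fun q : (ℕ × ℕ) × ℤ => ‖h q.1.1 * h q.1.2 * R (q.2 + q.1.1 - q.1.2)‖ := by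
  have h1 : Summable fun q : (ℕ × ℕ) × ℤ => ‖(h q.1.1 * h q.1.2) * R q.2‖ :=
    Summable.mul_norm (f := fun p : ℕ × ℕ => h p.1 * h p.2) (summable_norm_prod hh)
      (by simpa using hR)
  refine (lagShear.summable_iff.2 h1).congr fun q => ?_
  simp only [Function.comp_apply, lagShear_apply q.1 q.2, add_sub_assoc]

include hh in
lemma summable_abs_filteredCov {R : ℤ → ℝ} (hR : Summable fun k => |R k|) :
    Summable fun k => |filteredCov h R k| := by
  have h1 := (summable_filteredCov_joint hh hR)
  have h2 : Summable fun q : ℤ × (ℕ × ℕ) => ‖h q.2.1 * h q.2.2 * R (q.1 + q.2.1 - q.2.2)‖ :=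
    (Equiv.prodComm ℤ (ℕ × ℕ)).summable_iff.2 h1
  refine Summable.of_nonneg_of_le (fun _ => abs_nonneg _) (fun k => ?_) h2.prod
  exact norm_tsum_le_tsum_norm (h2.prod_factor k)

/-- Characters are multiplicative and unimodular: the phase at k is the phase at the shifted lag
times compensating phases, one conjugated, which is how |H|² arises. -/
lemma filter_term_eq (a b r θ : ℝ) (m n k : ℤ) :
    ((a * b * r : ℝ) : ℂ) * character θ k = star ((a : ℂ) * character θ m) *
      ((b : ℂ) * character θ n) * ((r : ℂ) * character θ (k + (m - n))) := by
  have key : ∀ m, character θ m * star (character θ m) = 1 := fun m => by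
    rw [← character_neg, ← character_add, add_neg_cancel, character_zero]
  have h1 := key m
  have h2 := key n
  have h3 : star (a : ℂ) = a := Complex.conj_ofReal _
  rw [sub_eq_add_neg, character_add, character_add, character_neg θ n, star_mul', h3]
  push_cast
  generalize character θ m = x at *
  generalize character θ n = y at *
  generalize star x = x' at *
  generalize star y = y' at *
  linear_combination (-(a : ℂ) * b * r * character θ k * (y * y')) * h1 +
    (-(a : ℂ) * b * r * character θ k) * h2

include hh in
/-- The action of a filter on power spectral densities. -/
theorem psd_filteredCov {R : ℤ → ℝ} (hR : Summable fun k => |R k|) (θ : ℝ) :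
    psd (filteredCov h R) θ = (‖freqResponse h θ‖ : ℂ) ^ 2 * psd R θ := by
  obtain ⟨a, ha⟩ : ∃ a : ℕ → ℂ, ∀ k, a k = (h k : ℂ) * character θ k := ⟨_, fun _ => rfl⟩
  have hH : Summable fun k => ‖a k‖ := by
    simp only [ha]
    exact summable_norm_freqResponse hh θ
  have hH' : Summable fun k => ‖star (a k)‖ := by simpa only [norm_star] using hH
  obtain ⟨u, hu⟩ : ∃ u : ℕ × ℕ → ℂ, ∀ p, u p = star (a p.1) * a p.2 := ⟨_, fun _ => rfl⟩
  have hu_norm : Summable fun p => ‖u p‖ := by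
    simp only [hu]
    exact Summable.mul_norm (f := fun k => star (a k)) hH' hH
  have hu_sum : ∑' p, u p = (‖freqResponse h θ‖ : ℂ) ^ 2 := by
    have hfr : freqResponse h θ = ∑' k, a k := by rw [freqResponse_eq]; simp only [ha]
    simp only [hu]
    rw [← tsum_mul_tsum_of_summable_norm (f := fun k => star (a k)) hH' hH, ← tsum_star, hfr]
    exact Complex.conj_mul' _
  have hRn := summable_norm_psd hR θ
  obtain ⟨G, hG⟩ : ∃ G : (ℕ × ℕ) × ℤ → ℂ, ∀ q, G q = u q.1 * ((R q.2 : ℂ) * character θ q.2) :=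
    ⟨_, fun _ => rfl⟩
  have hGsum : Summable G := by
    rw [funext hG]
    exact (Summable.mul_norm hu_norm hRn).of_norm
  have hGtsum : ∑' q, G q = (‖freqResponse h θ‖ : ℂ) ^ 2 * psd R θ := by
    rw [psd_eq, ← hu_sum, tsum_mul_tsum_of_summable_norm hu_norm hRn]
    exact tsum_congr hG
  obtain ⟨F, hF⟩ : ∃ F : ℤ → ℕ × ℕ → ℂ, ∀ k p, F k p =
    ((h p.1 * h p.2 * R (k + p.1 - p.2) : ℝ) : ℂ) * character θ k := ⟨_, fun _ _ => rfl⟩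
  have hFG : ∀ q : (ℕ × ℕ) × ℤ, F q.2 q.1 = G (lagShear q) := fun q => by
    rw [lagShear_apply q.1 q.2, hG, hF, hu, ha, ha, add_sub_assoc]
    exact filter_term_eq _ _ _ _ _ _ _
  have hsum : Summable fun q : (ℕ × ℕ) × ℤ => F q.2 q.1 := by
    simp only [hFG]
    exact lagShear.summable_iff.2 hGsum
  have hsum' : Summable (Function.uncurry F) := (Equiv.prodComm ℤ (ℕ × ℕ)).summable_iff.2 hsum
  have h1 : psd (filteredCov h R) θ = ∑' k, ∑' p, F k p := by
    rw [psd_eq]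
    refine tsum_congr fun k => ?_
    simp only [hF]
    rw [filteredCov, Complex.ofReal_tsum, ← tsum_mul_right]
  rw [h1, ← hGtsum, ← lagShear.tsum_eq G, ← Summable.tsum_comm hsum']
  simp only [← hFG]
  exact hsum.tsum_prod.symm

end Fourier

/-! ### Quality of service as a filtered signal -/

section Qos

variable {S : Type*} [Fintype S] [DecidableEq S]

/-- The autocovariance of `Γ_t ℓ` in terms of that of `Γ`. -/
def quadCov (ℓ : S → ℝ) (G : ℤ → Matrix S S ℝ) (k : ℤ) : ℝ := ∑ i, ∑ j, ℓ i * ℓ j * G k i j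

lemma abs_quadCov_le (ℓ : S → ℝ) {G : ℤ → Matrix S S ℝ} {g : ℝ} (hG : ∀ k i j, |G k i j| ≤ g)
    (k : ℤ) : |quadCov ℓ G k| ≤ (∑ i, ∑ j, |ℓ i * ℓ j|) * g := by
  simp only [quadCov, Finset.sum_mul]
  refine (Finset.abs_sum_le_sum_abs _ _).trans (Finset.sum_le_sum fun i _ =>
    (Finset.abs_sum_le_sum_abs _ _).trans (Finset.sum_le_sum fun j _ => ?_))
  rw [abs_mul]
  exact mul_le_mul_of_nonneg_left (hG k i j) (abs_nonneg _)

lemma quadCov_sub_add_smul (ℓ : S → ℝ) (G G₀ G₂ : ℤ → Matrix S S ℝ) (a : ℝ) (k : ℤ) :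
    quadCov ℓ (fun k => G k - (G₀ k + a • G₂ k)) k =
      quadCov ℓ G k - (quadCov ℓ G₀ k + a * quadCov ℓ G₂ k) := by
  simp only [quadCov, Finset.mul_sum, ← Finset.sum_add_distrib, ← Finset.sum_sub_distrib]
  refine Finset.sum_congr rfl fun i _ => Finset.sum_congr rfl fun j _ => ?_
  simp only [Matrix.sub_apply, Matrix.add_apply, Matrix.smul_apply, smul_eq_mul]
  ring

lemma summable_quadCov (ℓ : S → ℝ) {G : ℤ → Matrix S S ℝ}
    (hG : ∀ i j, Summable fun k => |G k i j|) : Summable fun k => |quadCov ℓ G k| :=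
  (summable_sum fun i _ => summable_sum fun j _ => (hG i j).of_abs.mul_left _).abs

variable [MeasurableSpace S] [DiscreteMeasurableSpace S]
  {Ω : Type*} [MeasurableSpace Ω] {μ : Measure Ω} {X : ℤ → Ω → S} {ℓ : S → ℝ} {h : ℕ → ℝ}

lemma abs_loadSignal_le (ℓ : S → ℝ) (X : ℤ → Ω → S) (t : ℤ) (ω : Ω) :
    |loadSignal ℓ X t ω| ≤ ‖ℓ‖ := norm_le_pi_norm ℓ _

lemma measurable_loadSignal (hX : ∀ t, Measurable (X t)) (t : ℤ) :
    Measurable (loadSignal ℓ X t) := (measurable_of_countable ℓ).comp (hX t)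

/-- The load signal centered at its mean. -/
def centeredLoad (μ : Measure Ω) (ℓ : S → ℝ) (X : ℤ → Ω → S) (t : ℤ) (ω : Ω) : ℝ :=
  loadSignal ℓ X t ω - ∫ ω, loadSignal ℓ X t ω ∂μ

variable [IsProbabilityMeasure μ]

lemma abs_centeredLoad_le (t : ℤ) (ω : Ω) : |centeredLoad μ ℓ X t ω| ≤ 2 * ‖ℓ‖ := by
  have h1 : |∫ ω, loadSignal ℓ X t ω ∂μ| ≤ ‖ℓ‖ := by
    simpa using norm_integral_le_of_norm_le_const (μ := μ) (f := loadSignal ℓ X t) (C := ‖ℓ‖)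
      (Eventually.of_forall fun ω => abs_loadSignal_le ℓ X t ω)
  refine (abs_sub _ _).trans ?_
  linarith [abs_loadSignal_le ℓ X t ω]

lemma integrable_loadSignal (hX : ∀ t, Measurable (X t)) (t : ℤ) :
    Integrable (loadSignal ℓ X t) μ :=
  Integrable.of_bound (measurable_loadSignal hX t).aestronglyMeasurable ‖ℓ‖
    (Eventually.of_forall fun ω => abs_loadSignal_le ℓ X t ω)

lemma measurable_centeredLoad (hX : ∀ t, Measurable (X t)) (t : ℤ) :
    Measurable (centeredLoad μ ℓ X t) := (measurable_loadSignal hX t).sub_const _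

lemma norm_mul_centeredLoad_le (k : ℕ) (t : ℤ) (ω : Ω) :
    ‖h k * centeredLoad μ ℓ X t ω‖ ≤ |h k| * (2 * ‖ℓ‖) := by
  rw [norm_mul]
  exact mul_le_mul_of_nonneg_left (abs_centeredLoad_le t ω) (abs_nonneg _)

/-- The terms are dominated by |h_k|‖ℓ‖, so expectation and filter sum commute. -/
lemma qos_sub_integral (hh : Summable fun k => |h k|) (hX : ∀ t, Measurable (X t)) (t : ℤ)
    (ω : Ω) : qos h ℓ X t ω - ∫ ω, qos h ℓ X t ω ∂μ =
      ∑' k : ℕ, h k * centeredLoad μ ℓ X (t - k) ω := by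
  have hb : ∀ (k : ℕ) ω, ‖h k * loadSignal ℓ X (t - k) ω‖ ≤ |h k| * ‖ℓ‖ := fun k ω => by
    rw [norm_mul]
    exact mul_le_mul_of_nonneg_left (abs_loadSignal_le _ _ _ _) (abs_nonneg _)
  have hsum := hasSum_integral_of_summable_integral_norm (μ := μ)
    (F := fun (k : ℕ) ω => h k * loadSignal ℓ X (t - k) ω)
    (fun k => (integrable_loadSignal hX _).const_mul _)
    (Summable.of_nonneg_of_le (fun k => integral_nonneg fun ω => norm_nonneg _) (fun k => by
      have := norm_integral_le_of_norm_le_const (μ := μ)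
        (f := fun ω => ‖h k * loadSignal ℓ X (t - k) ω‖) (C := |h k| * ‖ℓ‖)
        (Eventually.of_forall fun ω => by simpa only [norm_norm] using hb k ω)
      exact (le_abs_self _).trans (by simpa using this)) (hh.mul_right ‖ℓ‖))
  have hω : HasSum (fun k : ℕ => h k * loadSignal ℓ X (t - k) ω) (qos h ℓ X t ω) :=
    (Summable.of_norm_bounded (hh.mul_right ‖ℓ‖) fun k => hb k ω).hasSum
  refine (HasSum.tsum_eq ?_).symm
  refine (hω.sub hsum).congr_fun ?_
  intro k
  simp only [centeredLoad, mul_sub, integral_const_mul]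

/-- The product of the two centered filter sums is dominated by |h_p||h_q|(2‖ℓ‖)², which is summable
over pairs and permits integration term by term. -/
lemma covariance_qos (hh : Summable fun k => |h k|) (hX : ∀ t, Measurable (X t)) (s t : ℤ) :
    cov[qos h ℓ X s, qos h ℓ X t; μ] = ∑' p : ℕ × ℕ, h p.1 * h p.2 *
      cov[loadSignal ℓ X (s - p.1), loadSignal ℓ X (t - p.2); μ] := by
  set B := 2 * ‖ℓ‖
  have hn : ∀ (r : ℤ) ω, Summable fun k : ℕ => ‖h k * centeredLoad μ ℓ X (r - k) ω‖ :=
    fun r ω => Summable.of_nonneg_of_le (fun _ => norm_nonneg _)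
      (fun k => norm_mul_centeredLoad_le k _ ω) (hh.mul_right B)
  have hb : ∀ (p : ℕ × ℕ) ω, ‖h p.1 * centeredLoad μ ℓ X (s - p.1) ω *
      (h p.2 * centeredLoad μ ℓ X (t - p.2) ω)‖ ≤ |h p.1| * B * (|h p.2| * B) := fun p ω => by
    rw [norm_mul]
    exact mul_le_mul (norm_mul_centeredLoad_le _ _ ω) (norm_mul_centeredLoad_le _ _ ω)
      (norm_nonneg _) (by positivity)
  have hmeas : ∀ p : ℕ × ℕ, Measurable fun ω => h p.1 * centeredLoad μ ℓ X (s - p.1) ω *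
      (h p.2 * centeredLoad μ ℓ X (t - p.2) ω) := fun p =>
    ((measurable_centeredLoad hX _).const_mul _).mul ((measurable_centeredLoad hX _).const_mul _)
  have hBs : Summable fun p : ℕ × ℕ => |h p.1| * B * (|h p.2| * B) :=
    Summable.mul_of_nonneg (f := fun k => |h k| * B) (g := fun k => |h k| * B)
      (hh.mul_right B) (hh.mul_right B) (fun _ => by positivity) (fun _ => by positivity)
  have hsum := hasSum_integral_of_summable_integral_norm (μ := μ)
    (F := fun (p : ℕ × ℕ) ω => h p.1 * centeredLoad μ ℓ X (s - p.1) ω *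
      (h p.2 * centeredLoad μ ℓ X (t - p.2) ω))
    (fun p => Integrable.of_bound (hmeas p).aestronglyMeasurable _
      (Eventually.of_forall fun ω => hb p ω))
    (Summable.of_nonneg_of_le (fun p => integral_nonneg fun ω => norm_nonneg _) (fun p => by
      have := norm_integral_le_of_norm_le_const (μ := μ)
        (f := fun ω => ‖h p.1 * centeredLoad μ ℓ X (s - p.1) ω *
          (h p.2 * centeredLoad μ ℓ X (t - p.2) ω)‖) (C := |h p.1| * B * (|h p.2| * B))
        (Eventually.of_forall fun ω => by simpa only [norm_norm] using hb p ω)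
      exact (le_abs_self _).trans (by simpa using this)) hBs)
  have h1 : cov[qos h ℓ X s, qos h ℓ X t; μ] = ∫ ω, ∑' p : ℕ × ℕ,
      h p.1 * centeredLoad μ ℓ X (s - p.1) ω * (h p.2 * centeredLoad μ ℓ X (t - p.2) ω) ∂μ := by
    rw [covariance]
    refine integral_congr_ae (Eventually.of_forall fun ω => ?_)
    beta_reduce
    rw [qos_sub_integral hh hX, qos_sub_integral hh hX,
      tsum_mul_tsum_of_summable_norm (hn s ω) (hn t ω)]
  rw [h1, ← hsum.tsum_eq]
  refine tsum_congr fun p => ?_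
  rw [covariance, ← integral_const_mul]
  refine integral_congr_ae (Eventually.of_forall fun ω => ?_)
  simp only [centeredLoad]
  ring

lemma loadSignal_eq_sum (ℓ : S → ℝ) (X : ℤ → Ω → S) (t : ℤ) :
    loadSignal ℓ X t = fun ω => ∑ i, ℓ i * stateInd X t i ω := by
  ext ω; simp [loadSignal, stateInd]

namespace IsStationaryRealization

variable {P : ℝ → Matrix S S ℝ} {ν : Measure (ℤ → ℝ)} {ε : ℝ} {ζ : ℤ → Ω → ℝ}

lemma covariance_loadSignal (hr : IsStationaryRealization P ν ε μ ζ X) (ℓ : S → ℝ) (s t : ℤ) :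
    cov[loadSignal ℓ X s, loadSignal ℓ X t; μ] = quadCov ℓ (indicatorCov μ X) (t - s) := by
  rw [loadSignal_eq_sum, loadSignal_eq_sum, covariance_fun_sum_fun_sum
    (fun i => (memLp_stateInd (hr.measurable_state s) i).const_mul _)
    (fun i => (memLp_stateInd (hr.measurable_state t) i).const_mul _)]
  refine Finset.sum_congr rfl fun i _ => Finset.sum_congr rfl fun j _ => ?_
  rw [covariance_const_mul_left, covariance_const_mul_right, hr.covariance_stateInd]
  simp only [indicatorCov, Matrix.of_apply]
  ring

lemma autocov_loadSignal (hr : IsStationaryRealization P ν ε μ ζ X) (ℓ : S → ℝ) :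
    autocov μ (loadSignal ℓ X) = quadCov ℓ (indicatorCov μ X) := by
  ext k
  rw [autocov, hr.covariance_loadSignal, sub_zero]

lemma covariance_qos_eq (hr : IsStationaryRealization P ν ε μ ζ X) (hh : Summable fun k => |h k|)
    (ℓ : S → ℝ) (s t : ℤ) : cov[qos h ℓ X s, qos h ℓ X t; μ] =
      filteredCov h (autocov μ (loadSignal ℓ X)) (t - s) := by
  rw [covariance_qos hh hr.measurable_state, hr.autocov_loadSignal]
  refine tsum_congr fun p => ?_
  rw [hr.covariance_loadSignal]
  congr 2; ring

lemma autocov_qos (hr : IsStationaryRealization P ν ε μ ζ X) (hh : Summable fun k => |h k|)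
    (ℓ : S → ℝ) : autocov μ (qos h ℓ X) = filteredCov h (autocov μ (loadSignal ℓ X)) := by
  ext k
  rw [autocov, hr.covariance_qos_eq hh, sub_zero]

lemma aemeasurable_qos (hr : IsStationaryRealization P ν ε μ ζ X) (h : ℕ → ℝ)
    (ℓ : S → ℝ) (t : ℤ) : AEMeasurable (qos h ℓ X t) μ :=
  (Measurable.tsum fun k : ℕ =>
    (measurable_loadSignal (ℓ := ℓ) hr.measurable_state (t - k)).const_mul (h k)).aemeasurable

lemma variance_qos (hr : IsStationaryRealization P ν ε μ ζ X) (hh : Summable fun k => |h k|)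
    (ℓ : S → ℝ) (t : ℤ) :
    Var[qos h ℓ X t; μ] = filteredCov h (autocov μ (loadSignal ℓ X)) 0 := by
  rw [← covariance_self (hr.aemeasurable_qos h ℓ t), hr.covariance_qos_eq hh, sub_self]

end IsStationaryRealization

end Qos

/-! ### The moving window -/

section Window

lemma summable_windowResponse (T : ℕ) : Summable fun k => |windowResponse T k| := by
  refine summable_of_ne_finset_zero (s := Finset.range (T + 1)) fun k hk => ?_
  have : ¬ k ≤ T := fun h => hk (Finset.mem_range.2 (by omega))
  simp [windowResponse, this]

lemma filteredCov_windowResponse (T : ℕ) (R : ℤ → ℝ) : filteredCov (windowResponse T) R 0 =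
    ∑ m ∈ Finset.range (T + 1), ∑ n ∈ Finset.range (T + 1), R ((m : ℤ) - n) := by
  rw [filteredCov, tsum_eq_sum (s := Finset.range (T + 1) ×ˢ Finset.range (T + 1)),
    Finset.sum_product]
  · refine Finset.sum_congr rfl fun m hm => Finset.sum_congr rfl fun n hn => ?_
    rw [Finset.mem_range] at hm hn
    simp [windowResponse, Nat.le_of_lt_succ hm, Nat.le_of_lt_succ hn]
  · rintro ⟨m, n⟩ hmn
    rw [Finset.mem_product, Finset.mem_range, Finset.mem_range, not_and_or] at hmn
    rcases hmn with hm | hn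
    · have : ¬ m ≤ T := by simp only at hm; omega
      simp [windowResponse, this]
    · have : ¬ n ≤ T := by simp only at hn; omega
      simp [windowResponse, this]

/-- Pairs are grouped by t = max(m, n); each group is a symmetric partial sum of R, so the double
sum divided by T is a Cesàro mean. -/
lemma sum_sum_lag_eq (R : ℤ → ℝ) (T : ℕ) :
    ∑ m ∈ Finset.range T, ∑ n ∈ Finset.range T, R ((m : ℤ) - n) =
      ∑ t ∈ Finset.range T, (∑ j ∈ Finset.range t, R ((j : ℤ) + 1) + R 0 +
        ∑ j ∈ Finset.range t, R (-((j : ℤ) + 1))) := by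
  induction T with
  | zero => simp
  | succ T ih =>
    rw [Finset.sum_range_succ _ T, Finset.sum_range_succ (fun t => _ + R 0 + _) T, ← ih]
    simp only [Finset.sum_range_succ _ T, Finset.sum_add_distrib, sub_self]
    have h1 : ∑ j ∈ Finset.range T, R ((j : ℤ) + 1) = ∑ n ∈ Finset.range T, R ((T : ℤ) - n) := by
      rw [← Finset.sum_range_reflect]
      refine Finset.sum_congr rfl fun n hn => ?_
      have := Finset.mem_range.1 hn
      congr 1; omega
    have h2 : ∑ j ∈ Finset.range T, R (-((j : ℤ) + 1)) =
        ∑ n ∈ Finset.range T, R ((n : ℤ) - T) := by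
      rw [← Finset.sum_range_reflect]
      refine Finset.sum_congr rfl fun n hn => ?_
      have := Finset.mem_range.1 hn
      congr 1; omega
    rw [h1, h2]
    ring

/-- The normalized variance of a moving window converges to the power spectral density at zero
frequency. -/
theorem tendsto_filteredCov_window {R : ℤ → ℝ} (hR : Summable fun k => |R k|) :
    Tendsto (fun T : ℕ => ((filteredCov (windowResponse T) R 0 / T : ℝ) : ℂ)) atTop
      (𝓝 (psd R 0)) := by
  have hR' := hR.of_abs
  have hpos : Summable fun n : ℕ => R ((n : ℤ) + 1) :=
    hR'.comp_injective (i := fun n : ℕ => (n : ℤ) + 1) fun a b hab => by simpa using hab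
  have hneg : Summable fun n : ℕ => R (-((n : ℤ) + 1)) :=
    hR'.comp_injective (i := fun n : ℕ => -((n : ℤ) + 1)) fun a b hab => by simpa using hab
  have hpsd : psd R 0 = ((∑' k, R k : ℝ) : ℂ) := by
    rw [psd_eq, Complex.ofReal_tsum]
    simp [character]
  rw [hpsd]
  refine (Complex.continuous_ofReal.tendsto _).comp ?_
  set s : ℕ → ℝ := fun t => ∑ j ∈ Finset.range t, R ((j : ℤ) + 1) + R 0 +
    ∑ j ∈ Finset.range t, R (-((j : ℤ) + 1)) with hs
  have hlim : Tendsto s atTop (𝓝 (∑' k, R k)) := by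
    rw [tsum_of_add_one_of_neg_add_one hpos hneg]
    exact (hpos.hasSum.tendsto_sum_nat.add_const _).add hneg.hasSum.tendsto_sum_nat
  have h1 := ((tendsto_add_atTop_iff_nat 1).2 hlim.cesaro)
  -- The window contains T + 1 samples but the variance is divided by T.
  have h2 : Tendsto (fun T : ℕ => ((T : ℝ) + 1) / T) atTop (𝓝 1) := by
    have h3 : Tendsto (fun T : ℕ => 1 + (T : ℝ)⁻¹) atTop (𝓝 (1 + 0)) :=
      tendsto_const_nhds.add tendsto_inv_atTop_nhds_zero_nat
    rw [add_zero] at h3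
    refine h3.congr' ?_
    filter_upwards [eventually_gt_atTop 0] with T hT
    have : (T : ℝ) ≠ 0 := by positivity
    field_simp
  have h4 := h2.mul h1
  rw [one_mul] at h4
  refine h4.congr fun T => ?_
  rw [filteredCov_windowResponse, sum_sum_lag_eq]
  push_cast
  have : (T : ℝ) + 1 ≠ 0 := by positivity
  field_simp
  rfl

end Window

/-! ### The spectral density of the linear model -/

section LinearModelPsd

variable {S : Type*} [Fintype S] [DecidableEq S]

lemma hasSum_psd {R : ℤ → ℝ} (hR : Summable fun k => |R k|) (θ : ℝ) :
    HasSum (fun k : ℤ => (R k : ℂ) * character θ k) (psd R θ) := (summable_psd hR θ).hasSum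

lemma hasSum_psd_shift {R : ℤ → ℝ} (hR : Summable fun k => |R k|) (θ : ℝ) (l : ℤ) :
    HasSum (fun k : ℤ => (R (k + l) : ℂ) * character θ k) (character θ (-l) * psd R θ) := by
  have h1 := ((Equiv.addRight l).hasSum_iff.2 (hasSum_psd hR θ)).mul_left (character θ (-l))
  refine h1.congr_fun fun k => ?_
  have h2 : character θ k = character θ (-l) * character θ (k + l) := by
    rw [← character_add]; congr 1; ring
  simp only [Function.comp_apply, Equiv.coe_addRight]
  rw [h2]; ring

/-- The entrywise complexification of a real matrix. -/
def complexify (A : Matrix S S ℝ) : Matrix S S ℂ := A.map fun a => (a : ℂ)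

lemma conjTranspose_complexify (A : Matrix S S ℝ) :
    (complexify A)ᴴ = (complexify A)ᵀ := by
  ext i j
  simp [complexify]

/-- A unit shift of the lag multiplies the Fourier series by e^{±iθ}, so the operation Y_t −
Y_{t−1}A becomes a congruence. -/
lemma psdMatrix_noiseCov (A : Matrix S S ℝ) {G : ℤ → Matrix S S ℝ}
    (hG : ∀ i j, Summable fun k => |G k i j|) (θ : ℝ) :
    psdMatrix (noiseCov A G) θ = (1 - character θ 1 • complexify A)ᴴ * psdMatrix G θ *
      (1 - character θ 1 • complexify A) := by
  set z := character θ 1 with hz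
  have hzz : star z * z = 1 := by
    rw [hz, ← character_neg, ← character_add, neg_add_cancel, character_zero]
  have hexp : (1 - z • complexify A)ᴴ * psdMatrix G θ * (1 - z • complexify A) =
      psdMatrix G θ - star z • ((complexify A)ᵀ * psdMatrix G θ) -
        z • (psdMatrix G θ * complexify A) +
        (complexify A)ᵀ * psdMatrix G θ * complexify A := by
    rw [Matrix.conjTranspose_sub, Matrix.conjTranspose_one, Matrix.conjTranspose_smul,
      conjTranspose_complexify]
    simp only [sub_mul, mul_sub, one_mul, mul_one, Matrix.smul_mul, Matrix.mul_smul, smul_smul]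
    rw [mul_comm z, hzz, one_smul]
    abel
  rw [hexp]
  ext i j
  have h0 : ∀ i j, HasSum (fun k : ℤ => (G k i j : ℂ) * character θ k) (psdMatrix G θ i j) :=
    fun i j => hasSum_psd (hG i j) θ
  have h1 : ∀ x, HasSum (fun k : ℤ => (G (k + 1) x j : ℂ) * character θ k)
      (star z * psdMatrix G θ x j) := fun x => by
    rw [hz, ← character_neg]; exact hasSum_psd_shift (hG x j) θ 1
  have h2 : ∀ y, HasSum (fun k : ℤ => (G (k - 1) i y : ℂ) * character θ k)
      (z * psdMatrix G θ i y) := fun y => hasSum_psd_shift (hG i y) θ (-1)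
  have key := (((h0 i j).sub (hasSum_sum fun x (_ : x ∈ Finset.univ) =>
      (h1 x).mul_left (A x i : ℂ))).sub (hasSum_sum fun y (_ : y ∈ Finset.univ) =>
      (h2 y).mul_left (A y j : ℂ))).add (hasSum_sum fun y (_ : y ∈ Finset.univ) =>
      (hasSum_sum fun x (_ : x ∈ Finset.univ) => (h0 x y).mul_left (A x i : ℂ)).mul_left
        (A y j : ℂ))
  have hfun : ∀ k : ℤ, (noiseCov A G k i j : ℂ) * character θ k =
      (G k i j : ℂ) * character θ k - ∑ x, (A x i : ℂ) * ((G (k + 1) x j : ℂ) * character θ k) -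
      ∑ y, (A y j : ℂ) * ((G (k - 1) i y : ℂ) * character θ k) +
      ∑ y, (A y j : ℂ) * ∑ x, (A x i : ℂ) * ((G k x y : ℂ) * character θ k) := fun k => by
    rw [noiseCov_apply]
    push_cast
    simp only [add_mul, sub_mul, Finset.sum_mul, Finset.mul_sum]
    congr 1
    · congr 1
      · congr 1
        exact Finset.sum_congr rfl fun x _ => by ring
      · exact Finset.sum_congr rfl fun x _ => by ring
    · exact Finset.sum_congr rfl fun y _ => Finset.sum_congr rfl fun x _ => by ring
  have hL : psdMatrix (noiseCov A G) θ i j =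
      ∑' k : ℤ, (noiseCov A G k i j : ℂ) * character θ k := rfl
  rw [hL, tsum_congr hfun, key.tsum_eq]
  simp only [Matrix.add_apply, Matrix.sub_apply, Matrix.smul_apply, Matrix.mul_apply,
    Matrix.transpose_apply, complexify, Matrix.map_apply, smul_eq_mul, Finset.mul_sum,
    Finset.sum_mul]
  congr 1
  · congr 1
    · congr 1
      exact Finset.sum_congr rfl fun x _ => by ring
    · exact Finset.sum_congr rfl fun x _ => by ring
  · exact Finset.sum_congr rfl fun y _ => Finset.sum_congr rfl fun x _ => by ring

lemma tendsto_pow_apply_zero {A : Matrix S S ℝ}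
    (hA : Summable fun n : ℕ => ‖vecMulCLM A ^ n‖) (i j : S) :
    Tendsto (fun n : ℕ => (A ^ n) i j) atTop (𝓝 0) := by
  refine squeeze_zero_norm (a := fun n => ‖vecMulCLM A ^ n‖ * ‖(Pi.single i 1 : S → ℝ)‖)
    (fun n => ?_) (by simpa using hA.tendsto_atTop_zero.mul_const _)
  have h1 : (A ^ n) i j = (vecMulCLM A ^ n) (Pi.single i 1) j := by
    rw [vecMulCLM_pow_apply, Matrix.single_one_vecMul]; rfl
  rw [h1]
  exact (norm_le_pi_norm _ j).trans ((vecMulCLM A ^ n).le_opNorm _)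

/-- A null vector satisfies v = zⁿAⁿv for all n, and the right side tends to 0 since |z| = 1. -/
lemma isUnit_det_one_sub {A : Matrix S S ℝ} (hA : Summable fun n : ℕ => ‖vecMulCLM A ^ n‖)
    {z : ℂ} (hz : ‖z‖ = 1) : IsUnit (1 - z • complexify A).det := by
  rw [isUnit_iff_ne_zero]
  intro hdet
  obtain ⟨v, hv0, hv⟩ := Matrix.exists_mulVec_eq_zero_iff.2 hdet
  have h1 : v = (z • complexify A) *ᵥ v := by
    rw [Matrix.sub_mulVec, Matrix.one_mulVec, sub_eq_zero] at hv
    exact hv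
  have h2 : ∀ n : ℕ, v = (z • complexify A) ^ n *ᵥ v := fun n => by
    induction n with
    | zero => simp
    | succ n ih => rw [pow_succ, ← Matrix.mulVec_mulVec, ← h1]; exact ih
  have h3 : ∀ n : ℕ, complexify A ^ n = complexify (A ^ n) := fun n =>
    (map_pow (RingHom.mapMatrix Complex.ofRealHom) A n).symm
  refine hv0 (funext fun i => ?_)
  have hlim : Tendsto (fun n : ℕ => ∑ j, |(A ^ n) i j| * ‖v j‖) atTop (𝓝 0) := by
    have : Tendsto (fun n : ℕ => ∑ j, |(A ^ n) i j| * ‖v j‖) atTop (𝓝 (∑ j, |0| * ‖v j‖)) :=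
      tendsto_finsetSum _ fun j _ => ((tendsto_pow_apply_zero hA i j).abs).mul_const _
    simpa using this
  refine norm_le_zero_iff.1 (ge_of_tendsto' hlim fun n => ?_)
  have h4 : v i = z ^ n * ∑ j, ((A ^ n) i j : ℂ) * v j := by
    conv_lhs => rw [h2 n]
    rw [smul_pow, h3, Matrix.smul_mulVec, Pi.smul_apply, smul_eq_mul]
    rfl
  rw [h4, norm_mul, norm_pow, hz, one_pow, one_mul]
  refine norm_sum_le_of_le _ fun j _ => ?_
  rw [norm_mul, Complex.norm_real, Real.norm_eq_abs]

lemma psd_quadCov (ℓ : S → ℝ) {G : ℤ → Matrix S S ℝ}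
    (hG : ∀ i j, Summable fun k => |G k i j|) (θ : ℝ) :
    psd (quadCov ℓ G) θ = star (fun x => (ℓ x : ℂ)) ⬝ᵥ (psdMatrix G θ *ᵥ fun x => (ℓ x : ℂ)) := by
  have key : HasSum (fun k : ℤ => ∑ i, ∑ j, ((ℓ i * ℓ j : ℝ) : ℂ) *
      ((G k i j : ℂ) * character θ k)) (∑ i, ∑ j, ((ℓ i * ℓ j : ℝ) : ℂ) * psdMatrix G θ i j) :=
    hasSum_sum fun i _ => hasSum_sum fun j _ => (hasSum_psd (hG i j) θ).mul_left _
  have hfun : ∀ k : ℤ, (quadCov ℓ G k : ℂ) * character θ k =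
      ∑ i, ∑ j, ((ℓ i * ℓ j : ℝ) : ℂ) * ((G k i j : ℂ) * character θ k) := fun k => by
    rw [quadCov]
    push_cast
    simp only [Finset.sum_mul, mul_assoc]
  rw [psd_eq, tsum_congr hfun, key.tsum_eq]
  simp only [dotProduct, Matrix.mulVec, Pi.star_apply, Finset.mul_sum]
  refine Finset.sum_congr rfl fun i _ => Finset.sum_congr rfl fun j _ => ?_
  rw [show star (ℓ i : ℂ) = ℓ i from Complex.conj_ofReal _]
  push_cast
  ring

/-- The transfer function from the driving noise to the signal undoes the passage from the state
process to the driving noise. -/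
lemma linearModelPsd_noiseCov {P₀ : Matrix S S ℝ} {π : S → ℝ}
    (hA : Summable fun n : ℕ => ‖vecMulCLM (P₀ - constRows π) ^ n‖) (ℓ : S → ℝ) (h : ℕ → ℝ)
    {G : ℤ → Matrix S S ℝ} (hG : ∀ i j, Summable fun k => |G k i j|) (θ : ℝ) :
    linearModelPsd P₀ π ℓ h (psdMatrix (noiseCov (P₀ - constRows π) G)) θ =
      (‖freqResponse h θ‖ : ℂ) ^ 2 * psd (quadCov ℓ G) θ := by
  set M : Matrix S S ℂ := 1 - character θ 1 • complexify (P₀ - constRows π) with hM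
  have hg : transferVector P₀ π ℓ θ = M⁻¹ *ᵥ fun x => (ℓ x : ℂ) := by
    rw [transferVector, hM, character, Int.cast_one, one_mul]
    rfl
  have hMg : M *ᵥ transferVector P₀ π ℓ θ = fun x => (ℓ x : ℂ) := by
    rw [hg, Matrix.mulVec_mulVec,
      Matrix.mul_nonsing_inv _ (isUnit_det_one_sub hA (norm_character θ 1)), Matrix.one_mulVec]
  rw [linearModelPsd, psdMatrix_noiseCov _ hG, psd_quadCov ℓ hG, ← hM, ← hMg, Matrix.star_mulVec,
    ← Matrix.mulVec_mulVec, ← Matrix.mulVec_mulVec, Matrix.dotProduct_mulVec _ Mᴴ]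

/-- The variance that the linear model assigns to the filtered signal. -/
lemma spectralAverage_linearModelPsd {P₀ : Matrix S S ℝ} {π : S → ℝ}
    (hA : Summable fun n : ℕ => ‖vecMulCLM (P₀ - constRows π) ^ n‖) (ℓ : S → ℝ) {h : ℕ → ℝ}
    (hh : Summable fun k => |h k|) {G : ℤ → Matrix S S ℝ}
    (hG : ∀ i j, Summable fun k => |G k i j|) :
    spectralAverage (linearModelPsd P₀ π ℓ h (psdMatrix (noiseCov (P₀ - constRows π) G))) =
      filteredCov h (quadCov ℓ G) 0 := by
  have hq := summable_quadCov ℓ hG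
  rw [← spectralAverage_psd (summable_abs_filteredCov hh hq)]
  congr 1
  funext θ
  rw [linearModelPsd_noiseCov hA ℓ h hG, psd_filteredCov hh hq]

end LinearModelPsd

/-! ### Summation of errors over the lags -/

section Tails

lemma summable_pow_natAbs {q : ℝ} (h0 : 0 ≤ q) (h1 : q < 1) :
    Summable fun k : ℤ => q ^ k.natAbs := by
  have := summable_geometric_of_lt_one h0 h1
  exact Summable.of_nat_of_neg (by simpa using this) (by simpa using this)

/-- A sequence that is uniformly of third order, and geometrically decaying up to an absolutely
summable second-order term, has a sum of order `o(ε²)`. -/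
lemma exists_tsum_le {C b q : ℝ} (hC : 0 ≤ C) (hb : 0 ≤ b) (hq0 : 0 ≤ q) (hq1 : q < 1)
    {r : ℤ → ℝ} (hr0 : ∀ k, 0 ≤ r k) (hr : Summable r) {δ : ℝ} (hδ : 0 < δ) :
    ∃ ε₀ > 0, ∀ ε : ℝ, 0 ≤ ε → ε < ε₀ → ∀ e : ℤ → ℝ, (∀ k, |e k| ≤ C * ε ^ 3) →
      (∀ k, k ≠ 0 → |e k| ≤ b * q ^ k.natAbs + ε ^ 2 * r k) →
      (Summable fun k => |e k|) ∧ ∑' k, |e k| ≤ δ * ε ^ 2 := by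
  -- B exceeds b for the geometric bound and C for both the interpolation and the lag k = 0.
  set B := b + C with hB
  set σ : ℝ := q ^ (1 / 3 : ℝ) with hσ
  have hσ0 : 0 ≤ σ := Real.rpow_nonneg hq0 _
  have hσ3 : σ ^ 3 = q := by
    rw [hσ, ← Real.rpow_natCast, ← Real.rpow_mul hq0]; norm_num
  have hσ1 : σ < 1 := Real.rpow_lt_one hq0 hq1 (by norm_num)
  -- Bound on the errors divided by ε². It tends to 0 for each k because of Cε.
  set F : ℝ → ℤ → ℝ := fun ε k => min (C * ε) (B * q ^ k.natAbs / ε ^ 2 + r k) with hF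
  have hbound : ∀ ε : ℝ, 0 < ε → ε < 1 → ∀ k, 0 ≤ F ε k ∧ F ε k ≤ B * σ ^ k.natAbs + r k := by
    intro ε h0 h1 k
    refine ⟨le_min (by positivity) (add_nonneg (by positivity) (hr0 k)), ?_⟩
    set y := B * q ^ k.natAbs / ε ^ 2
    have hy : 0 ≤ y := by positivity
    have hm0 : 0 ≤ min (C * ε) y := le_min (by positivity) hy
    -- Interpolation min(u, y)³ ≤ u²y: with u = Cε the powers of ε cancel, giving a majorant free of
    -- ε. This is why σ is the cube root of q.
    have h3 : min (C * ε) y ≤ B * σ ^ k.natAbs := by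
      refine le_of_pow_le_pow_left₀ (n := 3) (by norm_num) (by positivity) ?_
      calc min (C * ε) y ^ 3 = min (C * ε) y ^ 2 * min (C * ε) y := by ring
        _ ≤ (C * ε) ^ 2 * y :=
            mul_le_mul (pow_le_pow_left₀ hm0 (min_le_left _ _) 2) (min_le_right _ _) hm0
              (by positivity)
        _ = C ^ 2 * (B * q ^ k.natAbs) := by simp only [y]; field_simp
        _ ≤ B ^ 2 * (B * q ^ k.natAbs) := by gcongr; linarith
        _ = (B * σ ^ k.natAbs) ^ 3 := by rw [← hσ3]; ring
    rcases le_total (C * ε) y with hle | hle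
    · rw [min_eq_left hle] at h3
      exact (min_le_left _ _).trans (by linarith [hr0 k])
    · rw [min_eq_right hle] at h3
      exact (min_le_right _ _).trans (by linarith)
  have hdom : Summable fun k : ℤ => B * σ ^ k.natAbs + r k :=
    ((summable_pow_natAbs hσ0 hσ1).mul_left B).add hr
  have hev : ∀ᶠ ε : ℝ in 𝓝[>] 0, 0 < ε ∧ ε < 1 :=
    Ioo_mem_nhdsGT (show (0 : ℝ) < 1 by norm_num)
  have hlim : Tendsto (fun ε => ∑' k, F ε k) (𝓝[>] 0) (𝓝 (∑' _ : ℤ, (0 : ℝ))) := by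
    refine tendsto_tsum_of_dominated_convergence hdom (fun k => ?_) ?_
    · have h1 : Tendsto (fun ε : ℝ => C * ε) (𝓝[>] 0) (𝓝 0) := by
        have : Tendsto (fun ε : ℝ => C * ε) (𝓝 0) (𝓝 (C * 0)) := tendsto_id.const_mul C
        rw [mul_zero] at this
        exact this.mono_left nhdsWithin_le_nhds
      refine tendsto_of_tendsto_of_tendsto_of_le_of_le' tendsto_const_nhds h1 ?_ ?_
      · filter_upwards [hev] with ε hε using (hbound ε hε.1 hε.2 k).1
      · exact Eventually.of_forall fun ε => min_le_left _ _
    · filter_upwards [hev] with ε hε k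
      rw [Real.norm_of_nonneg (hbound ε hε.1 hε.2 k).1]
      exact (hbound ε hε.1 hε.2 k).2
  rw [tsum_zero] at hlim
  obtain ⟨ε₁, hε₁, hsub⟩ := mem_nhdsGT_iff_exists_Ioo_subset.1
    ((hlim.eventually_lt_const hδ).and hev)
  refine ⟨ε₁, hε₁, fun ε hε hεlt e he1 he2 => ?_⟩
  -- At ε = 0 the first bound makes all errors vanish; F involves a division by ε².
  rcases hε.eq_or_lt with rfl | hpos
  · have : ∀ k, |e k| = 0 := fun k => le_antisymm (by simpa using he1 k) (abs_nonneg _)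
    simp [this, summable_zero]
  · obtain ⟨hlt, -, hε1⟩ := hsub ⟨hpos, hεlt⟩
    have hεsq : 0 < ε ^ 2 := by positivity
    have hle : ∀ k, |e k| ≤ ε ^ 2 * F ε k := fun k => by
      rw [mul_comm, ← div_le_iff₀ hεsq]
      refine le_min ?_ ?_
      · rw [div_le_iff₀ hεsq]; exact (he1 k).trans_eq (by ring)
      · rw [div_le_iff₀ hεsq, add_mul, div_mul_cancel₀ _ hεsq.ne']
        have hqk : 0 ≤ q ^ k.natAbs := by positivity
        rcases eq_or_ne k 0 with rfl | hk
        · have h1 : ε ^ 3 ≤ 1 := pow_le_one₀ hε hε1.le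
          have h2 : 0 ≤ r 0 * ε ^ 2 := mul_nonneg (hr0 0) hεsq.le
          have h3 := mul_le_mul_of_nonneg_left h1 hC
          have h4 := he1 0
          simp only [Int.natAbs_zero, pow_zero, mul_one]
          linarith
        · have h1 := he2 k hk
          have h2 : b * q ^ k.natAbs ≤ B * q ^ k.natAbs :=
            mul_le_mul_of_nonneg_right (by linarith) hqk
          linarith
    have hFs : Summable (F ε) := Summable.of_nonneg_of_le (fun k => (hbound ε hpos hε1 k).1)
      (fun k => (hbound ε hpos hε1 k).2) hdom
    have hes : Summable fun k => |e k| :=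
      Summable.of_nonneg_of_le (fun _ => abs_nonneg _) hle (hFs.mul_left _)
    refine ⟨hes, (hes.tsum_le_tsum hle (hFs.mul_left _)).trans ?_⟩
    rw [tsum_mul_left, mul_comm]
    exact mul_le_mul_of_nonneg_right hlt.le hεsq.le

lemma mul_pow_three_le {C δ ε : ℝ} (hC : 0 ≤ C) (hε : 0 ≤ ε) (h : ε < δ / (C + 1)) :
    C * ε ^ 3 ≤ δ * ε ^ 2 := by
  rw [lt_div_iff₀ (by linarith)] at h
  have : C * ε ≤ δ := by linarith
  calc C * ε ^ 3 = C * ε * ε ^ 2 := by ring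
    _ ≤ δ * ε ^ 2 := mul_le_mul_of_nonneg_right this (by positivity)

end Tails

/-! ### The expansions of the spectral density and of the variance -/

section Expansion

variable {S : Type*} [Fintype S] [DecidableEq S]

lemma summable_nominalNoiseCov (P₀ : Matrix S S ℝ) (π : S → ℝ) (i j : S) :
    Summable fun k => |nominalNoiseCov P₀ π k i j| :=
  summable_of_ne_finset_zero (s := {0}) fun k hk => by
    have : k ≠ 0 := by simpa using hk
    simp [nominalNoiseCov, this]

lemma exists_abs_apply_le {G : ℤ → Matrix S S ℝ} (hG : ∀ i j, Summable fun k => |G k i j|) :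
    ∃ g, ∀ k i j, |G k i j| ≤ g := by
  refine ⟨∑ i, ∑ j, ∑' k, |G k i j|, fun k i j => ?_⟩
  have h0 : ∀ i j, 0 ≤ ∑' k, |G k i j| := fun i j => tsum_nonneg fun _ => abs_nonneg _
  calc |G k i j| ≤ ∑' k, |G k i j| := (hG i j).le_tsum k fun _ _ => abs_nonneg _
    _ ≤ ∑ j, ∑' k, |G k i j| :=
        Finset.single_le_sum (f := fun j => ∑' k, |G k i j|) (fun j _ => h0 i j)
          (Finset.mem_univ j)
    _ ≤ _ := Finset.single_le_sum (f := fun i => ∑ j, ∑' k, |G k i j|)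
        (fun i _ => Finset.sum_nonneg fun j _ => h0 i j) (Finset.mem_univ i)

lemma norm_psd_sub_le {R R₀ R₂ : ℤ → ℝ} (hR : Summable fun k => |R k|)
    (hR₀ : Summable fun k => |R₀ k|) (hR₂ : Summable fun k => |R₂ k|) (a θ : ℝ)
    (he : Summable fun k => |R k - (R₀ k + a * R₂ k)|) :
    ‖psd R θ - (psd R₀ θ + (a : ℂ) * psd R₂ θ)‖ ≤ ∑' k, |R k - (R₀ k + a * R₂ k)| := by
  have h1 := (hasSum_psd hR θ).sub ((hasSum_psd hR₀ θ).add ((hasSum_psd hR₂ θ).mul_left (a : ℂ)))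
  rw [← h1.tsum_eq]
  refine tsum_of_norm_bounded he.hasSum fun k => le_of_eq ?_
  rw [← norm_mul_character _ θ k]
  congr 1
  push_cast
  ring

/-- The variance of a filtered signal depends on the autocovariances of the state in a Lipschitz
way. -/
lemma abs_filteredCov_quadCov_sub_le {h : ℕ → ℝ} (hh : Summable fun k => |h k|) (ℓ : S → ℝ)
    {G G₀ G₂ : ℤ → Matrix S S ℝ} {g g₀ g₂ a d : ℝ} (hG : ∀ k i j, |G k i j| ≤ g)
    (hG₀ : ∀ k i j, |G₀ k i j| ≤ g₀) (hG₂ : ∀ k i j, |G₂ k i j| ≤ g₂)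
    (hd : ∀ k i j, |G k i j - (G₀ k i j + a * G₂ k i j)| ≤ d) :
    |filteredCov h (quadCov ℓ G) 0 -
      (filteredCov h (quadCov ℓ G₀) 0 + a * filteredCov h (quadCov ℓ G₂) 0)| ≤
      (∑' k, |h k|) ^ 2 * ((∑ i, ∑ j, |ℓ i * ℓ j|) * d) := by
  rw [← filteredCov_sub_add_mul hh (abs_quadCov_le ℓ hG) (abs_quadCov_le ℓ hG₀)
    (abs_quadCov_le ℓ hG₂)]
  refine abs_filteredCov_le hh (fun k => ?_) 0
  rw [← quadCov_sub_add_smul]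
  exact abs_quadCov_le ℓ (G := fun k => G k - (G₀ k + a • G₂ k)) (fun k i j => hd k i j) k

lemma abs_indicatorCov_le {Ω : Type*} [MeasurableSpace Ω] (μ : Measure Ω)
    [IsProbabilityMeasure μ] (X : ℤ → Ω → S) (k : ℤ) (i j : S) : |indicatorCov μ X k i j| ≤ 4 := by
  have := abs_covariance_le (μ := μ) (Eventually.of_forall (abs_stateInd_le X 0 i))
    (Eventually.of_forall (abs_stateInd_le X k j))
  simpa [indicatorCov] using this

end Expansion

end

/-! ### Assembly of the two parts of the theorem -/

theorem theorem2 {S : Type u} [Fintype S] [DecidableEq S] [MeasurableSpace S]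
    [DiscreteMeasurableSpace S]
    (P : ℝ → Matrix S S ℝ) (hP : IsSmoothControlledMatrix P)
    (π₀ : S → ℝ) (hπ₀ : IsInvariantPmf (P 0) π₀)
    (ν : Measure (ℤ → ℝ)) (hν : IsInputLaw ν) :
    -- (i) representation of the variance, for any stationary realization
    (∀ (ε : ℝ), 0 ≤ ε → ε < 1 →
      ∀ (Ω : Type v) [MeasurableSpace Ω] (μ : Measure Ω) (ζ : ℤ → Ω → ℝ) (X : ℤ → Ω → S),
        IsStationaryRealization P ν ε μ ζ X →
      ∀ ℓ : S → ℝ,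
        (∀ h : ℕ → ℝ, Summable (fun k => |h k|) →
          -- the variance of QoS is the average of its PSD, as soon as the PSD exists
          ((Summable fun k => |autocov μ (qos h ℓ X) k|) →
            ∀ t : ℤ, (Var[qos h ℓ X t; μ] : ℂ) =
              spectralAverage (psd (autocov μ (qos h ℓ X)))) ∧
          -- which is the case when `L` has a PSD
          ((Summable fun k => |autocov μ (loadSignal ℓ X) k|) →
            (Summable fun k => |autocov μ (qos h ℓ X) k|) ∧
            ∀ θ : ℝ, psd (autocov μ (qos h ℓ X)) θ =
              (‖freqResponse h θ‖ : ℂ) ^ 2 * psd (autocov μ (loadSignal ℓ X)) θ)) ∧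
        -- moving window
        ((Summable fun k => |autocov μ (loadSignal ℓ X) k|) →
          ∀ t : ℤ, Tendsto
            (fun T : ℕ => ((Var[qos (windowResponse T) ℓ X t; μ] / T : ℝ) : ℂ))
            atTop (𝓝 (psd (autocov μ (loadSignal ℓ X)) 0)))) ∧
    -- (ii) second-order expansion; `R₂` and its Fourier series `S_D⁽²⁾` depend on `P`, `ν` only
    (∃ R₂ : ℤ → Matrix S S ℝ,
      (∀ i j, Summable fun k => |R₂ k i j|) ∧
      -- expansion of the second-order statistics of `D`, uniformly in the lag
      (∀ δ : ℝ, 0 < δ → ∃ ε₀ : ℝ, 0 < ε₀ ∧ ∀ ε : ℝ, 0 ≤ ε → ε < ε₀ →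
        ∀ (Ω : Type v) [MeasurableSpace Ω] (μ : Measure Ω) (ζ : ℤ → Ω → ℝ) (X : ℤ → Ω → S),
          IsStationaryRealization P ν ε μ ζ X →
        ∀ (k : ℤ) (i j : S),
          |autocovMatrix μ (drivingNoise P ζ X) k i j
            - (nominalNoiseCov (P 0) π₀ k i j + ε ^ 2 * R₂ k i j)| ≤ δ * ε ^ 2) ∧
      -- expansion of the PSD of `D`, uniformly in the frequency, when the autocovariance of `D`
      -- decays geometrically, with constants that do not depend on `ε`
      (∀ b ρ : ℝ, |ρ| < 1 → ∀ δ : ℝ, 0 < δ → ∃ ε₀ : ℝ, 0 < ε₀ ∧ ∀ ε : ℝ, 0 ≤ ε → ε < ε₀ →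
        ∀ (Ω : Type v) [MeasurableSpace Ω] (μ : Measure Ω) (ζ : ℤ → Ω → ℝ) (X : ℤ → Ω → S),
          IsStationaryRealization P ν ε μ ζ X →
          (∀ (k : ℤ) (i j : S),
            |autocovMatrix μ (drivingNoise P ζ X) k i j| ≤ b * ρ ^ k.natAbs) →
        ∀ (θ : ℝ) (i j : S),
          ‖psdMatrix (autocovMatrix μ (drivingNoise P ζ X)) θ i j
            - (psdMatrix (nominalNoiseCov (P 0) π₀) θ i j
                + (ε : ℂ) ^ 2 * psdMatrix R₂ θ i j)‖ ≤ δ * ε ^ 2) ∧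
      -- expansion of the variance of QoS
      (∀ (ℓ : S → ℝ) (h : ℕ → ℝ), Summable (fun k => |h k|) →
        ∃ V₀ V₂ : ℝ,
          (V₀ : ℂ) = spectralAverage
            (linearModelPsd (P 0) π₀ ℓ h (psdMatrix (nominalNoiseCov (P 0) π₀))) ∧
          (V₂ : ℂ) = spectralAverage (linearModelPsd (P 0) π₀ ℓ h (psdMatrix R₂)) ∧
          ∀ δ : ℝ, 0 < δ → ∃ ε₀ : ℝ, 0 < ε₀ ∧ ∀ ε : ℝ, 0 ≤ ε → ε < ε₀ →
            ∀ (Ω : Type v) [MeasurableSpace Ω] (μ : Measure Ω) (ζ : ℤ → Ω → ℝ) (X : ℤ → Ω → S),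
              IsStationaryRealization P ν ε μ ζ X →
            ∀ t : ℤ, |Var[qos h ℓ X t; μ] - (V₀ + ε ^ 2 * V₂)| ≤ δ * ε ^ 2)) := by
  classical
  refine ⟨?_, ?_⟩
  · intro ε _ _ Ω _ μ ζ X hr ℓ
    have := hr.prob
    refine ⟨fun h hh => ⟨fun hs t => ?_, fun hs => ?_⟩, fun hs t => ?_⟩
    · rw [spectralAverage_psd hs, hr.variance_qos hh, hr.autocov_qos hh]
    · rw [hr.autocov_qos hh]
      exact ⟨summable_abs_filteredCov hh hs, psd_filteredCov hh hs⟩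
    · simp only [hr.variance_qos (summable_windowResponse _)]
      exact tendsto_filteredCov_window hs
  · obtain ⟨G₂, hG₂, ε₁, hε₁, C, hC, hexp⟩ :=
      IsStationaryRealization.exists_expansion.{v, _} hP hπ₀ hν
    have hA := summable_norm_vecMulCLM_pow (hP.stochastic 0) hP.irreducible hP.aperiodic hπ₀
    have hR₂ := summable_noiseCov (P 0 - constRows π₀) hG₂
    refine ⟨noiseCov (P 0 - constRows π₀) G₂, hR₂, fun δ hδ => ?_, fun b ρ hρ δ hδ => ?_,
      fun ℓ h hh => ?_⟩
    · refine ⟨min ε₁ (δ / (C + 1)), lt_min hε₁ (by positivity), ?_⟩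
      intro ε hε hlt Ω _ μ ζ X hr k i j
      exact (hexp ε hε (hlt.trans_le (min_le_left _ _)) Ω μ ζ X hr k i j).2.trans
        (mul_pow_three_le hC hε (hlt.trans_le (min_le_right _ _)))
    · have hr0 : ∀ k, 0 ≤ ∑ i, ∑ j, |noiseCov (P 0 - constRows π₀) G₂ k i j| := fun k =>
        Finset.sum_nonneg fun i _ => Finset.sum_nonneg fun j _ => abs_nonneg _
      obtain ⟨ε₂, hε₂, hsum⟩ := exists_tsum_le hC (abs_nonneg b) (abs_nonneg ρ) hρ hr0
        (summable_sum fun i _ => summable_sum fun j _ => hR₂ i j) hδ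
      refine ⟨min ε₁ ε₂, lt_min hε₁ hε₂, ?_⟩
      intro ε hε hlt Ω _ μ ζ X hr hgeo θ i j
      obtain ⟨hes, hle⟩ := hsum ε hε (hlt.trans_le (min_le_right _ _)) _
        (fun k => (hexp ε hε (hlt.trans_le (min_le_left _ _)) Ω μ ζ X hr k i j).2)
        -- Away from lag zero the nominal covariance vanishes, so the error is bounded by the
        -- geometric hypothesis plus ε² times the summable second-order term.
        (fun k hk => by
          have h1 := abs_le_of_geometric (R := fun k =>
            autocovMatrix μ (drivingNoise P ζ X) k i j) (fun k => hgeo k i j) k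
          have h2 : |noiseCov (P 0 - constRows π₀) G₂ k i j| ≤
              ∑ i, ∑ j, |noiseCov (P 0 - constRows π₀) G₂ k i j| :=
            abs_apply_le_entrySum (noiseCov (P 0 - constRows π₀) G₂ k) i j
          simp only [nominalNoiseCov, if_neg hk, Matrix.zero_apply, zero_add]
          refine (abs_sub _ _).trans (add_le_add h1 ?_)
          rw [abs_mul, abs_of_nonneg (sq_nonneg ε)]
          exact mul_le_mul_of_nonneg_left h2 (sq_nonneg ε))
      have hRD : Summable fun k => |autocovMatrix μ (drivingNoise P ζ X) k i j| :=
        Summable.of_nonneg_of_le (fun _ => abs_nonneg _)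
          (abs_le_of_geometric fun k => hgeo k i j)
          ((summable_pow_natAbs (abs_nonneg ρ) hρ).mul_left |b|)
      have key := norm_psd_sub_le hRD (summable_nominalNoiseCov (P 0) π₀ i j) (hR₂ i j) (ε ^ 2) θ
        hes
      rw [Complex.ofReal_pow] at key
      exact key.trans hle
    · have hG₀ : ∀ i j, Summable fun k => |nominalStateCov (P 0 - constRows π₀) π₀ k i j| :=
        summable_twoSided fun i => summable_norm_pow_apply hA (stateCov π₀ i)
      -- The white nominal noise is the driving noise of the nominal state covariance, so one
      -- formula evaluates both spectral averages.
      have hN : nominalNoiseCov (P 0) π₀ =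
          noiseCov (P 0 - constRows π₀) (nominalStateCov (P 0 - constRows π₀) π₀) :=
        funext fun k => (noiseCov_nominalStateCov hπ₀.2.1 hπ₀.2.2 k).symm
      refine ⟨filteredCov h (quadCov ℓ (nominalStateCov (P 0 - constRows π₀) π₀)) 0,
        filteredCov h (quadCov ℓ G₂) 0, ?_, ?_, fun δ hδ => ?_⟩
      · rw [hN, spectralAverage_linearModelPsd hA ℓ hh hG₀]
      · rw [spectralAverage_linearModelPsd hA ℓ hh hG₂]
      · obtain ⟨g₀, hg₀⟩ := exists_abs_apply_le hG₀
        obtain ⟨g₂, hg₂⟩ := exists_abs_apply_le hG₂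
        set K := (∑' k, |h k|) ^ 2 * ((∑ i, ∑ j, |ℓ i * ℓ j|) * C) with hK
        have hK0 : 0 ≤ K := by positivity
        refine ⟨min ε₁ (δ / (K + 1)), lt_min hε₁ (by positivity), ?_⟩
        intro ε hε hlt Ω _ μ ζ X hr t
        have := hr.prob
        rw [hr.variance_qos hh, hr.autocov_loadSignal]
        -- The state expansion is applied directly, bypassing D: sup-norm control over lags suffices
        -- since h is in ℓ¹.
        refine (abs_filteredCov_quadCov_sub_le hh ℓ (abs_indicatorCov_le μ X) hg₀ hg₂
          fun k i j => (hexp ε hε (hlt.trans_le (min_le_left _ _)) Ω μ ζ X hr k i j).1).trans ?_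
        calc _ = K * ε ^ 3 := by rw [hK]; ring
          _ ≤ δ * ε ^ 2 := mul_pow_three_le hK0 hε (hlt.trans_le (min_le_right _ _))
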